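/- **Setting.** Let $(X,dx)$ be a $\sigma$-finite measure space (for instance a smooth manifold with a smooth measure), $N\in\mathbb N$, and $\mathcal H=L^2(X;\mathbb C^N)$. Let $\hat H$ be an operator in $\mathcal H$ such that $-\hat H$ generates a strongly continuous semigroup $\Omega(t)=e^{-t\hat H}$, $t\ge 0$, with $\|\Omega(t)\|=O(e^{-kt})$ as $t\to+\infty$ for some $k>0$. All integrals of operators below are strong integrals, and $\langle\cdot,\cdot\rangle$ is conjugate-linear in the first argument. **Backward propagation.** Given bounded operators $\hat K(t)$, $|t|\le t_0$, write $S(t)=\Omega(-t)\hat K(t)$ for bounded operators with $S(t)=\Omega(|t|)\hat K(t)$ if $t\le 0$ and $\Omega(t)S(t)=\hat K(t)$ if $t\ge 0$. (If $\Omega$ extends to a group this is just the product.) We say that $\mathcal L$ can be formed if such an $S$ is given with $t\mapsto S(t)v$ integrable on $[-t_0,t_0]$ for every $v\in\mathcal H$. The operators $$\mathcal L=\int_{|t|\le t_0}\Omega(-t)\hat K(t)\,dt,\qquad \Pi=\int_0^\infty \Omega(s)\,\mathcal L\,\Omega^\star(s)\,ds$$ are then part of the claims below. **I. Generalized sources.**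 Let ${\bf f}$ be a generalized random field on $X\times\mathbb R$ with values in $\mathbb C^N$: an almost surely conjugate-linear family of square integrable random variables $\langle h,{\bf f}\rangle$, $h\in L^2(\mathbb R;\mathcal H)=L^2(X\times\mathbb R;\mathbb C^N)$. Let its law be invariant under time translations and ergodic (every event of path space that is invariant, up to null sets, under each time translation has probability $0$ or $1$). The causal solution ${\bf u}(t)=\int_0^\infty\Omega(s){\bf f}(t-s)\,ds$ of $\frac{d{\bf u}}{dt}+\hat H{\bf u}={\bf f}$ is defined by letting $\langle\varphi,{\bf u}(t)\rangle$ be the pairing of ${\bf f}$ with the test function equal to $\Omega^\star(t-r)\varphi$ at time $r<t$ and to $0$ at time $r\ge t$. (a) Suppose that $\mathbb E({\bf f}(x,s)\otimes{\bf f}(y,s')^\star)=K(x,y,s-s')$, in the sense that $$\mathbb E\big(\langle h,{\bf f}\rangle\overline{\langle g,{\bf f}\rangle}\big)=\iint\langle h(s),\hat K(s-s')g(s')\rangle\,ds\,ds',$$ where $\hat K(\sigma)$, the operator with Schwartz kernel $K(\cdot,\cdot,\sigma)$, is a bounded operator on $\mathcal H$, strongly measurable in $\sigma$, with norm dominated by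 an integrable function of $\sigma$. Then for all $\varphi,\psi\in\mathcal H$ the processes $\langle\varphi,{\bf u}(t)\rangle$, $\langle\psi,{\bf u}(t)\rangle$ have versions measurable in $(t,\omega)$, and for all such versions and all $\tau\in\mathbb R$ the limit $$C_{\varphi,\psi}(\tau)=\lim_{T\to+\infty}\frac1T\int_0^T\langle\varphi,{\bf u}(t)\rangle\,\overline{\langle\psi,{\bf u}(t-\tau)\rangle}\,dt$$ exists almost surely and is deterministic. (It is the distribution kernel $C_{A,B}(\tau)$ tested on $\varphi(A),\psi(B)$.) For $\tau>0$, $$C_{\varphi,\psi}(\tau)=\int_0^\infty ds\int_{-\infty}^{s+\tau}d\sigma\,\langle\varphi,\Omega(s+\tau-\sigma)\hat K(\sigma)\Omega^\star(s)\psi\rangle,$$ with absolute convergence, and $C_{\varphi,\psi}(-\tau)=\overline{C_{\psi,\varphi}(\tau)}$ for all $\tau$. If $\hat K(t)=0$ for $|t|\ge t_0>0$ and $\mathcal L$ can be formed, then $\mathcal L$ and $\Pi$ exist as bounded operators, and for all $\tau>t_0$ $$C_{\varphi,\psi}(\tau)=\langle\varphi,\Omega(\tau)\Pi\psi\rangle,\qquad\text{i.e.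 } C_{A,B}(\tau)=[\Omega(\tau)\Pi](A,B)$$ as Schwartz kernels. (b) Suppose instead that ${\bf f}$ is white in time, $K(x,y,\sigma)=L(x,y)\delta(\sigma)$, i.e. $\mathbb E(\langle h,{\bf f}\rangle\overline{\langle g,{\bf f}\rangle})=\int\langle h(s),\hat Lg(s)\rangle\,ds$ with $\hat L$ bounded on $\mathcal H$. Then the limits $C_{\varphi,\psi}(\tau)$ exist as in (a), $C_{\varphi,\psi}(-\tau)=\overline{C_{\psi,\varphi}(\tau)}$, and for all $\tau>0$, with absolute convergence of the first integral, $$C_{\varphi,\psi}(\tau)=\int_0^\infty\langle\varphi,\Omega(s+\tau)\hat L\,\Omega^\star(s)\psi\rangle\,ds=\langle\varphi,\Omega(\tau)\Pi\psi\rangle,\qquad \Pi=\int_0^\infty\Omega(s)\mathcal L\,\Omega^\star(s)\,ds,\quad \mathcal L=\hat L.$$ **II. Function-valued sources and kernels.** Let $P(t,x,y)$ be a measurable matrix-valued function which for each $t>0$ is the Schwartz kernel of $\Omega(t)$. Let ${\bf f}(x,t)$ be a jointly measurable random function with square integrable values and $\mathbb E({\bf f}(x,s)\otimes{\bf f}(y,s')^\star)=K(x,y,s-s')$,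 whose law is stationary and ergodic under time translations. Here a function $k$ is the Schwartz kernel of a bounded operator $R$ if $X$ is exhausted, up to a null set, by an increasing sequence of measurable sets $D_n$ of finite measure such that $k$ is integrable on each $D_n\times D_n$ and $\langle\varphi,R\psi\rangle=\iint\varphi(x)^\star k(x,y)\psi(y)\,dx\,dy$ for bounded $\varphi,\psi$ supported in one $D_n$. Put ${\bf u}(x,t)=\int_0^\infty ds\int_X P(s,x,y){\bf f}(y,t-s)\,dy$, and call $x$ admissible if $\int_0^\infty ds\int_X|P(s,x,y)|\,(\operatorname{tr}K(y,y,0))^{1/2}\,dy<\infty$. For all admissible $A,B$ and all $\tau\in\mathbb R$ the limit $$C_{A,B}(\tau)=\lim_{T\to+\infty}\frac1T\int_0^T{\bf u}(A,t)\otimes{\bf u}(B,t-\tau)^\star\,dt$$ exists almost surely and is deterministic, $C_{A,B}(-\tau)=C_{B,A}(\tau)^\star$, and for $\tau>0$, with absolute convergence, $$C_{A,B}(\tau)=\int_0^\infty ds\int_{-\infty}^{s+\tau}d\sigma\int_{X\times X}dx\,dy\;P(s+\tau-\sigma,A,x)\,K(x,y,\sigma)\,P^\star(s,B,y).$$ If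 moreover almost every point is admissible, $K(x,y,t)=0$ for $|t|\ge t_0>0$, the functions $K(\cdot,\cdot,\sigma)$ are the Schwartz kernels of bounded operators $\hat K(\sigma)$ that are strongly measurable in $\sigma$ with norm dominated by an integrable function of $\sigma$, and $\mathcal L$ can be formed, then $\mathcal L$ and $\Pi$ exist as bounded operators, and for every $\tau>t_0$ the function $(A,B)\mapsto C_{A,B}(\tau)$ is the Schwartz kernel of $\Omega(\tau)\Pi$. -/

import Mathlib

open MeasureTheory Set Filter Topology
open scoped ComplexConjugate

namespace PassiveImaging

noncomputable section

/-! ### State space, semigroup and Schwartz kernels -/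

/-- The Hilbert space `L²(X; ℂᴺ)`. -/
abbrev VecL2 {X : Type*} [MeasurableSpace X] (N : ℕ) (μ : Measure X) : Type _ :=
  Lp (EuclideanSpace ℂ (Fin N)) 2 μ

/-- `Ω(t) = exp(-t Hop)` for `t ≥ 0`: the family `Ω` is a strongly continuous semigroup of bounded
operators on `E` and `-Hop` is its infinitesimal generator (with its full domain).
The values `Ω t` for `t < 0` carry no meaning. -/
structure IsExpSemigroup {E : Type*} [NormedAddCommGroup E] [NormedSpace ℂ E]
    (Hop : E →ₗ.[ℂ] E) (Ω : ℝ → E →L[ℂ] E) : Prop where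
  zero : Ω 0 = 1
  add : ∀ s t : ℝ, 0 ≤ s → 0 ≤ t → Ω (s + t) = Ω s ∘L Ω t
  cont : ∀ v : E, ContinuousOn (fun t => Ω t v) (Ici 0)
  generator : ∀ v w : E, (v, w) ∈ Hop.graph ↔
    Tendsto (fun t : ℝ => ((t : ℂ)⁻¹) • (v - Ω t v)) (𝓝[>] 0) (𝓝 w)

/-- Attenuation: `‖Ω(t)‖ = O(e^{-kt})` for some `k > 0`. -/
def DecaysExponentially {E : Type*} [NormedAddCommGroup E] [NormedSpace ℂ E]
    (Ω : ℝ → E →L[ℂ] E) : Prop :=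
  ∃ k : ℝ, 0 < k ∧ (fun t => ‖Ω t‖) =O[atTop] (fun t => Real.exp (-k * t))

/-- `R = ∫_I F(t) dt` as a strongly convergent integral of bounded operators. -/
def IsStrongIntegral {E : Type*} [NormedAddCommGroup E] [NormedSpace ℂ E]
    (I : Set ℝ) (F : ℝ → E →L[ℂ] E) (R : E →L[ℂ] E) : Prop :=
  ∀ v : E, IntegrableOn (fun t => F t v) I ∧ R v = ∫ t in I, F t v

/-- `S(t) = Ω(-t) K(t)` for `|t| ≤ t₀`. For `t ≤ 0` this is a product of two operators. For `t ≥ 0`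
the operator `Ω(-t)` is the inverse of `Ω(t)`, and `S(t)` is a bounded operator with
`Ω(t) S(t) = K(t)`. If `Ω` extends to a group, `S(t)` is the product `Ω(-t) K(t)` for all `t`. -/
structure IsBackward {E : Type*} [NormedAddCommGroup E] [NormedSpace ℂ E]
    (Ω K : ℝ → E →L[ℂ] E) (t₀ : ℝ) (S : ℝ → E →L[ℂ] E) : Prop where
  nonpos : ∀ t ∈ Icc (-t₀) 0, S t = Ω (-t) ∘L K t
  nonneg : ∀ t ∈ Icc 0 t₀, Ω t ∘L S t = K t

/-- The function `k` is the (matrix-valued) Schwartz kernel of the operator `R` on `L²(X; ℂᴺ)`: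
`k` is integrable on `D n × D n` for an exhaustion `D n` of `X` by sets of finite measure, and
`⟨φ, R ψ⟩ = ∫∫ φ(x)^* k(x,y) ψ(y) dx dy` for all bounded `φ, ψ` supported in some `D n`. -/
def HasKernel {X : Type*} [MeasurableSpace X] {N : ℕ} (μ : Measure X)
    (R : VecL2 N μ →L[ℂ] VecL2 N μ) (k : X → X → Matrix (Fin N) (Fin N) ℂ) : Prop :=
  ∃ D : ℕ → Set X, Monotone D ∧ (∀ n, MeasurableSet (D n)) ∧ (∀ n, μ (D n) < ⊤) ∧
    (∀ᵐ x ∂μ, ∃ n, x ∈ D n) ∧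
    (∀ n i j, IntegrableOn (fun p : X × X => k p.1 p.2 i j) (D n ×ˢ D n) (μ.prod μ)) ∧
    ∀ (n : ℕ) (φ ψ : VecL2 N μ),
      (∀ᵐ x ∂μ, x ∉ D n → φ x = 0) → (∀ᵐ x ∂μ, x ∉ D n → ψ x = 0) →
      (∃ M : ℝ, ∀ᵐ x ∂μ, ‖φ x‖ ≤ M) → (∃ M : ℝ, ∀ᵐ x ∂μ, ‖ψ x‖ ≤ M) →
      inner ℂ φ (R ψ) =
        ∫ p : X × X, ∑ i, ∑ j, conj (φ p.1 i) * k p.1 p.2 i j * ψ p.2 j ∂(μ.prod μ)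

/-! ### Stationary and ergodic families of random variables -/

/-- The family `g` of random variables, indexed by `I`, is stationary for the action `θ` of `ℝ` on
the index set: its joint law is invariant. -/
def IsStationaryFamily {I V Ω₀ : Type*} [MeasurableSpace V] [MeasurableSpace Ω₀]
    (ℙ : Measure Ω₀) (θ : ℝ → I → I) (g : I → Ω₀ → V) : Prop :=
  ∀ t : ℝ, MeasurePreserving (fun (F : I → V) (i : I) => F (θ t i))
    (ℙ.map fun ω i => g i ω) (ℙ.map fun ω i => g i ω)

/-- The family `g` is ergodic for the action `θ`: an event of path space that is invariant, up to
null sets, under every time translation has probability `0` or `1`. -/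
def IsErgodicFamily {I V Ω₀ : Type*} [MeasurableSpace V] [MeasurableSpace Ω₀]
    (ℙ : Measure Ω₀) (θ : ℝ → I → I) (g : I → Ω₀ → V) : Prop :=
  ∀ A : Set (I → V), MeasurableSet A →
    (∀ t : ℝ, (fun (F : I → V) (i : I) => F (θ t i)) ⁻¹' A =ᵐ[ℙ.map fun ω i => g i ω] A) →
    (ℙ.map fun ω i => g i ω) A = 0 ∨ (ℙ.map fun ω i => g i ω) Aᶜ = 0

/-- Almost surely, `(1/T) ∫₀ᵀ U(t) conj (V(t-τ)) dt` tends to `c` as `T → +∞`. -/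
def HasTimeCorrelation {Ω₀ : Type*} [MeasurableSpace Ω₀] (ℙ : Measure Ω₀)
    (U V : ℝ → Ω₀ → ℂ) (τ : ℝ) (c : ℂ) : Prop :=
  ∀ᵐ ω ∂ℙ,
    (∀ T : ℝ, 0 < T →
      IntervalIntegrable (fun t => U t ω * conj (V (t - τ) ω)) volume 0 T) ∧
    Tendsto (fun T : ℝ => ((1 / T : ℝ) : ℂ) * ∫ t in (0 : ℝ)..T, U t ω * conj (V (t - τ) ω))
      atTop (𝓝 c)

/-! ### Generalized random fields on `X × ℝ` -/

/-- Space-time test functions: `L²(X × ℝ; ℂᴺ)`, written as `L²(ℝ; L²(X; ℂᴺ))`. -/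
abbrev SpaceTimeL2 {X : Type*} [MeasurableSpace X] (N : ℕ) (μ : Measure X) : Type _ :=
  Lp (VecL2 N μ) 2 (volume : Measure ℝ)

/-- Time translation `(timeShift t h)(r) = h(r - t)` of test functions. -/
def timeShift {X : Type*} [MeasurableSpace X] {N : ℕ} {μ : Measure X} (t : ℝ)
    (h : SpaceTimeL2 N μ) : SpaceTimeL2 N μ :=
  Lp.compMeasurePreserving (fun r : ℝ => r - t) (measurePreserving_sub_right volume t) h

/-- A generalized random field `f` on `X × ℝ` with values in `ℂᴺ` and with second moments. The
random variable `f h` is the pairing `⟨h, f⟩ = ∫∫ h(x,r)^* f(x,r) dx dr`, so it is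
conjugate-linear in the test function `h`. -/
structure IsGeneralizedField {X Ω₀ : Type*} [MeasurableSpace X] [MeasurableSpace Ω₀] {N : ℕ}
    {μ : Measure X} (ℙ : Measure Ω₀) (f : SpaceTimeL2 N μ → Ω₀ → ℂ) : Prop where
  measurable : ∀ h, Measurable (f h)
  memLp : ∀ h, MemLp (f h) 2 ℙ
  add : ∀ h k, f (h + k) =ᵐ[ℙ] f h + f k
  smul : ∀ (c : ℂ) h, f (c • h) =ᵐ[ℙ] conj c • f h

/-- Admissible correlation operators `K(σ)`, `σ ∈ ℝ`: strongly measurable in `σ`, with norm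
dominated by an integrable function of `σ`. -/
structure IsCorrelationFamily {E : Type*} [NormedAddCommGroup E] [NormedSpace ℂ E]
    (K : ℝ → E →L[ℂ] E) : Prop where
  measurable : ∀ v : E, AEStronglyMeasurable (fun σ => K σ v) volume
  bound : ∃ g : ℝ → ℝ, Integrable g ∧ ∀ᵐ σ : ℝ, ‖K σ‖ ≤ g σ

/-- `𝔼(f(x,s) ⊗ f(y,s')^*) = K(x,y,s-s')`, tested on `h` and `k`, where `K(σ)` is the operator
with Schwartz kernel `K(x,y,σ)`. -/
def HasCorrelation {X Ω₀ : Type*} [MeasurableSpace X] [MeasurableSpace Ω₀] {N : ℕ}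
    {μ : Measure X} (ℙ : Measure Ω₀) (f : SpaceTimeL2 N μ → Ω₀ → ℂ)
    (K : ℝ → VecL2 N μ →L[ℂ] VecL2 N μ) : Prop :=
  ∀ h k : SpaceTimeL2 N μ, ∫ ω, f h ω * conj (f k ω) ∂ℙ =
    ∫ p : ℝ × ℝ, inner ℂ (h p.1) (K (p.1 - p.2) (k p.2))

/-- `𝔼(f(x,s) ⊗ f(y,s')^*) = L(x,y) δ(s-s')`, tested on `h` and `k`, where `L` is the operator
with Schwartz kernel `L(x,y)`. -/
def HasWhiteCorrelation {X Ω₀ : Type*} [MeasurableSpace X] [MeasurableSpace Ω₀] {N : ℕ}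
    {μ : Measure X} (ℙ : Measure Ω₀) (f : SpaceTimeL2 N μ → Ω₀ → ℂ)
    (L : VecL2 N μ →L[ℂ] VecL2 N μ) : Prop :=
  ∀ h k : SpaceTimeL2 N μ, ∫ ω, f h ω * conj (f k ω) ∂ℙ =
    ∫ s : ℝ, inner ℂ (h s) (L (k s))

/-- `U(t) = ⟨φ, u(·,t)⟩` (as a process measurable in time and chance), where `u` is the causal
solution `u(·,t) = ∫₀^∞ Ω(s) f(·,t-s) ds`: transposing, `⟨φ, u(·,t)⟩` is the pairing of `f` with the
test function equal to `Ω(t-r)^* φ` at time `r < t` and to `0` at time `r ≥ t`. -/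
def IsCausalField {X Ω₀ : Type*} [MeasurableSpace X] [MeasurableSpace Ω₀] {N : ℕ}
    {μ : Measure X} (ℙ : Measure Ω₀) (Ω : ℝ → VecL2 N μ →L[ℂ] VecL2 N μ)
    (f : SpaceTimeL2 N μ → Ω₀ → ℂ) (φ : VecL2 N μ) (U : ℝ → Ω₀ → ℂ) : Prop :=
  Measurable (Function.uncurry U) ∧
  ∀ t : ℝ, ∃ h : SpaceTimeL2 N μ,
    (∀ᵐ r : ℝ, h r = (Iio t).indicator
      (fun r => ContinuousLinearMap.adjoint (Ω (t - r)) φ) r) ∧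
    U t =ᵐ[ℙ] f h

/-- `C φ ψ τ = ∫∫ φ(A)^* C_{A,B}(τ) ψ(B) dA dB`, the correlation of the causal field, tested on
`φ` and `ψ`: the almost sure limit of `(1/T) ∫₀ᵀ ⟨φ,u(t)⟩ conj ⟨ψ,u(t-τ)⟩ dt`. -/
def IsFieldCorrelation {X Ω₀ : Type*} [MeasurableSpace X] [MeasurableSpace Ω₀] {N : ℕ}
    {μ : Measure X} (ℙ : Measure Ω₀) (Ω : ℝ → VecL2 N μ →L[ℂ] VecL2 N μ)
    (f : SpaceTimeL2 N μ → Ω₀ → ℂ) (C : VecL2 N μ → VecL2 N μ → ℝ → ℂ) : Prop :=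
  (∀ φ, ∃ U, IsCausalField ℙ Ω f φ U) ∧
  ∀ φ ψ U V, IsCausalField ℙ Ω f φ U → IsCausalField ℙ Ω f ψ V →
    ∀ τ : ℝ, HasTimeCorrelation ℙ U V τ (C φ ψ τ)

/-! ### Function-valued random fields on `X × ℝ` -/

/-- `f` is a random function on `X × ℝ` with values in `ℂᴺ`, with second moments and with
`𝔼(f(x,s) ⊗ f(y,s')^*) = K(x,y,s-s')`. -/
structure IsFunctionField {X Ω₀ : Type*} [MeasurableSpace X] [MeasurableSpace Ω₀] {N : ℕ}
    (ℙ : Measure Ω₀) (f : X × ℝ → Ω₀ → Fin N → ℂ)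
    (K : X → X → ℝ → Matrix (Fin N) (Fin N) ℂ) : Prop where
  measurable : Measurable (Function.uncurry f)
  memLp : ∀ p i, MemLp (fun ω => f p ω i) 2 ℙ
  correlation : ∀ x y s s' i j,
    ∫ ω, f (x, s) ω i * conj (f (y, s') ω j) ∂ℙ = K x y (s - s') i j

/-- The causal solution `u(x,t) = ∫₀^∞ ds ∫_X P(s,x,y) f(y,t-s) dy`. -/
def causalSolution {X Ω₀ : Type*} [MeasurableSpace X] {N : ℕ} (μ : Measure X)
    (P : ℝ → X → X → Matrix (Fin N) (Fin N) ℂ) (f : X × ℝ → Ω₀ → Fin N → ℂ)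
    (x : X) (t : ℝ) (ω : Ω₀) : Fin N → ℂ :=
  ∫ s in Ioi (0 : ℝ), ∫ y, (P s x y).mulVec (f (y, t - s) ω) ∂μ

/-- The integral that defines the causal solution at the point `x` converges absolutely in mean
square: `∫₀^∞ ds ∫_X |P(s,x,y)| 𝔼(|f(y,0)|²)^{1/2} dy < ∞`, where `𝔼(|f(y,0)|²) = tr K(y,y,0)`. -/
def CausalIntegrable {X : Type*} [MeasurableSpace X] {N : ℕ} (μ : Measure X)
    (P : ℝ → X → X → Matrix (Fin N) (Fin N) ℂ)
    (K : X → X → ℝ → Matrix (Fin N) (Fin N) ℂ) (x : X) : Prop :=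
  Integrable (fun p : ℝ × X =>
      (∑ i, ∑ j, ‖P p.1 x p.2 i j‖) * Real.sqrt (K p.2 p.2 0).trace.re)
    ((volume.restrict (Ioi (0 : ℝ))).prod μ)

end

end PassiveImaging

/-!
The time averages in the statement are replaced by expectations, and the expectations are computed
from the correlation of the source by Fubini's theorem.

**Ergodic theorem.** The source is a point of path space, on which time translations act. These
translations are not jointly measurable in time and path, so the flow is never integrated over time
on path space. Instead, a process `Z` that is measurable in `(t, ω)` is described by a function `Y`
on path space with `Z t = Y ∘ Θ t` almost surely for each `t` (`IsGeneratedBy`), and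
`exists_isGeneratedBy_integral` shows that integrals of such processes over parameters are again of
this kind. The pointwise ergodic theorem (`ae_tendsto_timeAverage`) then follows from the maximal
inequality for the time-one map: the event that the upper limit of the averages exceeds a number
above the mean is invariant under all translations, so its probability is `0` or `1`, and the
maximal inequality excludes `1`. It is applied to `U(t) conj V(t-τ)` (`hasTimeCorrelation`).

**Generalized sources.** The pairings `⟨φ, u(t)⟩` are the values of the source on the translates of
the fixed test function `r ↦ Ω(-r)^* φ`, `r < 0` (`causalTest`). Translations are continuous on
`L²` and the source is bounded in mean square, so these pairings are uniformly continuous in mean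
square and have measurable versions. The formula for the correlation is the substitution
`s = -p₂ - τ`, `σ = p₁ - p₂` in the correlation form of the source. Measurability of the integrands
rests on strong continuity of the adjoint semigroup (`tendsto_adjoint_zero`).

**The operator `Π`.** Strong integrals of operators are bounded by the closed graph theorem
(`exists_isStrongIntegral`). If the correlation of the source vanishes for `|σ| ≥ t₀` and `τ > t₀`,
then `Ω(s+τ-σ) K(σ) = Ω(s+τ) S(σ)`, so the integral over `σ` gives `Ω(s+τ) 𝓛` and the integral
over `s` gives `Ω(τ) Π` (`exists_backward_sandwich`).

**Sources that are functions.** By the Cauchy–Schwarz inequality `|K(x,y,σ)| ≤ r(x) r(y)`, where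
`r` is the root mean square of the source. After the substitution `σ = τ + s₂ - s₁` the integrand of
`C_{A,B}(τ)` is therefore dominated by a product of a function of `(s₁, x)` and a function of
`(s₂, y)`, both integrable at admissible points. The same bound gives the last claim: `X` is
exhausted by sets on which the total weight of admissible points is bounded, and for test functions
`φ`, `ψ` on these sets both `∫∫ φ^* C_{A,B}(τ) ψ` and the operator formula reduce to one integral
of `K` against the functions `Ω(s₁)^* φ` and `Ω(s₂)^* ψ`
(`integral_kernelForm_pointCorrelation`, `integral_causalRegion_eq`). This uses that `Ω(s)^* φ` is
given by the kernel of `Ω(s)` wherever `r` does not vanish (`HasKernel.ae_adjoint_eq`).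
-/

namespace PassiveImaging

open ContinuousLinearMap (adjoint)

noncomputable section

/-! ### The maximal ergodic inequality -/

/-- The maximal function `max (0, f, f + f ∘ T, …)` of the first `n` Birkhoff sums of `f`. -/
def maxBirkhoffSum {W : Type*} (T : W → W) (f : W → ℝ) : ℕ → W → ℝ
  | 0 => fun _ => 0
  | n + 1 => fun w => max 0 (f w + maxBirkhoffSum T f n (T w))

lemma maxBirkhoffSum_nonneg {W : Type*} (T : W → W) (f : W → ℝ) (n : ℕ) (w : W) :
    0 ≤ maxBirkhoffSum T f n w := by
  cases n with
  | zero => exact le_rfl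
  | succ n => exact le_max_left _ _

lemma maxBirkhoffSum_le_succ {W : Type*} (T : W → W) (f : W → ℝ) (n : ℕ) (w : W) :
    maxBirkhoffSum T f n w ≤ maxBirkhoffSum T f (n + 1) w := by
  induction n generalizing w with
  | zero => exact maxBirkhoffSum_nonneg T f 1 w
  | succ n ih => exact max_le_max le_rfl (by gcongr; exact ih (T w))

lemma birkhoffSum_le_maxBirkhoffSum {W : Type*} (T : W → W) (f : W → ℝ) (n : ℕ) (w : W) :
    birkhoffSum T f n w ≤ maxBirkhoffSum T f n w := by
  induction n generalizing w with
  | zero => simp [maxBirkhoffSum]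
  | succ n ih =>
    rw [birkhoffSum_succ']
    exact le_max_of_le_right (by gcongr; exact ih (T w))

lemma integrable_maxBirkhoffSum {W : Type*} [MeasurableSpace W] {ν : Measure W}
    [IsFiniteMeasure ν] {T : W → W} (hT : MeasurePreserving T ν ν) {f : W → ℝ}
    (hf : Integrable f ν) (n : ℕ) : Integrable (maxBirkhoffSum T f n) ν := by
  induction n with
  | zero => exact integrable_zero _ _ _
  | succ n ih => exact (integrable_zero _ _ _).sup (hf.add (hT.integrable_comp_of_integrable ih))

lemma measurable_maxBirkhoffSum {W : Type*} [MeasurableSpace W] {T : W → W} (hT : Measurable T)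
    {f : W → ℝ} (hf : Measurable f) (n : ℕ) : Measurable (maxBirkhoffSum T f n) := by
  induction n with
  | zero => exact measurable_const
  | succ n ih => exact measurable_const.max (hf.add (ih.comp hT))

/-- Garsia's form of the maximal ergodic inequality. -/
lemma setIntegral_maxBirkhoffSum_pos_nonneg {W : Type*} [MeasurableSpace W] {ν : Measure W}
    [IsFiniteMeasure ν] {T : W → W} (hT : MeasurePreserving T ν ν) {f : W → ℝ}
    (hfm : Measurable f) (hf : Integrable f ν) (n : ℕ) :
    0 ≤ ∫ w in {w | 0 < maxBirkhoffSum T f (n + 1) w}, f w ∂ν := by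
  set M := maxBirkhoffSum T f
  have hM := integrable_maxBirkhoffSum hT hf
  have hms : MeasurableSet {w | 0 < M (n + 1) w} :=
    measurableSet_lt measurable_const (measurable_maxBirkhoffSum hT.measurable hfm _)
  have hMT : Integrable (fun w => M n (T w)) ν := hT.integrable_comp_of_integrable (hM n)
  have h1 : ∫ w in {w | 0 < M (n + 1) w}, f w ∂ν =
      ∫ w in {w | 0 < M (n + 1) w}, (M (n + 1) w - M n (T w)) ∂ν := by
    refine setIntegral_congr_fun hms fun w hw => ?_
    have hw' : 0 < max 0 (f w + M n (T w)) := hw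
    have : M (n + 1) w = f w + M n (T w) := by
      change max 0 (f w + M n (T w)) = _
      rcases lt_max_iff.1 hw' with h | h
      · exact absurd h (lt_irrefl _)
      · exact max_eq_right h.le
    simp only [this]; ring
  rw [h1, integral_sub (hM (n + 1)).integrableOn hMT.integrableOn]
  have h2 : ∫ w in {w | 0 < M (n + 1) w}, M (n + 1) w ∂ν = ∫ w, M (n + 1) w ∂ν := by
    refine setIntegral_eq_integral_of_forall_compl_eq_zero fun w hw => ?_
    exact le_antisymm (not_lt.1 hw) (maxBirkhoffSum_nonneg T f _ w)
  have h3 : ∫ w in {w | 0 < M (n + 1) w}, M n (T w) ∂ν ≤ ∫ w, M n (T w) ∂ν :=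
    setIntegral_le_integral hMT (ae_of_all _ fun w => maxBirkhoffSum_nonneg T f n (T w))
  have h4 : ∫ w, M n (T w) ∂ν = ∫ w, M n w ∂ν := by
    have := hT.map_eq
    rw [← integral_map hT.measurable.aemeasurable
      (by rw [hT.map_eq]; exact (hM n).aestronglyMeasurable), hT.map_eq]
  have h5 : ∫ w, M n w ∂ν ≤ ∫ w, M (n + 1) w ∂ν :=
    integral_mono (hM n) (hM (n + 1)) (maxBirkhoffSum_le_succ T f n)
  linarith

/-- If almost every orbit has a positive Birkhoff sum, then the mean is nonnegative. -/
lemma integral_nonneg_of_exists_birkhoffSum_pos {W : Type*} [MeasurableSpace W] {ν : Measure W}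
    [IsFiniteMeasure ν] {T : W → W} (hT : MeasurePreserving T ν ν) {f : W → ℝ}
    (hfm : Measurable f) (hf : Integrable f ν) (h : ∀ᵐ w ∂ν, ∃ n, 0 < birkhoffSum T f n w) :
    0 ≤ ∫ w, f w ∂ν := by
  set M := maxBirkhoffSum T f
  have hmono : Monotone fun n => {w | 0 < M (n + 1) w} :=
    monotone_nat_of_le_succ fun n w hw => lt_of_lt_of_le hw (maxBirkhoffSum_le_succ T f _ w)
  have hlim := tendsto_setIntegral_of_monotone (μ := ν) (f := f)
    (fun n => measurableSet_lt measurable_const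
      (measurable_maxBirkhoffSum hT.measurable hfm (n + 1))) hmono hf.integrableOn
  have huniv : (⋃ n, {w | 0 < M (n + 1) w}) =ᵐ[ν] univ := by
    rw [ae_eq_univ, ← mem_ae_iff]
    filter_upwards [h] with w ⟨n, hn⟩
    refine mem_iUnion.2 ⟨n, ?_⟩
    exact hn.trans_le ((birkhoffSum_le_maxBirkhoffSum T f n w).trans
      (maxBirkhoffSum_le_succ T f n w))
  rw [setIntegral_congr_set huniv, setIntegral_univ] at hlim
  exact ge_of_tendsto' hlim fun n => setIntegral_maxBirkhoffSum_pos_nonneg hT hfm hf n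

/-! ### Ergodic flows on path space -/

/-- A measurable map `π` to a space `W` ("path space") on which a flow `Θ` preserves the law of `π`
and acts ergodically. No joint measurability of the flow in time is required. -/
structure IsErgodicPathFlow {Ω₀ W : Type*} [MeasurableSpace Ω₀] [MeasurableSpace W]
    (ℙ : Measure Ω₀) (π : Ω₀ → W) (Θ : ℝ → W → W) : Prop where
  measurable : Measurable π
  zero : ∀ w, Θ 0 w = w
  add : ∀ s t w, Θ (s + t) w = Θ s (Θ t w)
  preserving : ∀ t, MeasurePreserving (Θ t) (ℙ.map π) (ℙ.map π)
  ergodic : ∀ A : Set W, MeasurableSet A → (∀ t, Θ t ⁻¹' A =ᵐ[ℙ.map π] A) →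
    ℙ.map π A = 0 ∨ ℙ.map π Aᶜ = 0

/-- The process `Z` is the stationary process `Y ∘ Θ t ∘ π` generated by the function `Y` on path
space, up to a null set for each time. -/
def IsGeneratedBy {Ω₀ W E : Type*} [MeasurableSpace Ω₀] (ℙ : Measure Ω₀) (π : Ω₀ → W)
    (Θ : ℝ → W → W) (Z : ℝ → Ω₀ → E) (Y : W → E) : Prop :=
  ∀ t, Z t =ᵐ[ℙ] fun ω => Y (Θ t (π ω))

/-- An integral of random variables that are measurable, up to null sets, with respect to a
sub-`σ`-algebra `m` is again of this kind. -/
lemma integral_ae_eq_condExp {Ω₀ α E : Type*} {m m₀ : MeasurableSpace Ω₀} {mα : MeasurableSpace α}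
    [NormedAddCommGroup E] [NormedSpace ℝ E] [CompleteSpace E] {ℙ : Measure Ω₀}
    [IsProbabilityMeasure ℙ] (hm : m ≤ m₀) {μ : Measure α} [SFinite μ] {u : α → Ω₀ → E}
    (hu : Integrable (Function.uncurry u) (μ.prod ℙ))
    (hum : ∀ᵐ a ∂μ, AEStronglyMeasurable[m] (u a) ℙ) :
    (fun ω => ∫ a, u a ω ∂μ) =ᵐ[ℙ] ℙ[fun ω => ∫ a, u a ω ∂μ | m] := by
  have hv : Integrable (fun ω => ∫ a, u a ω ∂μ) ℙ := hu.integral_prod_right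
  set v : Ω₀ → E := fun ω => ∫ a, u a ω ∂μ
  refine hv.ae_eq_of_forall_setIntegral_eq _ _ integrable_condExp fun s hs _ => ?_
  set w : Ω₀ → ℝ := ℙ[s.indicator (fun _ => (1 : ℝ)) | m]
  have hI : Integrable (s.indicator (fun _ => (1 : ℝ))) ℙ := (integrable_const 1).indicator hs
  have hwm : StronglyMeasurable[m] w := stronglyMeasurable_condExp
  have hwb : ∀ᵐ ω ∂ℙ, ‖w ω‖ ≤ 1 := by
    refine ae_bdd_abs_condExp_of_ae_bdd_abs (R := 1) (ae_of_all _ fun ω => ?_)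
    by_cases h : ω ∈ s <;> simp [h]
  have hsm : ∀ g : Ω₀ → E, s.indicator (fun _ => (1 : ℝ)) • g = s.indicator g := by
    intro g; ext ω; by_cases h : ω ∈ s <;> simp [h]
  have hwsm : ∀ g : Ω₀ → E, Integrable g ℙ → Integrable (w • g) ℙ := fun g hg =>
    hg.bdd_smul 1 (hwm.mono hm).aestronglyMeasurable hwb
  have key : ∀ g : Ω₀ → E, AEStronglyMeasurable[m] g ℙ → Integrable g ℙ →
      ∫ ω in s, g ω ∂ℙ = ∫ ω, w ω • g ω ∂ℙ := by
    intro g hg hgi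
    have h := condExp_smul_of_aestronglyMeasurable_right (m := m) hI
      (by rw [hsm]; exact hgi.indicator hs) hg
    rw [← integral_indicator hs, ← hsm, ← integral_condExp hm, integral_congr_ae h]
    rfl
  rw [key _ stronglyMeasurable_condExp.aestronglyMeasurable integrable_condExp]
  have h2 : ∫ ω, w ω • (ℙ[v | m]) ω ∂ℙ = ∫ ω, w ω • v ω ∂ℙ := by
    have h := condExp_smul_of_aestronglyMeasurable_left (m := m) hwm.aestronglyMeasurable
      (hwsm v hv) hv
    rw [← integral_condExp (μ := ℙ) (f := fun ω => w ω • v ω) hm]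
    exact (integral_congr_ae h).symm
  rw [h2]
  have h3 : ∫ ω, w ω • v ω ∂ℙ = ∫ ω, ∫ a, w ω • u a ω ∂μ ∂ℙ := by
    congr 1; ext ω; rw [integral_smul]
  have hw2 : Integrable (fun p : α × Ω₀ => w p.2 • u p.1 p.2) (μ.prod ℙ) := by
    refine hu.bdd_smul (φ := fun p : α × Ω₀ => w p.2) 1 ?_ ?_
    · exact ((hwm.mono hm).comp_measurable measurable_snd).aestronglyMeasurable
    · exact Measure.quasiMeasurePreserving_snd.ae hwb
  have hr : Integrable (Function.uncurry u) (μ.prod (ℙ.restrict s)) := by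
    refine hu.mono_measure ?_
    exact Measure.prod_mono le_rfl Measure.restrict_le_self
  rw [h3, integral_integral_swap (f := fun ω a => w ω • u a ω) hw2.swap,
    integral_integral_swap (f := fun ω a => u a ω) hr.swap]
  refine integral_congr_ae ?_
  filter_upwards [hum, hu.prod_right_ae] with a ha hai
  exact key _ ha hai

namespace IsErgodicPathFlow

variable {Ω₀ W E : Type*} [MeasurableSpace Ω₀] [MeasurableSpace W] {ℙ : Measure Ω₀}
  {π : Ω₀ → W} {Θ : ℝ → W → W} [NormedAddCommGroup E]

lemma map_comp (hF : IsErgodicPathFlow ℙ π Θ) (t : ℝ) :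
    ℙ.map (fun ω => Θ t (π ω)) = ℙ.map π := by
  conv_rhs => rw [← (hF.preserving t).map_eq,
    Measure.map_map (hF.preserving t).measurable hF.measurable]
  rfl

lemma measurable_comp (hF : IsErgodicPathFlow ℙ π Θ) (t : ℝ) :
    Measurable fun ω => Θ t (π ω) :=
  (hF.preserving t).measurable.comp hF.measurable

lemma identDistrib (hF : IsErgodicPathFlow ℙ π Θ) (t : ℝ) :
    ProbabilityTheory.IdentDistrib (fun ω => Θ t (π ω)) π ℙ ℙ :=
  ⟨(hF.measurable_comp t).aemeasurable, hF.measurable.aemeasurable, hF.map_comp t⟩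

lemma integral_comp [NormedSpace ℝ E] (hF : IsErgodicPathFlow ℙ π Θ) {Y : W → E}
    (hY : StronglyMeasurable Y) (t : ℝ) : ∫ ω, Y (Θ t (π ω)) ∂ℙ = ∫ ω, Y (π ω) ∂ℙ := by
  rw [← integral_map (hF.measurable_comp t).aemeasurable hY.aestronglyMeasurable,
    hF.map_comp, integral_map hF.measurable.aemeasurable hY.aestronglyMeasurable]

lemma integrable_comp (hF : IsErgodicPathFlow ℙ π Θ) {Y : W → E} (hY : StronglyMeasurable Y)
    (hYi : Integrable (fun ω => Y (π ω)) ℙ) (t : ℝ) :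
    Integrable (fun ω => Y (Θ t (π ω))) ℙ := by
  have h1 := (integrable_map_measure (f := π) (g := Y) hY.aestronglyMeasurable
    hF.measurable.aemeasurable).2 hYi
  rw [← hF.map_comp t] at h1
  exact (integrable_map_measure hY.aestronglyMeasurable
    (hF.measurable_comp t).aemeasurable).1 h1

lemma neg_apply (hF : IsErgodicPathFlow ℙ π Θ) (t : ℝ) (w : W) : Θ (-t) (Θ t w) = w := by
  rw [← hF.add, neg_add_cancel, hF.zero]

lemma setIntegral_comp [NormedSpace ℝ E] (hF : IsErgodicPathFlow ℙ π Θ) {Y : W → E}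
    (hY : StronglyMeasurable Y) (t : ℝ) {S : Set W} (hS : MeasurableSet S) :
    ∫ ω in π ⁻¹' S, Y (Θ t (π ω)) ∂ℙ = ∫ ω in π ⁻¹' (Θ (-t) ⁻¹' S), Y (π ω) ∂ℙ := by
  have hS' : MeasurableSet (Θ (-t) ⁻¹' S) := (hF.preserving (-t)).measurable hS
  rw [← integral_indicator (hF.measurable hS), ← integral_indicator (hF.measurable hS')]
  have h := hF.integral_comp (hY.indicator hS') t
  have h' : ∀ ω, (Θ (-t) ⁻¹' S).indicator Y (π ω) =
      (π ⁻¹' (Θ (-t) ⁻¹' S)).indicator (fun ω => Y (π ω)) ω := fun ω => rfl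
  simp_rw [h'] at h
  rw [← h]
  congr 1
  ext ω
  have hiff : Θ t (π ω) ∈ Θ (-t) ⁻¹' S ↔ ω ∈ π ⁻¹' S := by
    rw [mem_preimage, hF.neg_apply, mem_preimage]
  by_cases hω : ω ∈ π ⁻¹' S
  · rw [indicator_of_mem hω, indicator_of_mem (hiff.2 hω)]
  · rw [indicator_of_notMem hω, indicator_of_notMem (mt hiff.1 hω)]

/-- Integrals over a parameter of processes generated by functions on path space are generated by
a function on path space. Both the process and its generator are tested against events of path
space, since the flow is not jointly measurable. -/
lemma exists_isGeneratedBy_integral [NormedSpace ℝ E] [CompleteSpace E] [IsProbabilityMeasure ℙ]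
    (hF : IsErgodicPathFlow ℙ π Θ) {α : Type*} [MeasurableSpace α] {μ : Measure α} [SFinite μ]
    {u : ℝ → α → Ω₀ → E} (hu : ∀ t, Integrable (Function.uncurry (u t)) (μ.prod ℙ))
    {y : α → W → E} (hy : ∀ a, StronglyMeasurable (y a))
    (hgen : ∀ t, ∀ᵐ a ∂μ, u t a =ᵐ[ℙ] fun ω => y a (Θ t (π ω))) :
    ∃ Y : W → E, StronglyMeasurable Y ∧
      IsGeneratedBy ℙ π Θ (fun t ω => ∫ a, u t a ω ∂μ) Y := by
  have hm : MeasurableSpace.comap π inferInstance ≤ ‹MeasurableSpace Ω₀› :=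
    hF.measurable.comap_le
  have hmeas : ∀ {g : W → E}, StronglyMeasurable g → ∀ t,
      StronglyMeasurable[MeasurableSpace.comap π inferInstance] fun ω =>
        g (Θ t (π ω)) := fun hg t =>
    (hg.comp_measurable (hF.preserving t).measurable).comp_measurable (comap_measurable π)
  have hv : ∀ t, AEStronglyMeasurable[MeasurableSpace.comap π inferInstance]
      (fun ω => ∫ a, u t a ω ∂μ) ℙ := fun t =>
    ⟨_, stronglyMeasurable_condExp, integral_ae_eq_condExp hm (hu t) (by
      filter_upwards [hgen t] with a ha
      exact ⟨_, hmeas (hy a) t, ha⟩)⟩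
  have hvi : ∀ t, Integrable (fun ω => ∫ a, u t a ω ∂μ) ℙ := fun t => (hu t).integral_prod_right
  obtain ⟨g, hg, hvg⟩ := hv 0
  obtain ⟨Y, hY, rfl⟩ := hg.exists_eq_measurable_comp
  have hYi : Integrable (fun ω => Y (π ω)) ℙ := (hvi 0).congr hvg
  refine ⟨Y, hY, fun t => ?_⟩
  have hYti := hF.integrable_comp hY hYi t
  refine ae_eq_of_forall_setIntegral_eq_of_sigmaFinite' hm (fun s _ _ => (hvi t).integrableOn)
    (fun s _ _ => hYti.integrableOn) ?_ (hv t) (hmeas hY t).aestronglyMeasurable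
  rintro s ⟨S, hS, rfl⟩ -
  have hS' : MeasurableSet (Θ (-t) ⁻¹' S) := (hF.preserving (-t)).measurable hS
  have swap : ∀ t (s : Set Ω₀), ∫ ω in s, ∫ a, u t a ω ∂μ ∂ℙ = ∫ a, ∫ ω in s, u t a ω ∂ℙ ∂μ := by
    intro t s
    have hr : Integrable (Function.uncurry (u t)) (μ.prod (ℙ.restrict s)) :=
      (hu t).mono_measure (Measure.prod_mono le_rfl Measure.restrict_le_self)
    exact integral_integral_swap (f := fun ω a => u t a ω) hr.swap
  rw [hF.setIntegral_comp hY t hS, swap]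
  have h0 : ∫ ω in π ⁻¹' (Θ (-t) ⁻¹' S), Y (π ω) ∂ℙ =
      ∫ ω in π ⁻¹' (Θ (-t) ⁻¹' S), ∫ a, u 0 a ω ∂μ ∂ℙ :=
    integral_congr_ae (ae_restrict_of_ae (hvg.mono fun ω h => h.symm))
  rw [h0, swap]
  refine integral_congr_ae ?_
  filter_upwards [hgen t, hgen 0] with a hat ha0
  calc ∫ ω in π ⁻¹' S, u t a ω ∂ℙ = ∫ ω in π ⁻¹' S, y a (Θ t (π ω)) ∂ℙ :=
        integral_congr_ae (ae_restrict_of_ae hat)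
    _ = ∫ ω in π ⁻¹' (Θ (-t) ⁻¹' S), y a (π ω) ∂ℙ := hF.setIntegral_comp (hy a) t hS
    _ = ∫ ω in π ⁻¹' (Θ (-t) ⁻¹' S), u 0 a ω ∂ℙ := by
        refine integral_congr_ae (ae_restrict_of_ae ?_)
        filter_upwards [ha0] with ω h
        rw [h, hF.zero]

/-- An integrable function grows sublinearly along almost every orbit. -/
lemma ae_tendsto_div_atTop_zero [IsProbabilityMeasure ℙ] (hF : IsErgodicPathFlow ℙ π Θ)
    {H : W → ℝ} (hH : Measurable H) (hHi : Integrable (fun ω => H (π ω)) ℙ) :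
    ∀ᵐ ω ∂ℙ, Tendsto (fun n : ℕ => H (Θ n (π ω)) / n) atTop (𝓝 0) := by
  have key : ∀ k : ℕ, ∀ᵐ ω ∂ℙ, ∀ᶠ n : ℕ in atTop, |H (Θ n (π ω))| * (k + 1) ≤ n := by
    intro k
    -- The Borel–Cantelli lemma: `∑ ℙ(|H| (k + 1) > n)` converges because `H` is integrable.
    let _ : MeasureSpace Ω₀ := ⟨ℙ⟩
    have : IsProbabilityMeasure (volume : Measure Ω₀) := ‹IsProbabilityMeasure ℙ›
    have hX : Integrable (fun ω => |H (π ω)| * (k + 1)) (volume : Measure Ω₀) :=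
      hHi.abs.mul_const _
    have hsum := ProbabilityTheory.tsum_prob_mem_Ioi_lt_top hX
      (fun ω => mul_nonneg (abs_nonneg _) (by positivity))
    have hmeasH : Measurable fun w => |H w| * ((k : ℝ) + 1) := hH.abs.mul_const _
    have heq : ∀ n : ℕ, ℙ {ω | |H (π ω)| * ((k : ℝ) + 1) ∈ Ioi (n : ℝ)} =
        ℙ {ω | |H (Θ n (π ω))| * ((k : ℝ) + 1) ∈ Ioi (n : ℝ)} := by
      intro n
      have h := ((hF.identDistrib n).comp hmeasH).measure_mem_eq (measurableSet_Ioi (a := (n : ℝ)))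
      exact h.symm
    have hsum' : ∑' n : ℕ, ℙ {ω | |H (Θ n (π ω))| * ((k : ℝ) + 1) ∈ Ioi (n : ℝ)} ≠ ⊤ := by
      simp_rw [← heq]
      exact hsum.ne
    filter_upwards [ae_eventually_notMem hsum'] with ω hω
    filter_upwards [hω] with n hn
    exact not_lt.1 hn
  filter_upwards [ae_all_iff.2 key] with ω hω
  rw [Metric.tendsto_nhds]
  intro ε hε
  obtain ⟨k, hk⟩ := exists_nat_one_div_lt hε
  filter_upwards [hω k, eventually_gt_atTop 0] with n hn hn0
  have hn0' : (0 : ℝ) < n := by exact_mod_cast hn0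
  rw [Real.dist_eq, sub_zero, abs_div, abs_of_pos hn0', div_lt_iff₀ hn0']
  have hk1 : (0 : ℝ) < k + 1 := by positivity
  calc |H (Θ n (π ω))| ≤ n / (k + 1) := (le_div_iff₀ hk1).2 hn
    _ = 1 / ((k : ℝ) + 1) * n := by ring
    _ < ε * n := by gcongr

lemma iterate_one (hF : IsErgodicPathFlow ℙ π Θ) (n : ℕ) (w : W) : (Θ 1)^[n] w = Θ n w := by
  induction n generalizing w with
  | zero => simp [hF.zero]
  | succ n ih => rw [Function.iterate_succ_apply, ih, ← hF.add]; norm_cast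

/-! ### Stationary processes in continuous time -/

/-- The processes generated by an integrable function are integrable over bounded time windows. -/
lemma integrable_window [IsProbabilityMeasure ℙ] (hF : IsErgodicPathFlow ℙ π Θ)
    [MeasurableSpace E] [BorelSpace E] [SecondCountableTopology E] {Z : ℝ → Ω₀ → E}
    (hZ : Measurable (Function.uncurry Z))
    {Y : W → E} (hY : StronglyMeasurable Y) (hYi : Integrable (fun ω => Y (π ω)) ℙ)
    (hgen : IsGeneratedBy ℙ π Θ Z Y) (a b t : ℝ) :
    Integrable (Function.uncurry fun r ω => Z (r + t) ω) ((volume.restrict (Ioc a b)).prod ℙ) := by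
  have hm : Measurable (Function.uncurry fun r ω => Z (r + t) ω) :=
    hZ.comp ((measurable_fst.add_const t).prodMk measurable_snd)
  refine (integrable_prod_iff hm.stronglyMeasurable.aestronglyMeasurable).2 ⟨?_, ?_⟩
  · exact ae_of_all _ fun r => (hF.integrable_comp hY hYi (r + t)).congr (hgen (r + t)).symm
  · have : ∀ r, ∫ ω, ‖Function.uncurry (fun r ω => Z (r + t) ω) (r, ω)‖ ∂ℙ =
        ∫ ω, ‖Y (π ω)‖ ∂ℙ := by
      intro r
      rw [← hF.integral_comp hY.norm (r + t)]
      exact integral_congr_ae ((hgen (r + t)).mono fun ω h => by simp only [Function.uncurry, h])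
    simp_rw [this]
    exact integrable_const _

lemma ae_intervalIntegrable [IsProbabilityMeasure ℙ] (hF : IsErgodicPathFlow ℙ π Θ)
    [MeasurableSpace E] [BorelSpace E] [SecondCountableTopology E] {Z : ℝ → Ω₀ → E}
    (hZ : Measurable (Function.uncurry Z))
    {Y : W → E} (hY : StronglyMeasurable Y) (hYi : Integrable (fun ω => Y (π ω)) ℙ)
    (hgen : IsGeneratedBy ℙ π Θ Z Y) :
    ∀ᵐ ω ∂ℙ, ∀ a b : ℝ, IntervalIntegrable (fun t => Z t ω) volume a b := by
  have h : ∀ n : ℕ, ∀ᵐ ω ∂ℙ, IntegrableOn (fun t => Z t ω) (Ioc (-n) n) := by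
    intro n
    have := (hF.integrable_window hZ hY hYi hgen (-n) n 0).prod_left_ae
    simpa [IntegrableOn] using this
  filter_upwards [ae_all_iff.2 h] with ω hω a b
  obtain ⟨n, hn⟩ := exists_nat_gt (max |a| |b|)
  have ha := abs_lt.1 ((le_max_left _ _).trans_lt hn)
  have hb := abs_lt.1 ((le_max_right _ _).trans_lt hn)
  refine intervalIntegrable_iff.2 ((hω n).mono_set fun x hx => ⟨?_, ?_⟩)
  · exact (lt_min ha.1 hb.1).trans hx.1
  · exact hx.2.trans (max_le ha.2.le hb.2.le)

/-- The integrals over windows of fixed length around `n` grow sublinearly, since they form a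
process that is generated by an integrable function. -/
lemma ae_tendsto_window_div [IsProbabilityMeasure ℙ] (hF : IsErgodicPathFlow ℙ π Θ)
    {Z : ℝ → Ω₀ → ℝ} (hZ : Measurable (Function.uncurry Z)) {Y : W → ℝ} (hY : Measurable Y)
    (hYi : Integrable (fun ω => Y (π ω)) ℙ) (hgen : IsGeneratedBy ℙ π Θ Z Y) (m : ℕ) :
    ∀ᵐ ω ∂ℙ, Tendsto (fun n : ℕ => (∫ r in (n - m : ℝ)..(n + m), |Z r ω|) / n) atTop (𝓝 0) := by
  have hgen' : IsGeneratedBy ℙ π Θ (fun t ω => |Z t ω|) (fun w => |Y w|) := fun t =>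
    (hgen t).mono fun ω h => by simp only [h]
  have hu := hF.integrable_window (Z := fun t ω => |Z t ω|) hZ.abs hY.abs.stronglyMeasurable
    hYi.abs hgen' (-m) m
  obtain ⟨H, hH, hHg⟩ := hF.exists_isGeneratedBy_integral hu
    (y := fun r w => |Y (Θ r w)|)
    (fun r => (hY.comp (hF.preserving r).measurable).abs.stronglyMeasurable)
    (fun t => ae_of_all _ fun r => (hgen' (r + t)).mono fun ω h => by simpa only [hF.add] using h)
  have hHi : Integrable (fun ω => H (π ω)) ℙ := by
    have := (hu 0).integral_prod_right
    exact this.congr ((hHg 0).mono fun ω h => by simpa only [hF.zero, Function.uncurry] using h)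
  filter_upwards [hF.ae_tendsto_div_atTop_zero hH.measurable hHi,
    ae_all_iff.2 fun n : ℕ => hHg n] with ω hω hn
  refine hω.congr fun n => ?_
  rw [← hn n, ← intervalIntegral.integral_of_le (by have : (0:ℝ) ≤ m := m.cast_nonneg; linarith),
    intervalIntegral.integral_comp_add_right (fun r => |Z r ω|)]
  congr 2 <;> ring

lemma frequently_lt_of_tendsto_sub_div {s s' : ℕ → ℝ} {q q' : ℝ} (hq : q' < q)
    (h : Tendsto (fun n : ℕ => (s n - s' n) / n) atTop (𝓝 0))
    (hs : ∃ᶠ n : ℕ in atTop, q * n < s n) :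
    ∃ᶠ n : ℕ in atTop, q' * n < s' n := by
  refine (hs.and_eventually ((h.eventually_lt_const (sub_pos.2 hq)).and
    (eventually_gt_atTop 0))).mono ?_
  rintro n ⟨h1, h2, h3⟩
  have hn0 : (0 : ℝ) < n := by exact_mod_cast h3
  rw [div_lt_iff₀ hn0] at h2
  nlinarith

/-- The upper half of the pointwise ergodic theorem. The event that the upper limit of the time
averages exceeds the mean is invariant, because shifting time changes the integrals over `[0, n]`
by `o(n)`; it cannot have full probability by the maximal inequality. -/
lemma ae_eventually_integral_le [IsProbabilityMeasure ℙ] (hF : IsErgodicPathFlow ℙ π Θ)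
    {Z : ℝ → Ω₀ → ℝ} (hZ : Measurable (Function.uncurry Z)) {Y : W → ℝ} (hY : Measurable Y)
    (hYi : Integrable (fun ω => Y (π ω)) ℙ) (hgen : IsGeneratedBy ℙ π Θ Z Y) {q : ℝ}
    (hq : ∫ ω, Y (π ω) ∂ℙ < q) :
    ∀ᵐ ω ∂ℙ, ∀ᶠ n : ℕ in atTop, ∫ t in (0 : ℝ)..n, Z t ω ≤ q * n := by
  have hu := hF.integrable_window hZ hY.stronglyMeasurable hYi hgen 0 1
  obtain ⟨Y₁, hY₁, hY₁g⟩ := hF.exists_isGeneratedBy_integral hu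
    (y := fun r w => Y (Θ r w))
    (fun r => (hY.comp (hF.preserving r).measurable).stronglyMeasurable)
    (fun t => ae_of_all _ fun r => (hgen (r + t)).mono fun ω h => by simpa only [hF.add] using h)
  have h0 : (fun ω => ∫ r in Ioc (0:ℝ) 1, Z (r + 0) ω) =ᵐ[ℙ] fun ω => Y₁ (π ω) :=
    (hY₁g 0).mono fun ω h => by simpa only [hF.zero] using h
  have hY₁i : Integrable (fun ω => Y₁ (π ω)) ℙ := (hu 0).integral_prod_right.congr h0
  have hmean : ∫ ω, Y₁ (π ω) ∂ℙ = ∫ ω, Y (π ω) ∂ℙ := by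
    rw [← integral_congr_ae h0,
      integral_integral_swap (f := fun ω (r : ℝ) => Z (r + 0) ω) (hu 0).swap]
    have : ∀ r : ℝ, ∫ ω, Z (r + 0) ω ∂ℙ = ∫ ω, Y (π ω) ∂ℙ := fun r => by
      rw [integral_congr_ae (hgen (r + 0)), hF.integral_comp hY.stronglyMeasurable]
    simp_rw [this]
    simp
  -- Birkhoff sums of `Y₁` are integrals of the process.
  have hsum : ∀ t : ℝ, ∀ᵐ ω ∂ℙ, ∀ n : ℕ,
      birkhoffSum (Θ 1) Y₁ n (Θ t (π ω)) = ∫ r in t..(t + n), Z r ω := by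
    intro t
    filter_upwards [ae_all_iff.2 fun n : ℕ => hY₁g (n + t),
      hF.ae_intervalIntegrable hZ hY.stronglyMeasurable hYi hgen] with ω hω hint n
    have h1 : ∀ k : ℕ, Y₁ ((Θ 1)^[k] (Θ t (π ω))) =
        ∫ r in (t + k : ℝ)..(t + (k + 1 : ℕ)), Z r ω := by
      intro k
      rw [hF.iterate_one, ← hF.add, ← hω k, ← intervalIntegral.integral_of_le zero_le_one,
        intervalIntegral.integral_comp_add_right (fun r => Z r ω)]
      congr 1
      · ring
      · push_cast; ring
    simp only [birkhoffSum, h1]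
    rw [intervalIntegral.sum_integral_adjacent_intervals (a := fun k : ℕ => t + (k : ℝ))
      fun k _ => hint _ _]
    simp
  obtain ⟨c, hc, hcq⟩ := exists_between hq
  set S : ℕ → W → ℝ := fun n => birkhoffSum (Θ 1) Y₁ n
  have hΘ1 := (hF.preserving 1).measurable
  have hSm : ∀ n, Measurable (S n) := fun n => by
    refine Finset.measurable_sum _ fun k _ => hY₁.measurable.comp ?_
    exact hΘ1.iterate k
  -- The rational threshold `p` is not fixed, so that an `o(n)` change of the sums preserves `A`.
  set A : Set W := {w | ∃ p : ℚ, c < p ∧ ∃ᶠ n : ℕ in atTop, (p : ℝ) * n < S n w}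
  have hA : MeasurableSet A := by
    refine MeasurableSet.congr (s := ⋃ p : ℚ, ⋃ _ : c < p,
      limsup (fun n : ℕ => {w | (p : ℝ) * n < S n w}) atTop) ?_ ?_
    · refine MeasurableSet.iUnion fun p => MeasurableSet.iUnion fun _ => ?_
      exact MeasurableSet.measurableSet_limsup fun n => measurableSet_lt measurable_const (hSm n)
    · ext w
      simp only [mem_iUnion, mem_limsup_iff_frequently_mem, A, mem_ofPred_eq, exists_prop]
  have hinv : ∀ t, Θ t ⁻¹' A =ᵐ[ℙ.map π] A := by
    intro t
    have hAt : MeasurableSet (Θ t ⁻¹' A) := (hF.preserving t).measurable hA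
    refine eventuallyEq_set.2 ?_
    refine (ae_map_iff hF.measurable.aemeasurable
      (p := fun w => w ∈ Θ t ⁻¹' A ↔ w ∈ A) (hAt.iff hA)).2 ?_
    obtain ⟨m, hm⟩ := exists_nat_gt |t|
    filter_upwards [hsum t, hsum 0, hF.ae_tendsto_window_div hZ hY hYi hgen m,
      hF.ae_intervalIntegrable hZ hY.stronglyMeasurable hYi hgen] with ω ht h0 hw hint
    have hdiff : Tendsto (fun n : ℕ => (S n (Θ t (π ω)) - S n (π ω)) / n) atTop (𝓝 0) := by
      have hz : Tendsto (fun n : ℕ => |∫ r in (0 : ℝ)..t, Z r ω| / n) atTop (𝓝 0) :=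
        tendsto_const_div_atTop_nhds_zero_nat _
      refine squeeze_zero_norm (fun n => ?_) (by simpa using hw.add hz)
      have e1 : S n (Θ t (π ω)) = ∫ r in t..(t + n), Z r ω := ht n
      have e2 : S n (π ω) = ∫ r in (0 : ℝ)..n, Z r ω := by
        have := h0 n
        rw [hF.zero, zero_add] at this
        exact this
      have e3 : S n (Θ t (π ω)) - S n (π ω) =
          (∫ r in (n : ℝ)..(t + n), Z r ω) - ∫ r in (0 : ℝ)..t, Z r ω := by
        have := intervalIntegral.integral_add_adjacent_intervals (hint 0 t) (hint t (t + n))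
        have := intervalIntegral.integral_add_adjacent_intervals (hint 0 n) (hint n (t + n))
        rw [e1, e2]; linarith
      rw [e3, norm_div, ← add_div, Real.norm_natCast]
      refine div_le_div_of_nonneg_right ?_ n.cast_nonneg
      refine (norm_sub_le _ _).trans (add_le_add ?_ le_rfl)
      have hat := abs_lt.1 hm
      refine (intervalIntegral.norm_integral_le_integral_norm_uIoc).trans ?_
      rw [intervalIntegral.integral_of_le (by linarith)]
      refine setIntegral_mono_set ?_ (ae_of_all _ fun _ => abs_nonneg _) ?_
      · exact ((intervalIntegrable_iff_integrableOn_Ioc_of_le (by linarith)).1 (hint _ _)).abs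
      · refine LE.le.eventuallyLE fun x hx => ⟨?_, ?_⟩
        · exact lt_of_le_of_lt (le_min (by linarith) (by linarith)) hx.1
        · exact hx.2.trans (max_le (by linarith) (by linarith))
    have hdiff' : Tendsto (fun n : ℕ => (S n (π ω) - S n (Θ t (π ω))) / n) atTop (𝓝 0) := by
      have := hdiff.neg
      rw [neg_zero] at this
      exact this.congr fun n => by ring
    constructor
    · rintro ⟨p, hp, hfreq⟩
      obtain ⟨p', hp', hpp⟩ := exists_rat_btwn hp
      exact ⟨p', hp', frequently_lt_of_tendsto_sub_div hpp hdiff hfreq⟩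
    · rintro ⟨p, hp, hfreq⟩
      obtain ⟨p', hp', hpp⟩ := exists_rat_btwn hp
      exact ⟨p', hp', frequently_lt_of_tendsto_sub_div hpp hdiff' hfreq⟩
  have hprob : IsProbabilityMeasure (ℙ.map π) :=
    Measure.isProbabilityMeasure_map hF.measurable.aemeasurable
  have hnull : ℙ.map π A = 0 := by
    rcases hF.ergodic A hA hinv with h | h
    · exact h
    exfalso
    have hfi : Integrable (fun w => Y₁ w - c) (ℙ.map π) :=
      ((integrable_map_measure hY₁.aestronglyMeasurable hF.measurable.aemeasurable).2 hY₁i).sub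
        (integrable_const c)
    have hpos := integral_nonneg_of_exists_birkhoffSum_pos (hF.preserving 1)
      (hY₁.measurable.sub_const c) hfi (by
        have hA' : ∀ᵐ w ∂(ℙ.map π), w ∈ A := h
        filter_upwards [hA'] with w ⟨p, hp, hfreq⟩
        obtain ⟨n, hn⟩ := hfreq.exists
        refine ⟨n, ?_⟩
        have : birkhoffSum (Θ 1) (fun w => Y₁ w - c) n w = S n w - n * c := by
          simp [birkhoffSum, S]
        rw [this]
        have hn0 : (0 : ℝ) ≤ n := n.cast_nonneg
        nlinarith)
    rw [integral_map hF.measurable.aemeasurable hfi.aestronglyMeasurable,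
      integral_sub hY₁i (integrable_const c), hmean] at hpos
    simp at hpos
    linarith
  have hnot : ∀ᵐ ω ∂ℙ, π ω ∉ A := by
    have : ∀ᵐ w ∂(ℙ.map π), w ∉ A := by
      rw [ae_iff]; simpa using hnull
    exact ae_of_ae_map hF.measurable.aemeasurable this
  filter_upwards [hnot, hsum 0] with ω hω hs
  obtain ⟨p, hp, hpq⟩ := exists_rat_btwn hcq
  have h1 : ¬ ∃ᶠ n : ℕ in atTop, (p : ℝ) * n < S n (π ω) := fun h => hω ⟨p, hp, h⟩
  filter_upwards [not_frequently.1 h1] with n hn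
  have h2 := hs n
  rw [hF.zero, zero_add] at h2
  rw [← h2]
  have hn0 : (0 : ℝ) ≤ n := n.cast_nonneg
  have h3 : S n (π ω) ≤ p * n := not_lt.1 hn
  exact h3.trans (by gcongr)

/-- The pointwise ergodic theorem for a real stationary process in continuous time. -/
lemma ae_tendsto_timeAverage_real [IsProbabilityMeasure ℙ] (hF : IsErgodicPathFlow ℙ π Θ)
    {Z : ℝ → Ω₀ → ℝ} (hZ : Measurable (Function.uncurry Z)) {Y : W → ℝ} (hY : Measurable Y)
    (hYi : Integrable (fun ω => Y (π ω)) ℙ) (hgen : IsGeneratedBy ℙ π Θ Z Y) :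
    ∀ᵐ ω ∂ℙ, Tendsto (fun T : ℝ => (1 / T) * ∫ t in (0 : ℝ)..T, Z t ω) atTop
      (𝓝 (∫ ω, Y (π ω) ∂ℙ)) := by
  set e := ∫ ω, Y (π ω) ∂ℙ
  have hup : ∀ k : ℕ, ∀ᵐ ω ∂ℙ, ∀ᶠ n : ℕ in atTop,
      ∫ t in (0 : ℝ)..n, Z t ω ≤ (e + 1 / (k + 1)) * n := fun k =>
    hF.ae_eventually_integral_le hZ hY hYi hgen (lt_add_of_pos_right _ (by positivity))
  have hneg : IsGeneratedBy ℙ π Θ (fun t ω => -Z t ω) (fun w => -Y w) := fun t =>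
    (hgen t).mono fun ω h => by simp only [h]
  have hlo : ∀ k : ℕ, ∀ᵐ ω ∂ℙ, ∀ᶠ n : ℕ in atTop,
      ∫ t in (0 : ℝ)..n, -Z t ω ≤ (-e + 1 / (k + 1)) * n := fun k =>
    hF.ae_eventually_integral_le (Z := fun t ω => -Z t ω) (Y := fun w => -Y w) hZ.neg hY.neg
      hYi.neg hneg (by rw [integral_neg]; exact lt_add_of_pos_right _ (by positivity))
  filter_upwards [ae_all_iff.2 hup, ae_all_iff.2 hlo, hF.ae_tendsto_window_div hZ hY hYi hgen 1,
    hF.ae_intervalIntegrable hZ hY.stronglyMeasurable hYi hgen] with ω hu hl hw hint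
  have hn : Tendsto (fun n : ℕ => (∫ t in (0 : ℝ)..n, Z t ω) / n) atTop (𝓝 e) := by
    rw [Metric.tendsto_nhds]
    intro ε hε
    obtain ⟨k, hk⟩ := exists_nat_one_div_lt hε
    filter_upwards [hu k, hl k, eventually_gt_atTop 0] with n h1 h2 h3
    have hn0 : (0 : ℝ) < n := by exact_mod_cast h3
    rw [intervalIntegral.integral_neg] at h2
    rw [Real.dist_eq, abs_lt]
    have h1' := (div_le_iff₀ hn0).2 h1
    have h2' := (div_le_iff₀ hn0).2 h2
    rw [neg_div] at h2'
    constructor <;> linarith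
  have hfl : Tendsto (fun T : ℝ => ⌊T⌋₊) atTop atTop := tendsto_nat_floor_atTop
  have hquot : Tendsto (fun T : ℝ => (⌊T⌋₊ : ℝ) / T) atTop (𝓝 1) := tendsto_nat_floor_div_atTop
  have hmain := (hn.comp hfl).mul hquot
  have herr : Tendsto (fun T : ℝ => (1 / T) * ∫ t in (⌊T⌋₊ : ℝ)..T, Z t ω) atTop (𝓝 0) := by
    refine squeeze_zero_norm' ?_ (by simpa [Function.comp_def] using (hw.comp hfl).mul hquot)
    filter_upwards [eventually_ge_atTop 1] with T hT
    have hT0 : (0 : ℝ) < T := by linarith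
    have hf0 : (0 : ℝ) < ⌊T⌋₊ := by exact_mod_cast Nat.floor_pos.2 hT
    have hle := Nat.floor_le hT0.le
    have hlt := Nat.lt_floor_add_one T
    rw [div_mul_div_comm, mul_comm _ (⌊T⌋₊ : ℝ), mul_div_mul_left _ _ hf0.ne', norm_mul,
      Real.norm_of_nonneg (by positivity), one_div, inv_mul_eq_div]
    refine div_le_div_of_nonneg_right ?_ hT0.le
    refine (intervalIntegral.norm_integral_le_integral_norm hle).trans ?_
    rw [intervalIntegral.integral_of_le hle, intervalIntegral.integral_of_le (by linarith)]
    refine setIntegral_mono_set ?_ (ae_of_all _ fun _ => abs_nonneg _) ?_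
    · exact ((intervalIntegrable_iff_integrableOn_Ioc_of_le (by linarith)).1 (hint _ _)).abs
    · exact LE.le.eventuallyLE fun x hx => ⟨by linarith [hx.1], by linarith [hx.2]⟩
  have h := hmain.add herr
  rw [mul_one, add_zero] at h
  refine h.congr' ?_
  filter_upwards [eventually_ge_atTop 1] with T hT
  have hf0 : (0 : ℝ) < ⌊T⌋₊ := by exact_mod_cast Nat.floor_pos.2 hT
  rw [Function.comp_apply, ← intervalIntegral.integral_add_adjacent_intervals
    (hint 0 (⌊T⌋₊ : ℝ)) (hint _ T)]
  field_simp

/-- The pointwise ergodic theorem for a complex stationary process in continuous time. -/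
lemma ae_tendsto_timeAverage [IsProbabilityMeasure ℙ] (hF : IsErgodicPathFlow ℙ π Θ)
    {Z : ℝ → Ω₀ → ℂ} (hZ : Measurable (Function.uncurry Z)) {Y : W → ℂ} (hY : Measurable Y)
    (hYi : Integrable (fun ω => Y (π ω)) ℙ) (hgen : IsGeneratedBy ℙ π Θ Z Y) :
    ∀ᵐ ω ∂ℙ, Tendsto (fun T : ℝ => ((1 / T : ℝ) : ℂ) * ∫ t in (0 : ℝ)..T, Z t ω) atTop
      (𝓝 (∫ ω, Y (π ω) ∂ℙ)) := by
  have hre := hF.ae_tendsto_timeAverage_real (Z := fun t ω => (Z t ω).re)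
    (Complex.measurable_re.comp hZ) (Complex.measurable_re.comp hY) hYi.re
    (fun t => (hgen t).mono fun ω h => by simp only [h, Function.comp_apply])
  have him := hF.ae_tendsto_timeAverage_real (Z := fun t ω => (Z t ω).im)
    (Complex.measurable_im.comp hZ) (Complex.measurable_im.comp hY) hYi.im
    (fun t => (hgen t).mono fun ω h => by simp only [h, Function.comp_apply])
  filter_upwards [hre, him, hF.ae_intervalIntegrable hZ hY.stronglyMeasurable hYi hgen]
    with ω h1 h2 hint
  have h3 := ((Complex.continuous_ofReal.tendsto _).comp h1).add
    (((Complex.continuous_ofReal.tendsto _).comp h2).mul_const Complex.I)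
  have e1 : (∫ ω, Y (π ω) ∂ℙ) = ((∫ ω, (Complex.re ∘ Y) (π ω) ∂ℙ : ℝ) : ℂ) +
      ((∫ ω, (Complex.im ∘ Y) (π ω) ∂ℙ : ℝ) : ℂ) * Complex.I :=
    (integral_re_add_im (𝕜 := ℂ) hYi).symm
  rw [e1]
  refine h3.congr fun T => ?_
  have hre' : ∫ t in (0 : ℝ)..T, (Z t ω).re = (∫ t in (0 : ℝ)..T, Z t ω).re :=
    Complex.reCLM.intervalIntegral_comp_comm (hint 0 T)
  have him' : ∫ t in (0 : ℝ)..T, (Z t ω).im = (∫ t in (0 : ℝ)..T, Z t ω).im :=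
    Complex.imCLM.intervalIntegral_comp_comm (hint 0 T)
  simp only [Function.comp_apply, hre', him']
  rw [Complex.ofReal_mul, Complex.ofReal_mul, mul_assoc, ← mul_add, Complex.re_add_im]

/-- The time correlation of two square integrable stationary processes exists and equals the
expectation of the product. -/
lemma hasTimeCorrelation [IsProbabilityMeasure ℙ] (hF : IsErgodicPathFlow ℙ π Θ)
    {U V : ℝ → Ω₀ → ℂ} (hU : Measurable (Function.uncurry U)) (hV : Measurable (Function.uncurry V))
    {F G : W → ℂ} (hFm : Measurable F) (hGm : Measurable G)
    (hUF : IsGeneratedBy ℙ π Θ U F) (hVG : IsGeneratedBy ℙ π Θ V G) {τ : ℝ}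
    (hint : Integrable (fun ω => F (π ω) * conj (G (Θ (-τ) (π ω)))) ℙ) :
    HasTimeCorrelation ℙ U V τ (∫ ω, F (π ω) * conj (G (Θ (-τ) (π ω))) ∂ℙ) := by
  have hm : Measurable (Function.uncurry fun t ω => U t ω * conj (V (t - τ) ω)) :=
    hU.mul (Complex.continuous_conj.measurable.comp
      (hV.comp ((measurable_fst.sub_const τ).prodMk measurable_snd)))
  have hYm : Measurable fun w => F w * conj (G (Θ (-τ) w)) :=
    hFm.mul (Complex.continuous_conj.measurable.comp (hGm.comp (hF.preserving _).measurable))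
  have hgen : IsGeneratedBy ℙ π Θ (fun t ω => U t ω * conj (V (t - τ) ω))
      (fun w => F w * conj (G (Θ (-τ) w))) := by
    intro t
    filter_upwards [hUF t, hVG (t - τ)] with ω h1 h2
    rw [h1, h2, ← hF.add, neg_add_eq_sub]
  filter_upwards [hF.ae_tendsto_timeAverage hm hYm hint hgen,
    hF.ae_intervalIntegrable hm hYm.stronglyMeasurable hint hgen] with ω h1 h2
  exact ⟨fun T _ => h2 0 T, h1⟩

end IsErgodicPathFlow

/-- The action of time translations on the paths of a stationary ergodic family. -/
lemma isErgodicPathFlow_of_family {I V Ω₀ : Type*} [MeasurableSpace V] [MeasurableSpace Ω₀]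
    {ℙ : Measure Ω₀} {θ : ℝ → I → I} {g : I → Ω₀ → V} (hg : ∀ i, Measurable (g i))
    (hzero : ∀ i, θ 0 i = i) (hadd : ∀ s t i, θ (s + t) i = θ s (θ t i))
    (hstat : IsStationaryFamily ℙ θ g) (herg : IsErgodicFamily ℙ θ g) :
    IsErgodicPathFlow ℙ (fun ω i => g i ω) (fun t (F : I → V) i => F (θ t i)) where
  measurable := measurable_pi_lambda _ hg
  zero w := by simp only [hzero]
  add s t w := by
    ext i
    change w (θ (s + t) i) = w (θ t (θ s i))
    rw [← hadd, add_comm]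
  preserving := hstat
  ergodic := herg

/-! ### Strong integrals of operators -/

/-- A family of bounded operators that is strongly integrable has a bounded strong integral, by the
closed graph theorem for `v ↦ F · v` as a map to `L¹`. -/
lemma exists_isStrongIntegral {E : Type*} [NormedAddCommGroup E] [NormedSpace ℂ E]
    [CompleteSpace E] {I : Set ℝ} {F : ℝ → E →L[ℂ] E}
    (hF : ∀ v, IntegrableOn (fun t => F t v) I) : ∃ R : E →L[ℂ] E, IsStrongIntegral I F R := by
  let T : E →ₗ[ℂ] (ℝ →₁[volume.restrict I] E) :=
    { toFun := fun v => (hF v).toL1 _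
      map_add' := fun v w => by
        refine Eq.trans ?_ (Integrable.toL1_add _ _ (hF v) (hF w))
        congr 1; ext t; simp
      map_smul' := fun c v => by
        refine Eq.trans ?_ (Integrable.toL1_smul _ (hF v) c)
        congr 1; ext t; simp }
  have hT : Continuous T := by
    refine T.continuous_of_seq_closed_graph fun u x y hu hTu => ?_
    have hm : TendstoInMeasure (volume.restrict I) (fun n => (T (u n) : ℝ → E)) atTop y :=
      tendstoInMeasure_of_tendsto_Lp hTu
    obtain ⟨ns, hns, hlim⟩ := hm.exists_seq_tendsto_ae
    refine Lp.ext ?_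
    have h1 : ∀ᵐ t ∂(volume.restrict I), ∀ n, (T (u n) : ℝ → E) t = F t (u n) :=
      ae_all_iff.2 fun n => (hF (u n)).coeFn_toL1
    filter_upwards [hlim, h1, (hF x).coeFn_toL1] with t ht h1 h2
    refine tendsto_nhds_unique ht ?_
    have h3 : Tendsto (fun n => F t (u (ns n))) atTop (𝓝 (F t x)) :=
      ((F t).continuous.tendsto x).comp (hu.comp hns.tendsto_atTop)
    simp only [h1]
    rw [show (T x : ℝ → E) t = F t x from h2]
    exact h3
  have hR : ∀ v, ∫ t in I, F t v = ∫ t, (T v : ℝ → E) t ∂(volume.restrict I) := fun v =>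
    integral_congr_ae (hF v).coeFn_toL1.symm
  let R : E →ₗ[ℂ] E :=
    { toFun := fun v => ∫ t in I, F t v
      map_add' := fun v w => by
        simp only [map_add]
        exact integral_add (hF v) (hF w)
      map_smul' := fun c v => by
        simp only [map_smul, RingHom.id_apply]
        exact integral_smul c _ }
  have hRc : Continuous R := by
    have : (R : E → E) = fun v => ∫ t, (T v : ℝ → E) t ∂(volume.restrict I) := funext hR
    rw [this]
    exact continuous_integral.comp hT
  exact ⟨⟨R, hRc⟩, fun v => ⟨hF v, rfl⟩⟩

/-! ### Exponentially decaying semigroups and their adjoints -/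

/-- The properties of a strongly continuous semigroup with exponential decay that are used below,
with explicit constants. -/
structure IsDecayingSemigroup {E : Type*} [NormedAddCommGroup E] [NormedSpace ℂ E]
    (Ω : ℝ → E →L[ℂ] E) (M k : ℝ) : Prop where
  zero : Ω 0 = 1
  add : ∀ s t : ℝ, 0 ≤ s → 0 ≤ t → Ω (s + t) = Ω s ∘L Ω t
  cont : ∀ v : E, ContinuousOn (fun t => Ω t v) (Ici 0)
  pos : 0 < k
  bound : ∀ t, 0 ≤ t → ‖Ω t‖ ≤ M * Real.exp (-k * t)

lemma IsExpSemigroup.exists_isDecayingSemigroup {E : Type*} [NormedAddCommGroup E]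
    [NormedSpace ℂ E] [CompleteSpace E] {Hop : E →ₗ.[ℂ] E} {Ω : ℝ → E →L[ℂ] E}
    (hΩ : IsExpSemigroup Hop Ω) (hdecay : DecaysExponentially Ω) :
    ∃ M k, IsDecayingSemigroup Ω M k := by
  obtain ⟨k, hk, hO⟩ := hdecay
  obtain ⟨c, hc⟩ := hO.bound
  obtain ⟨T, hT⟩ := eventually_atTop.1 hc
  obtain ⟨C, hC⟩ : ∃ C, ∀ t : Icc (0 : ℝ) T, ‖Ω t‖ ≤ C := by
    refine banach_steinhaus fun v => ?_
    obtain ⟨C, hC⟩ := isCompact_Icc.exists_bound_of_continuousOn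
      ((hΩ.cont v).mono fun t (ht : t ∈ Icc (0 : ℝ) T) => ht.1)
    exact ⟨C, fun t => hC t t.2⟩
  refine ⟨max |c| (|C| * Real.exp (k * |T|)), k, hΩ.zero, hΩ.add, hΩ.cont, hk, fun t ht => ?_⟩
  rcases le_total T t with h | h
  · have h1 := hT t h
    rw [Real.norm_of_nonneg (norm_nonneg _), Real.norm_of_nonneg (Real.exp_pos _).le] at h1
    refine h1.trans ?_
    gcongr
    exact (le_abs_self c).trans (le_max_left _ _)
  · refine (hC ⟨t, ht, h⟩).trans ((le_abs_self C).trans ?_)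
    have h2 : 1 ≤ Real.exp (k * |T|) * Real.exp (-k * t) := by
      rw [← Real.exp_add, Real.one_le_exp_iff]
      have : t ≤ |T| := h.trans (le_abs_self T)
      nlinarith
    calc |C| ≤ |C| * (Real.exp (k * |T|) * Real.exp (-k * t)) :=
          le_mul_of_one_le_right (abs_nonneg _) h2
      _ = |C| * Real.exp (k * |T|) * Real.exp (-k * t) := by ring
      _ ≤ _ := by gcongr; exact le_max_right _ _

namespace IsDecayingSemigroup

variable {E : Type*} [NormedAddCommGroup E] [InnerProductSpace ℂ E]
  {Ω : ℝ → E →L[ℂ] E} {M k : ℝ}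

lemma nonneg (h : IsDecayingSemigroup Ω M k) : 0 ≤ M := by
  have := (norm_nonneg _).trans (h.bound 0 le_rfl)
  simpa using this

lemma norm_le (h : IsDecayingSemigroup Ω M k) {t : ℝ} (ht : 0 ≤ t) : ‖Ω t‖ ≤ M := by
  refine (h.bound t ht).trans (mul_le_of_le_one_right h.nonneg ?_)
  rw [Real.exp_le_one_iff]
  nlinarith [h.pos]

/-- Strong continuity of `t ↦ Ω(t) w(t)` for continuous `w`. -/
lemma continuousOn_apply (h : IsDecayingSemigroup Ω M k) {w : ℝ → E}
    (hw : ContinuousOn w (Ici 0)) : ContinuousOn (fun t => Ω t (w t)) (Ici 0) := by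
  intro t₀ ht₀
  have h1 : Tendsto (fun t => Ω t (w t - w t₀)) (𝓝[Ici 0] t₀) (𝓝 0) := by
    have h2 : Tendsto (fun t => M * ‖w t - w t₀‖) (𝓝[Ici 0] t₀) (𝓝 0) := by
      have : Tendsto (fun t => w t - w t₀) (𝓝[Ici 0] t₀) (𝓝 0) := by
        simpa using (hw t₀ ht₀).tendsto.sub_const (w t₀)
      simpa using this.norm.const_mul M
    refine squeeze_zero_norm' ?_ h2
    filter_upwards [self_mem_nhdsWithin] with t ht
    exact ((Ω t).le_opNorm _).trans (by gcongr; exact h.norm_le ht)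
  have h3 := h1.add (h.cont (w t₀) t₀ ht₀).tendsto
  rw [zero_add] at h3
  refine h3.congr fun t => ?_
  rw [map_sub]; abel

lemma integrableOn_exp (h : IsDecayingSemigroup Ω M k) :
    IntegrableOn (fun s => Real.exp (-k * s)) (Ioi 0) :=
  integrableOn_exp_mul_Ioi (neg_lt_zero.2 h.pos) 0

variable [CompleteSpace E]

lemma adjoint_add (h : IsDecayingSemigroup Ω M k) {s t : ℝ} (hs : 0 ≤ s) (ht : 0 ≤ t) (v : E) :
    adjoint (Ω (s + t)) v = adjoint (Ω t) (adjoint (Ω s) v) := by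
  rw [h.add s t hs ht, ContinuousLinearMap.adjoint_comp]; rfl

lemma adjoint_norm_le (h : IsDecayingSemigroup Ω M k) {t : ℝ} (ht : 0 ≤ t) (v : E) :
    ‖adjoint (Ω t) v‖ ≤ M * ‖v‖ := by
  refine (ContinuousLinearMap.le_opNorm _ _).trans ?_
  rw [LinearIsometryEquiv.norm_map]
  gcongr
  exact h.norm_le ht

/-- The adjoint semigroup converges strongly to the identity at `0`. The vectors with this property
form a closed subspace. It contains the ranges of the adjoints of the averages
`∫₀^ε Ω(s) ds`, so a vector orthogonal to it is orthogonal to everything. -/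
lemma tendsto_adjoint_zero (h : IsDecayingSemigroup Ω M k) (v : E) :
    Tendsto (fun t => adjoint (Ω t) v) (𝓝[Ici 0] 0) (𝓝 v) := by
  let D : Submodule ℂ E :=
    { carrier := {v | Tendsto (fun t => adjoint (Ω t) v) (𝓝[Ici 0] 0) (𝓝 v)}
      add_mem' := fun {a b} ha hb => by
        change Tendsto _ _ _
        simp only [map_add]; exact Tendsto.add ha hb
      zero_mem' := by
        change Tendsto _ _ _
        simp only [map_zero]; exact tendsto_const_nhds
      smul_mem' := fun c x hx => by
        change Tendsto _ _ _
        simp only [map_smul]; exact Tendsto.const_smul hx c }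
  have hD : ∀ x, x ∈ D ↔ Tendsto (fun t => adjoint (Ω t) x) (𝓝[Ici 0] 0) (𝓝 x) := fun x => Iff.rfl
  have hclosed : IsClosed (D : Set E) := by
    refine isClosed_of_closure_subset fun x hx => ?_
    change Tendsto _ _ _
    rw [Metric.tendsto_nhds]
    intro ε hε
    have hM := h.nonneg
    obtain ⟨y, hy, hxy⟩ := Metric.mem_closure_iff.1 hx (ε / (M + 2)) (by positivity)
    have hy' := Metric.tendsto_nhds.1 ((hD y).1 hy) (ε / (M + 2)) (by positivity)
    filter_upwards [hy', self_mem_nhdsWithin] with t ht ht0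
    have e1 : dist (adjoint (Ω t) x) (adjoint (Ω t) y) ≤ M * dist x y := by
      rw [dist_eq_norm, dist_eq_norm, ← map_sub]
      exact h.adjoint_norm_le ht0 _
    calc dist (adjoint (Ω t) x) x
        ≤ dist (adjoint (Ω t) x) (adjoint (Ω t) y) + dist (adjoint (Ω t) y) y + dist y x :=
          dist_triangle4 _ _ _ _
      _ < M * (ε / (M + 2)) + ε / (M + 2) + ε / (M + 2) := by
          have e2 : M * dist x y ≤ M * (ε / (M + 2)) := by gcongr
          rw [dist_comm y x]
          linarith
      _ = ε := by field_simp; ring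
  have hint : ∀ (w : E) (a b : ℝ), 0 ≤ a → 0 ≤ b → IntervalIntegrable (fun s => Ω s w) volume a b :=
    fun w a b ha hb => ((h.cont w).mono fun s hs => (le_min ha hb).trans hs.1).intervalIntegrable
  have hA : ∀ ε : ℝ, 0 ≤ ε → ∃ R : E →L[ℂ] E, ∀ w, R w = ∫ s in (0 : ℝ)..ε, Ω s w := by
    intro ε hε
    obtain ⟨R, hR⟩ := exists_isStrongIntegral (I := Ioc 0 ε) (F := Ω)
      (fun w => (hint w 0 ε le_rfl hε).1)
    exact ⟨R, fun w => by rw [(hR w).2, intervalIntegral.integral_of_le hε]⟩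
  have hrange : ∀ (ε : ℝ) (hε : 0 ≤ ε) (R : E →L[ℂ] E), (∀ w, R w = ∫ s in (0 : ℝ)..ε, Ω s w) →
      ∀ x, adjoint R x ∈ D := by
    intro ε hε R hR x
    rw [hD]
    have hdiff : ∀ t, 0 ≤ t → ‖adjoint (Ω t) (adjoint R x) - adjoint R x‖ ≤ 2 * t * M * ‖x‖ := by
      intro t ht
      have h1 : ‖R ∘L Ω t - R‖ ≤ 2 * t * M := by
        have hM := h.nonneg
        refine ContinuousLinearMap.opNorm_le_bound _ (by positivity) fun w => ?_
        have e1 : R (Ω t w) = ∫ s in t..(ε + t), Ω s w := by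
          rw [hR, ← zero_add t, add_comm ε, zero_add, add_comm t ε]
          have := intervalIntegral.integral_comp_add_right (a := 0) (b := ε)
            (fun s => Ω s w) t
          rw [zero_add] at this
          rw [← this]
          refine intervalIntegral.integral_congr fun s hs => ?_
          rw [uIcc_of_le hε] at hs
          simp only [h.add s t hs.1 ht]; rfl
        have e2 : R (Ω t w) - R w =
            (∫ s in ε..(ε + t), Ω s w) - ∫ s in (0 : ℝ)..t, Ω s w := by
          have := intervalIntegral.integral_interval_sub_interval_comm
            (hint w t (ε + t) ht (by positivity)) (hint w 0 ε le_rfl hε) (hint w t 0 ht le_rfl)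
          rw [e1, hR w, this, intervalIntegral.integral_symm 0 t,
            intervalIntegral.integral_symm (ε + t) ε]
          abel
        have e3 : ∀ a b, 0 ≤ a → a ≤ b → ‖∫ s in a..b, Ω s w‖ ≤ M * ‖w‖ * |b - a| := by
          intro a b ha hab
          refine intervalIntegral.norm_integral_le_of_norm_le_const fun s hs => ?_
          rw [uIoc_of_le hab] at hs
          exact ((Ω s).le_opNorm w).trans (by gcongr; exact h.norm_le (ha.trans hs.1.le))
        change ‖R (Ω t w) - R w‖ ≤ _
        rw [e2]
        refine (norm_sub_le _ _).trans ?_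
        have e4 := e3 ε (ε + t) hε (by linarith)
        have e5 := e3 0 t le_rfl ht
        rw [add_sub_cancel_left, abs_of_nonneg ht] at e4
        rw [sub_zero, abs_of_nonneg ht] at e5
        linarith
      have h2 : adjoint (Ω t) (adjoint R x) - adjoint R x = adjoint (R ∘L Ω t - R) x := by
        rw [map_sub, ContinuousLinearMap.adjoint_comp]; rfl
      rw [h2]
      refine (ContinuousLinearMap.le_opNorm _ _).trans ?_
      rw [LinearIsometryEquiv.norm_map]
      gcongr
    rw [tendsto_iff_norm_sub_tendsto_zero]
    refine squeeze_zero' (Eventually.of_forall fun _ => norm_nonneg _)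
      (g := fun t => 2 * t * M * ‖x‖) ?_ ?_
    · filter_upwards [self_mem_nhdsWithin] with t ht using hdiff t ht
    · have : Tendsto (fun t : ℝ => 2 * t * M * ‖x‖) (𝓝 0) (𝓝 (2 * 0 * M * ‖x‖)) :=
        (by fun_prop : Continuous fun t : ℝ => 2 * t * M * ‖x‖).tendsto 0
      rw [mul_zero, zero_mul, zero_mul] at this
      exact this.mono_left nhdsWithin_le_nhds
  -- If `w` is orthogonal to the ranges, then `∫₀^ε Ω(s) w ds = 0` for all `ε`, and the derivative
  -- at `ε = 0` is `Ω(0) w = w`.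
  have horth : Dᗮ = ⊥ := by
    rw [Submodule.eq_bot_iff]
    intro w hw
    have hz : ∀ ε : ℝ, 0 < ε → ∫ s in (0 : ℝ)..ε, Ω s w = 0 := by
      intro ε hε
      obtain ⟨R, hR⟩ := hA ε hε.le
      rw [← hR]
      refine ext_inner_left ℂ fun x => ?_
      rw [← ContinuousLinearMap.adjoint_inner_left, inner_zero_right]
      exact (Submodule.mem_orthogonal D w).1 hw _ (hrange ε hε.le R hR x)
    have hcont : Continuous fun s => Ω (max s 0) w :=
      (h.cont w).comp_continuous (by fun_prop) fun s => mem_Ici.2 (le_max_right _ _)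
    have hder := intervalIntegral.integral_hasDerivAt_right
      (hcont.intervalIntegrable 0 0) (hcont.stronglyMeasurableAtFilter _ _) hcont.continuousAt
    have hder' := hder.hasDerivWithinAt (s := Ici 0)
    have hzero : HasDerivWithinAt (fun u => ∫ s in (0 : ℝ)..u, Ω (max s 0) w) 0 (Ici 0) 0 := by
      refine (hasDerivWithinAt_const (0 : ℝ) (Ici 0) (0 : E)).congr (fun u hu => ?_) (by simp)
      rcases eq_or_lt_of_le (show (0 : ℝ) ≤ u from hu) with rfl | hu'
      · simp
      rw [← hz u hu']
      refine intervalIntegral.integral_congr fun s hs => ?_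
      rw [uIcc_of_le hu'.le] at hs
      simp only [max_eq_left hs.1]
    have := (uniqueDiffWithinAt_Ici (0 : ℝ)).eq_deriv (Ici 0) hder' hzero
    rwa [max_self, h.zero] at this
  have htop : D = ⊤ := by
    have : CompleteSpace D := hclosed.completeSpace_coe
    exact (Submodule.orthogonal_eq_bot_iff).1 horth
  have : v ∈ D := htop ▸ Submodule.mem_top
  exact this

/-- Strong continuity at `0` propagates to all times by the semigroup property. -/
lemma adjoint_continuousOn (h : IsDecayingSemigroup Ω M k) (v : E) :
    ContinuousOn (fun t => adjoint (Ω t) v) (Ici 0) := by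
  intro t₀ ht₀
  have hd : ∀ t, 0 ≤ t →
      ‖adjoint (Ω t) v - adjoint (Ω t₀) v‖ ≤ M * ‖adjoint (Ω |t - t₀|) v - v‖ := by
    have key : ∀ s t, 0 ≤ s → s ≤ t →
        ‖adjoint (Ω t) v - adjoint (Ω s) v‖ ≤ M * ‖adjoint (Ω (t - s)) v - v‖ := by
      intro s t hs hst
      have : adjoint (Ω t) v = adjoint (Ω s) (adjoint (Ω (t - s)) v) := by
        rw [← h.adjoint_add (sub_nonneg.2 hst) hs, sub_add_cancel]
      rw [this, ← map_sub]
      exact h.adjoint_norm_le hs _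
    intro t ht
    rcases le_total t₀ t with h1 | h1
    · rw [abs_of_nonneg (sub_nonneg.2 h1)]; exact key t₀ t ht₀ h1
    · rw [abs_of_nonpos (sub_nonpos.2 h1), neg_sub, norm_sub_rev]; exact key t t₀ ht h1
  have habs : Tendsto (fun t : ℝ => |t - t₀|) (𝓝[Ici 0] t₀) (𝓝[Ici 0] 0) := by
    refine tendsto_nhdsWithin_iff.2 ⟨?_, Eventually.of_forall fun _ => mem_Ici.2 (abs_nonneg _)⟩
    have : Tendsto (fun t : ℝ => |t - t₀|) (𝓝 t₀) (𝓝 |t₀ - t₀|) :=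
      (by fun_prop : Continuous fun t : ℝ => |t - t₀|).tendsto t₀
    rw [sub_self, abs_zero] at this
    exact this.mono_left nhdsWithin_le_nhds
  have h1 := tendsto_iff_norm_sub_tendsto_zero.1 ((h.tendsto_adjoint_zero v).comp habs)
  have h2 := h1.const_mul M
  rw [mul_zero] at h2
  refine tendsto_iff_norm_sub_tendsto_zero.2 (squeeze_zero' (Eventually.of_forall fun _ =>
    norm_nonneg _) ?_ h2)
  filter_upwards [self_mem_nhdsWithin] with t ht using hd t ht

lemma continuous_adjoint_max (h : IsDecayingSemigroup Ω M k) (v : E) :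
    Continuous fun t => adjoint (Ω (max t 0)) v :=
  (h.adjoint_continuousOn v).comp_continuous (by fun_prop) fun _ => mem_Ici.2 (le_max_right _ _)

lemma adjoint_norm_le_exp (h : IsDecayingSemigroup Ω M k) {t : ℝ} (ht : 0 ≤ t) (v : E) :
    ‖adjoint (Ω t) v‖ ≤ M * Real.exp (-k * t) * ‖v‖ := by
  refine (ContinuousLinearMap.le_opNorm _ _).trans ?_
  rw [LinearIsometryEquiv.norm_map]
  gcongr
  exact h.bound t ht

lemma integrableOn_sandwich (h : IsDecayingSemigroup Ω M k) (L : E →L[ℂ] E) (v : E) :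
    IntegrableOn (fun s => Ω s (L (adjoint (Ω s) v))) (Ioi 0) := by
  have hc : ContinuousOn (fun s => Ω s (L (adjoint (Ω s) v))) (Ici 0) :=
    h.continuousOn_apply (L.continuous.comp_continuousOn (h.adjoint_continuousOn v))
  refine (h.integrableOn_exp.const_mul (M * ‖L‖ * M * ‖v‖)).mono'
    ((hc.mono Ioi_subset_Ici_self).aestronglyMeasurable measurableSet_Ioi) ?_
  filter_upwards [ae_restrict_mem measurableSet_Ioi] with s hs
  have hs0 : (0 : ℝ) ≤ s := (mem_Ioi.1 hs).le
  have hM := h.nonneg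
  calc ‖Ω s (L (adjoint (Ω s) v))‖ ≤ ‖Ω s‖ * (‖L‖ * ‖adjoint (Ω s) v‖) :=
        ((Ω s).le_opNorm _).trans (by gcongr; exact L.le_opNorm _)
    _ ≤ M * (‖L‖ * (M * Real.exp (-k * s) * ‖v‖)) := by
        gcongr
        · exact h.norm_le hs0
        · exact h.adjoint_norm_le_exp hs0 v
    _ = M * ‖L‖ * M * ‖v‖ * Real.exp (-k * s) := by ring

/-- The operator `Π = ∫₀^∞ Ω(s) L Ω*(s) ds` exists, and `Ω(τ)` can be moved under the integral. -/
lemma exists_sandwich (h : IsDecayingSemigroup Ω M k) (L : E →L[ℂ] E) :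
    ∃ Pi : E →L[ℂ] E, IsStrongIntegral (Ioi 0) (fun s => Ω s ∘L L ∘L adjoint (Ω s)) Pi ∧
      ∀ φ ψ τ, 0 ≤ τ →
        IntegrableOn (fun s => inner ℂ φ (Ω (s + τ) (L (adjoint (Ω s) ψ)))) (Ioi 0) ∧
        ∫ s in Ioi (0 : ℝ), inner ℂ φ (Ω (s + τ) (L (adjoint (Ω s) ψ))) =
          inner ℂ φ (Ω τ (Pi ψ)) := by
  obtain ⟨Pi, hPi⟩ := exists_isStrongIntegral (I := Ioi 0) (F := fun s => Ω s ∘L L ∘L adjoint (Ω s))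
    (h.integrableOn_sandwich L)
  refine ⟨Pi, hPi, fun φ ψ τ hτ => ?_⟩
  have hcongr : ∀ s ∈ Ioi (0 : ℝ), inner ℂ (adjoint (Ω τ) φ) (Ω s (L (adjoint (Ω s) ψ))) =
      inner ℂ φ (Ω (s + τ) (L (adjoint (Ω s) ψ))) := by
    intro s hs
    rw [add_comm s τ, h.add τ s hτ (mem_Ioi.1 hs).le, ContinuousLinearMap.adjoint_inner_left]
    rfl
  have hi := (h.integrableOn_sandwich L ψ).const_inner (𝕜 := ℂ) (adjoint (Ω τ) φ)
  refine ⟨IntegrableOn.congr_fun hi hcongr measurableSet_Ioi, ?_⟩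
  rw [← setIntegral_congr_fun measurableSet_Ioi hcongr]
  rw [integral_inner (h.integrableOn_sandwich L ψ), ContinuousLinearMap.adjoint_inner_left]
  rw [(hPi ψ).2]
  rfl

/-- The double integral for the time correlation factors through `Π` for times beyond the range of
the correlations of the source: for `|σ| ≤ t₀ < τ` one has `Ω(s + τ - σ) K(σ) = Ω(s + τ) S(σ)`. -/
lemma exists_backward_sandwich (h : IsDecayingSemigroup Ω M k) {K S : ℝ → E →L[ℂ] E} {t₀ : ℝ}
    (hK : ∀ t, t₀ ≤ |t| → K t = 0) (hS : IsBackward Ω K t₀ S)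
    (hSi : ∀ v, IntegrableOn (fun t => S t v) (Icc (-t₀) t₀)) :
    ∃ 𝓛 Pi : E →L[ℂ] E, IsStrongIntegral (Icc (-t₀) t₀) S 𝓛 ∧
      IsStrongIntegral (Ioi 0) (fun s => Ω s ∘L 𝓛 ∘L adjoint (Ω s)) Pi ∧
      ∀ φ ψ τ, t₀ < τ → 0 < τ →
        ∫ s in Ioi (0 : ℝ), ∫ σ in Iio (s + τ),
          inner ℂ φ (Ω (s + τ - σ) (K σ (adjoint (Ω s) ψ))) = inner ℂ φ (Ω τ (Pi ψ)) := by
  obtain ⟨𝓛, h𝓛⟩ := exists_isStrongIntegral hSi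
  obtain ⟨Pi, hPi, hform⟩ := h.exists_sandwich 𝓛
  refine ⟨𝓛, Pi, h𝓛, hPi, fun φ ψ τ hτ hτ0 => ?_⟩
  rw [← (hform φ ψ τ hτ0.le).2]
  refine setIntegral_congr_fun measurableSet_Ioi fun s hs => ?_
  have hs0 : (0 : ℝ) < s := hs
  have hsub : Icc (-t₀) t₀ ⊆ Iio (s + τ) := fun σ hσ => by
    have := hσ.2
    simp only [mem_Iio]; linarith
  have h1 : ∫ σ in Iio (s + τ), inner ℂ φ (Ω (s + τ - σ) (K σ (adjoint (Ω s) ψ))) =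
      ∫ σ in Icc (-t₀) t₀, inner ℂ φ (Ω (s + τ - σ) (K σ (adjoint (Ω s) ψ))) := by
    refine (setIntegral_eq_of_subset_of_forall_sdiff_eq_zero measurableSet_Iio hsub ?_)
    rintro σ ⟨-, hσ⟩
    have : t₀ ≤ |σ| := by
      by_contra hlt
      have := abs_lt.1 (not_le.1 hlt)
      exact hσ ⟨this.1.le, this.2.le⟩
    simp [hK σ this]
  have h2 : ∀ σ ∈ Icc (-t₀) t₀, inner ℂ φ (Ω (s + τ - σ) (K σ (adjoint (Ω s) ψ))) =
      inner ℂ (adjoint (Ω (s + τ)) φ) (S σ (adjoint (Ω s) ψ)) := by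
    intro σ hσ
    rw [ContinuousLinearMap.adjoint_inner_left]
    congr 1
    rcases le_total σ 0 with h0 | h0
    · rw [hS.nonpos σ ⟨hσ.1, h0⟩, sub_eq_add_neg, h.add (s + τ) (-σ) (by linarith) (by linarith)]
      rfl
    · rw [← hS.nonneg σ ⟨h0, hσ.2⟩]
      have : Ω (s + τ) = Ω (s + τ - σ) ∘L Ω σ := by
        rw [← h.add _ _ (by linarith [hσ.2]) h0, sub_add_cancel]
      rw [this]
      rfl
  rw [h1, setIntegral_congr_fun measurableSet_Icc h2, integral_inner (hSi _),
    ContinuousLinearMap.adjoint_inner_left, (h𝓛 _).2]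

end IsDecayingSemigroup

lemma integral_comp_of_measurePreserving {α β F : Type*} [MeasurableSpace α] [MeasurableSpace β]
    [NormedAddCommGroup F] [NormedSpace ℝ F] {μ : Measure α} {ν : Measure β} {f : α → β}
    (hf : MeasurePreserving f μ ν) {G : β → F} (hG : AEStronglyMeasurable G ν) :
    ∫ a, G (f a) ∂μ = ∫ b, G b ∂ν := by
  rw [← hf.map_eq, integral_map hf.measurable.aemeasurable (by rwa [hf.map_eq])]

/-! ### The double integral for the time correlation -/

/-- The domain of integration `0 < s`, `σ < s + τ`. -/
def causalRegion (τ : ℝ) : Set (ℝ × ℝ) := {p | 0 < p.1 ∧ p.2 < p.1 + τ}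

lemma mem_causalRegion {τ : ℝ} {p : ℝ × ℝ} : p ∈ causalRegion τ ↔ 0 < p.1 ∧ p.2 < p.1 + τ :=
  Iff.rfl

lemma measurableSet_causalRegion (τ : ℝ) : MeasurableSet (causalRegion τ) :=
  (measurableSet_lt measurable_const measurable_fst).inter
    (measurableSet_lt measurable_snd (measurable_fst.add_const τ))

lemma setIntegral_causalRegion {F : Type*} [NormedAddCommGroup F] [NormedSpace ℝ F] {τ : ℝ}
    {G : ℝ × ℝ → F} (hG : IntegrableOn G (causalRegion τ)) :
    ∫ p in causalRegion τ, G p = ∫ s in Ioi (0 : ℝ), ∫ σ in Iio (s + τ), G (s, σ) := by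
  have hm := measurableSet_causalRegion τ
  rw [← integral_indicator hm, ← integral_indicator measurableSet_Ioi]
  have hi := (integrable_indicator_iff hm).2 hG
  rw [Measure.volume_eq_prod] at hi ⊢
  rw [integral_prod _ hi]
  congr 1
  ext s
  by_cases hs : s ∈ Ioi (0 : ℝ)
  · rw [indicator_of_mem hs, ← integral_indicator measurableSet_Iio]
    congr 1
    ext σ
    by_cases hσ : σ ∈ Iio (s + τ)
    · rw [indicator_of_mem hσ, indicator_of_mem (mem_causalRegion.2 ⟨mem_Ioi.1 hs, mem_Iio.1 hσ⟩)]
    · rw [indicator_of_notMem hσ, indicator_of_notMem fun h =>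
        hσ (mem_Iio.2 (mem_causalRegion.1 h).2)]
  · rw [indicator_of_notMem hs]
    have : ∀ σ : ℝ, (causalRegion τ).indicator G (s, σ) = 0 := fun σ =>
      indicator_of_notMem (fun h => hs (mem_Ioi.2 (mem_causalRegion.1 h).1)) _
    simp [this]

/-- The change of variables `s = -p₂ - τ`, `σ = p₁ - p₂`. -/
lemma measurePreserving_lag (τ : ℝ) :
    MeasurePreserving (fun p : ℝ × ℝ => (-p.2 - τ, p.1 - p.2)) := by
  have h1 : MeasurePreserving (fun p : ℝ × ℝ => (p.1 - p.2, p.2))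
      (volume.prod volume) (volume.prod volume) := measurePreserving_sub_prod volume volume
  have h2 : MeasurePreserving (fun y : ℝ => -y - τ) volume volume :=
    (measurePreserving_sub_right volume τ).comp (Measure.measurePreserving_neg volume)
  have h3 : MeasurePreserving (fun q : ℝ × ℝ => (-q.2 - τ, q.1))
      (volume.prod volume) (volume.prod volume) :=
    (h2.prod (MeasurePreserving.id volume)).comp Measure.measurePreserving_swap
  exact h3.comp h1

lemma ae_sub_of_ae {p : ℝ → Prop} (h : ∀ᵐ σ : ℝ, p σ) : ∀ᵐ q : ℝ × ℝ, p (q.1 - q.2) :=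
  (Measure.quasiMeasurePreserving_snd.comp
    (measurePreserving_lag 0).quasiMeasurePreserving).ae h

/-- A strongly measurable family of operators, applied to a measurable function of a second
variable, is jointly measurable. -/
lemma aestronglyMeasurable_clm_apply {E α β : Type*} [NormedAddCommGroup E] [NormedSpace ℂ E]
    [MeasurableSpace α] [MeasurableSpace β] {μ : Measure α} {ν : Measure β} [SFinite μ] [SFinite ν]
    {K : β → E →L[ℂ] E}
    (hK : ∀ v, AEStronglyMeasurable (fun σ => K σ v) ν) {b : α → E}
    (hb : AEStronglyMeasurable b μ) :
    AEStronglyMeasurable (fun q : α × β => K q.2 (b q.1)) (μ.prod ν) := by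
  have hmk : (fun q : α × β => K q.2 (hb.mk b q.1)) =ᵐ[μ.prod ν]
      fun q => K q.2 (b q.1) := by
    filter_upwards [Measure.quasiMeasurePreserving_fst.ae hb.ae_eq_mk] with q hq
    rw [hq]
  refine AEStronglyMeasurable.congr ?_ hmk
  have hsimple : ∀ φ : SimpleFunc α E,
      AEStronglyMeasurable (fun q : α × β => K q.2 (φ q.1)) (μ.prod ν) := by
    intro φ
    induction φ using SimpleFunc.induction with
    | const c hs =>
      rename_i s
      have : (fun q : α × β => K q.2 ((SimpleFunc.piecewise s hs (SimpleFunc.const α c)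
          (SimpleFunc.const α 0)) q.1)) =
          (Prod.fst ⁻¹' s).indicator fun q : α × β => K q.2 c := by
        ext q
        by_cases h : q.1 ∈ s
        · rw [indicator_of_mem (show q ∈ Prod.fst ⁻¹' s from h)]
          simp [h]
        · rw [indicator_of_notMem (show q ∉ Prod.fst ⁻¹' s from h)]
          simp [h]
      rw [this]
      exact ((hK c).comp_snd).indicator (measurable_fst hs)
    | add _ h1 h2 =>
      refine (h1.add h2).congr (Eventually.of_forall fun q => ?_)
      simp
  refine aestronglyMeasurable_of_tendsto_ae atTop
    (fun n => hsimple (hb.stronglyMeasurable_mk.approx n)) (Eventually.of_forall fun q => ?_)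
  exact ((K q.2).continuous.tendsto _).comp (hb.stronglyMeasurable_mk.tendsto_approx q.1)

section

variable {E : Type*} [NormedAddCommGroup E] [InnerProductSpace ℂ E] [CompleteSpace E]
  {Ω : ℝ → E →L[ℂ] E} {M k : ℝ}

/-- Absolute convergence of the correlation integral. The integrand is at most a multiple of
`e^{-ks} g(σ)`, where `g` dominates the norms of the correlation operators. -/
lemma IsDecayingSemigroup.integrableOn_correlation (h : IsDecayingSemigroup Ω M k)
    {K : ℝ → E →L[ℂ] E} (hK : IsCorrelationFamily K) (φ ψ : E) (τ : ℝ) :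
    IntegrableOn (fun p : ℝ × ℝ => inner ℂ φ (Ω (p.1 + τ - p.2) (K p.2 (adjoint (Ω p.1) ψ))))
      (causalRegion τ) := by
  obtain ⟨g, hg, hKg⟩ := hK.bound
  have hm := measurableSet_causalRegion τ
  -- On the region the two adjoint semigroups may be replaced by continuous functions of all times.
  have hcongr : ∀ p ∈ causalRegion τ,
      inner ℂ (adjoint (Ω (max (p.1 + τ - p.2) 0)) φ) (K p.2 (adjoint (Ω (max p.1 0)) ψ)) =
      inner ℂ φ (Ω (p.1 + τ - p.2) (K p.2 (adjoint (Ω p.1) ψ))) := by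
    rintro p hp
    obtain ⟨h1, h2⟩ := mem_causalRegion.1 hp
    rw [max_eq_left h1.le, max_eq_left (by linarith), ContinuousLinearMap.adjoint_inner_left]
  refine IntegrableOn.congr_fun ?_ hcongr hm
  have hmeas : AEStronglyMeasurable (fun p : ℝ × ℝ =>
      inner ℂ (adjoint (Ω (max (p.1 + τ - p.2) 0)) φ) (K p.2 (adjoint (Ω (max p.1 0)) ψ)))
      (volume.prod volume) := by
    refine AEStronglyMeasurable.inner ?_ (aestronglyMeasurable_clm_apply hK.measurable
      (h.continuous_adjoint_max ψ).aestronglyMeasurable)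
    exact ((h.continuous_adjoint_max φ).comp
      (by fun_prop : Continuous fun p : ℝ × ℝ => p.1 + τ - p.2)).aestronglyMeasurable
  have hint : Integrable (fun p : ℝ × ℝ => (M * M * ‖φ‖ * ‖ψ‖) * (Real.exp (-k * p.1) * g p.2))
      ((volume.restrict (Ioi 0)).prod volume) :=
    (h.integrableOn_exp.mul_prod hg).const_mul _
  have hsub : (volume : Measure (ℝ × ℝ)).restrict (causalRegion τ) ≤
      (volume.restrict (Ioi 0)).prod volume := by
    have : ((volume : Measure ℝ).restrict (Ioi 0)).prod (volume : Measure ℝ) =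
        (volume : Measure (ℝ × ℝ)).restrict (Ioi 0 ×ˢ univ) := by
      rw [Measure.volume_eq_prod, ← Measure.prod_restrict, Measure.restrict_univ]
    rw [this]
    exact Measure.restrict_mono (fun p hp => mem_prod.2
      ⟨mem_Ioi.2 (mem_causalRegion.1 hp).1, mem_univ _⟩) le_rfl
  refine (hint.mono_measure hsub).mono' hmeas.restrict ?_
  have hKg' : ∀ᵐ p : ℝ × ℝ, ‖K p.2‖ ≤ g p.2 := Measure.quasiMeasurePreserving_snd.ae hKg
  filter_upwards [ae_restrict_of_ae hKg', ae_restrict_mem hm] with p hp hpm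
  obtain ⟨h1, h2⟩ := mem_causalRegion.1 hpm
  have hM := h.nonneg
  rw [max_eq_left h1.le, max_eq_left (by linarith)]
  calc ‖inner ℂ (adjoint (Ω (p.1 + τ - p.2)) φ) (K p.2 (adjoint (Ω p.1) ψ))‖
      ≤ ‖adjoint (Ω (p.1 + τ - p.2)) φ‖ * (‖K p.2‖ * ‖adjoint (Ω p.1) ψ‖) :=
        (norm_inner_le_norm _ _).trans (by gcongr; exact (K p.2).le_opNorm _)
    _ ≤ (M * ‖φ‖) * (g p.2 * (M * Real.exp (-k * p.1) * ‖ψ‖)) := by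
        gcongr
        · exact h.adjoint_norm_le (by linarith) φ
        · exact (norm_nonneg _).trans hp
        · exact h.adjoint_norm_le_exp h1.le ψ
    _ = (M * M * ‖φ‖ * ‖ψ‖) * (Real.exp (-k * p.1) * g p.2) := by ring

/-- The function `r ↦ Ω(-r)* φ` on `r < 0`, extended by `0`. -/
def causalKernel (Ω : ℝ → E →L[ℂ] E) (φ : E) : ℝ → E :=
  (Iio 0).indicator fun r => adjoint (Ω (-r)) φ

lemma IsDecayingSemigroup.aestronglyMeasurable_causalKernel (h : IsDecayingSemigroup Ω M k)
    (φ : E) : AEStronglyMeasurable (causalKernel Ω φ) volume := by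
  have : causalKernel Ω φ = (Iio 0).indicator fun r => adjoint (Ω (max (-r) 0)) φ := by
    refine indicator_congr fun r hr => ?_
    have : r < 0 := hr
    rw [max_eq_left (by linarith)]
  rw [this]
  exact ((h.continuous_adjoint_max φ).comp continuous_neg).aestronglyMeasurable.indicator
    measurableSet_Iio

lemma IsDecayingSemigroup.memLp_causalKernel (h : IsDecayingSemigroup Ω M k) (φ : E) :
    MemLp (causalKernel Ω φ) 2 volume := by
  rw [memLp_two_iff_integrable_sq_norm (h.aestronglyMeasurable_causalKernel φ)]
  have hI : Integrable ((Iio (0 : ℝ)).indicator fun r =>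
      (M * ‖φ‖) ^ 2 * Real.exp (2 * k * r)) := by
    refine (integrable_indicator_iff measurableSet_Iio).2 (Integrable.const_mul ?_ _)
    exact (integrableOn_exp_mul_Iic (by linarith [h.pos]) 0).mono_set Iio_subset_Iic_self
  refine hI.mono' ((h.aestronglyMeasurable_causalKernel φ).norm.pow 2) (ae_of_all _ fun r => ?_)
  rw [causalKernel]
  by_cases hr : r ∈ Iio (0 : ℝ)
  · rw [indicator_of_mem hr, indicator_of_mem hr, Real.norm_of_nonneg (by positivity)]
    have h1 := h.adjoint_norm_le_exp (show 0 ≤ -r from (neg_pos.2 hr).le) φ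
    calc ‖adjoint (Ω (-r)) φ‖ ^ 2 ≤ (M * Real.exp (-k * -r) * ‖φ‖) ^ 2 := by gcongr
      _ = (M * ‖φ‖) ^ 2 * (Real.exp (-k * -r) * Real.exp (-k * -r)) := by ring
      _ = (M * ‖φ‖) ^ 2 * Real.exp (2 * k * r) := by rw [← Real.exp_add]; ring_nf
  · rw [indicator_of_notMem hr, indicator_of_notMem hr]
    simp

/-- The correlation form of the source on causal test functions, as a double integral over the
lag `σ` and the delay `s`. -/
lemma IsDecayingSemigroup.integral_correlation_causalKernel (h : IsDecayingSemigroup Ω M k)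
    {K : ℝ → E →L[ℂ] E} (hK : IsCorrelationFamily K) (φ ψ : E) (τ : ℝ) :
    ∫ p : ℝ × ℝ, inner ℂ (causalKernel Ω φ p.1) (K (p.1 - p.2) (causalKernel Ω ψ (p.2 + τ))) =
      ∫ s in Ioi (0 : ℝ), ∫ σ in Iio (s + τ),
        inner ℂ φ (Ω (s + τ - σ) (K σ (adjoint (Ω s) ψ))) := by
  have hi := h.integrableOn_correlation hK φ ψ τ
  have hm := measurableSet_causalRegion τ
  rw [← setIntegral_causalRegion hi, ← integral_indicator hm]
  have hmp := measurePreserving_lag τ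
  have hHm := ((integrable_indicator_iff hm).2 hi).aestronglyMeasurable
  rw [← integral_comp_of_measurePreserving hmp hHm]
  congr 1
  ext p
  by_cases hp : (-p.2 - τ, p.1 - p.2) ∈ causalRegion τ
  · obtain ⟨h1, h2⟩ := mem_causalRegion.1 hp
    simp only at h1 h2
    rw [indicator_of_mem hp, causalKernel, causalKernel,
      indicator_of_mem (mem_Iio.2 (by linarith)), indicator_of_mem (mem_Iio.2 (by linarith)),
      ContinuousLinearMap.adjoint_inner_left]
    congr 3
    · ring
    · congr 3; ring
  · rw [indicator_of_notMem hp, causalKernel, causalKernel]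
    by_cases hp1 : p.1 ∈ Iio (0 : ℝ)
    · have : p.2 + τ ∉ Iio (0 : ℝ) := fun h2 => hp (mem_causalRegion.2
        ⟨by have := mem_Iio.1 h2; simp only; linarith,
          by have := mem_Iio.1 hp1; simp only; linarith⟩)
      rw [indicator_of_notMem this, map_zero, inner_zero_right]
    · rw [indicator_of_notMem hp1, inner_zero_left]

/-- The correlation form of a source that is white in time, on causal test functions. -/
lemma IsDecayingSemigroup.integral_white_causalKernel
    (L : E →L[ℂ] E) (φ ψ : E) {τ : ℝ} (hτ : 0 ≤ τ) :
    ∫ r : ℝ, inner ℂ (causalKernel Ω φ r) (L (causalKernel Ω ψ (r + τ))) =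
      ∫ s in Ioi (0 : ℝ), inner ℂ φ (Ω (s + τ) (L (adjoint (Ω s) ψ))) := by
  rw [← integral_indicator measurableSet_Ioi, ← integral_sub_right_eq_self _ τ,
    ← integral_neg_eq_self]
  congr 1
  ext s
  rw [causalKernel, causalKernel, sub_add_cancel]
  by_cases hs : s ∈ Ioi (0 : ℝ)
  · have hs0 := mem_Ioi.1 hs
    rw [indicator_of_mem hs, indicator_of_mem (mem_Iio.2 (by linarith)),
      indicator_of_mem (mem_Iio.2 (by linarith)), ContinuousLinearMap.adjoint_inner_left, neg_neg]
    congr 3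
    ring
  · have hs0 : ¬ 0 < s := hs
    rw [indicator_of_notMem hs, indicator_of_notMem (s := Iio 0) (a := -s)
      (fun h => hs0 (by have := mem_Iio.1 h; linarith)), map_zero, inner_zero_right]

end

section

variable {E : Type*} [NormedAddCommGroup E] [InnerProductSpace ℂ E]

/-- A source with an admissible correlation family is bounded in mean square. The bound is
Young's inequality, from `‖h(p₁)‖ ‖h(p₂)‖ ≤ (‖h(p₁)‖² + ‖h(p₂)‖²) / 2`. -/
lemma IsCorrelationFamily.exists_bound {K : ℝ → E →L[ℂ] E} (hK : IsCorrelationFamily K) :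
    ∃ B : ℝ, 0 ≤ B ∧ ∀ h : Lp E 2 (volume : Measure ℝ),
      ‖∫ p : ℝ × ℝ, inner ℂ (h p.1) (K (p.1 - p.2) (h p.2))‖ ≤ B * ‖h‖ ^ 2 := by
  obtain ⟨g, hg, hKg⟩ := hK.bound
  have hg0 : 0 ≤ ∫ σ, g σ := integral_nonneg_of_ae (hKg.mono fun σ h => (norm_nonneg _).trans h)
  refine ⟨∫ σ, g σ, hg0, fun h => ?_⟩
  have hh : Integrable (fun r => ‖h r‖ ^ 2) :=
    (memLp_two_iff_integrable_sq_norm (Lp.aestronglyMeasurable h)).1 (Lp.memLp h)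
  have hnorm : ∫ r, ‖h r‖ ^ 2 = ‖h‖ ^ 2 := by
    have h1 : (inner ℂ h h : ℂ) = ∫ r, inner ℂ (h r) (h r) := rfl
    rw [inner_self_eq_norm_sq_to_K] at h1
    simp only [inner_self_eq_norm_sq_to_K] at h1
    have h2 : ∫ r, ((‖h r‖ : ℂ)) ^ 2 = ((∫ r, ‖h r‖ ^ 2 : ℝ) : ℂ) := by
      rw [← integral_complex_ofReal]; congr 1; ext r; push_cast; rfl
    have h3 : ((‖h‖ : ℝ) : ℂ) ^ 2 = ((∫ r, ‖h r‖ ^ 2 : ℝ) : ℂ) := by rw [← h2]; exact h1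
    exact_mod_cast h3.symm
  have hsp : MeasurePreserving (fun p : ℝ × ℝ => (p.1 - p.2, p.2))
      (volume.prod volume) (volume.prod volume) := measurePreserving_sub_prod volume volume
  have hps : MeasurePreserving (fun p : ℝ × ℝ => (p.2 - p.1, p.1))
      (volume.prod volume) (volume.prod volume) := hsp.comp Measure.measurePreserving_swap
  have hgn : Integrable (fun σ => g (-σ)) := hg.comp_neg
  have hF2 : Integrable (fun q : ℝ × ℝ => g q.1 * ‖h q.2‖ ^ 2) (volume.prod volume) :=
    hg.mul_prod hh
  have hF1 : Integrable (fun q : ℝ × ℝ => g (-q.1) * ‖h q.2‖ ^ 2) (volume.prod volume) :=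
    hgn.mul_prod hh
  have i2 := hsp.integrable_comp_of_integrable hF2
  have i1 := hps.integrable_comp_of_integrable hF1
  have v2 : ∫ p, ((fun q : ℝ × ℝ => g q.1 * ‖h q.2‖ ^ 2) ∘ fun p : ℝ × ℝ => (p.1 - p.2, p.2)) p
      ∂(volume.prod volume) = (∫ σ, g σ) * ‖h‖ ^ 2 := by
    rw [← hnorm, ← integral_prod_mul]
    exact integral_comp_of_measurePreserving hsp hF2.aestronglyMeasurable
  have v1 : ∫ p, ((fun q : ℝ × ℝ => g (-q.1) * ‖h q.2‖ ^ 2) ∘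
      fun p : ℝ × ℝ => (p.2 - p.1, p.1)) p ∂(volume.prod volume) = (∫ σ, g σ) * ‖h‖ ^ 2 := by
    rw [← hnorm, ← integral_neg_eq_self g, ← integral_prod_mul]
    exact integral_comp_of_measurePreserving hps hF1.aestronglyMeasurable
  refine (norm_integral_le_of_norm_le ((i1.add i2).const_mul (1 / 2)) ?_).trans_eq ?_
  · filter_upwards [ae_sub_of_ae hKg] with p hp
    simp only [Pi.add_apply, Function.comp_apply, neg_sub]
    have hgp := (norm_nonneg _).trans hp
    calc ‖inner ℂ (h p.1) (K (p.1 - p.2) (h p.2))‖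
        ≤ ‖h p.1‖ * (‖K (p.1 - p.2)‖ * ‖h p.2‖) :=
          (norm_inner_le_norm _ _).trans (by gcongr; exact ContinuousLinearMap.le_opNorm _ _)
      _ ≤ ‖h p.1‖ * (g (p.1 - p.2) * ‖h p.2‖) := by gcongr
      _ ≤ 1 / 2 * (g (p.1 - p.2) * ‖h p.1‖ ^ 2 + g (p.1 - p.2) * ‖h p.2‖ ^ 2) := by
          nlinarith [mul_nonneg hgp (sq_nonneg (‖h p.1‖ - ‖h p.2‖))]
  · rw [integral_const_mul]
    simp only [Pi.add_apply]
    rw [integral_add i1 i2, v1, v2]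
    ring

lemma exists_white_bound (L : E →L[ℂ] E) :
    ∃ B : ℝ, 0 ≤ B ∧ ∀ h : Lp E 2 (volume : Measure ℝ),
      ‖∫ s : ℝ, inner ℂ (h s) (L (h s))‖ ≤ B * ‖h‖ ^ 2 := by
  refine ⟨‖L‖, norm_nonneg _, fun h => ?_⟩
  have e : ∫ s : ℝ, inner ℂ (h s) (L (h s)) = inner ℂ h (L.compLp h) := by
    rw [L2.inner_def]
    refine integral_congr_ae ?_
    filter_upwards [L.coeFn_compLp h] with s hs
    rw [hs]
  rw [e]
  refine (norm_inner_le_norm _ _).trans ?_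
  have := L.norm_compLp_le h
  nlinarith [norm_nonneg h]

end

/-! ### Measurable versions of mean-square continuous processes -/

/-- A process that is uniformly continuous in mean square has a version that is jointly measurable
in time and chance: the almost sure limit of step processes whose meshes shrink fast. -/
lemma exists_measurable_version {Ω₀ : Type*} [MeasurableSpace Ω₀] {ℙ : Measure Ω₀}
    {u : ℝ → Ω₀ → ℂ} (hu : ∀ t, Measurable (u t))
    (hcont : ∀ ε : ENNReal, ε ≠ 0 → ∃ n : ℕ, 0 < n ∧ ∀ s t : ℝ, |s - t| ≤ 1 / n →
      ∫⁻ ω, ‖u s ω - u t ω‖ₑ ^ 2 ∂ℙ ≤ ε) :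
    ∃ U : ℝ → Ω₀ → ℂ, Measurable (Function.uncurry U) ∧ ∀ t, U t =ᵐ[ℙ] u t := by
  have hne : ∀ n : ℕ, ((2 : ENNReal)⁻¹) ^ n ≠ 0 := fun n => pow_ne_zero _ (by simp)
  choose N hN0 hN using fun n : ℕ => hcont _ (hne n)
  -- The mesh `1 / N n` makes the mean square errors of the step processes summable.
  let step : ℕ → ℝ → Ω₀ → ℂ := fun n t ω => u ((⌊t * N n⌋ : ℝ) / N n) ω
  have hstep : ∀ n, Measurable (Function.uncurry (step n)) := by
    intro n
    have h1 : Measurable fun q : ℤ × Ω₀ => u ((q.1 : ℝ) / N n) q.2 :=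
      measurable_from_prod_countable_right fun z => hu ((z : ℝ) / N n)
    exact h1.comp (((Int.measurable_floor.comp (measurable_id.mul_const _)).comp
      measurable_fst).prodMk measurable_snd)
  have hlim : StronglyMeasurable fun p : ℝ × Ω₀ => limUnder atTop fun n => step n p.1 p.2 :=
    StronglyMeasurable.limUnder fun n => (hstep n).stronglyMeasurable
  refine ⟨fun t ω => limUnder atTop fun n => step n t ω, hlim.measurable, fun t => ?_⟩
  have hclose : ∀ n, ∫⁻ ω, ‖step n t ω - u t ω‖ₑ ^ 2 ∂ℙ ≤ ((2 : ENNReal)⁻¹) ^ n := by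
    intro n
    refine hN n _ _ ?_
    have h0 : (0 : ℝ) < N n := by exact_mod_cast hN0 n
    have e : (⌊t * N n⌋ : ℝ) / N n - t = (⌊t * N n⌋ - t * N n) / N n := by field_simp
    rw [e, abs_div, abs_of_pos h0]
    refine div_le_div_of_nonneg_right ?_ h0.le
    rw [abs_sub_comm, abs_of_nonneg (sub_nonneg.2 (Int.floor_le _))]
    linarith [Int.lt_floor_add_one (t * N n)]
  have hmeas : ∀ n, Measurable fun ω => ‖step n t ω - u t ω‖ₑ ^ 2 := fun n =>
    (((hu _).sub (hu t)).enorm).pow_const 2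
  have hsum : ∫⁻ ω, ∑' n, ‖step n t ω - u t ω‖ₑ ^ 2 ∂ℙ ≠ ⊤ := by
    rw [lintegral_tsum fun n => (hmeas n).aemeasurable]
    refine ne_top_of_le_ne_top ?_ (ENNReal.tsum_le_tsum hclose)
    rw [ENNReal.tsum_geometric]
    simp
  filter_upwards [ae_lt_top (Measurable.tsum hmeas) hsum] with ω hω
  have h1 := ENNReal.tendsto_atTop_zero_of_tsum_ne_top hω.ne
  have h2 : Tendsto (fun n => ‖step n t ω - u t ω‖ₑ) atTop (𝓝 0) := by
    have h3 := h1.ennrpow_const (1 / 2)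
    rw [ENNReal.zero_rpow_of_pos (by norm_num)] at h3
    refine h3.congr fun n => ?_
    rw [← ENNReal.rpow_natCast, ← ENNReal.rpow_mul]
    norm_num
  have h3 : Tendsto (fun n => step n t ω) atTop (𝓝 (u t ω)) := by
    rw [tendsto_iff_edist_tendsto_0]
    exact h2.congr fun n => (edist_eq_enorm_sub _ _).symm
  exact h3.limUnder_eq

/-! ### Generalized sources -/

section

variable {X Ω₀ : Type*} [MeasurableSpace X] [MeasurableSpace Ω₀] {N : ℕ} {μ : Measure X}
  {ℙ : Measure Ω₀} {Ω : ℝ → VecL2 N μ →L[ℂ] VecL2 N μ} {M k : ℝ}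

lemma timeShift_ae (t : ℝ) (h : SpaceTimeL2 N μ) :
    timeShift t h =ᵐ[volume] fun r => h (r - t) :=
  Lp.coeFn_compMeasurePreserving h (measurePreserving_sub_right volume t)

lemma timeShift_zero (h : SpaceTimeL2 N μ) : timeShift 0 h = h := by
  refine Lp.ext ((timeShift_ae 0 h).trans (Eventually.of_forall fun r => ?_))
  simp only [sub_zero]

lemma timeShift_add (s t : ℝ) (h : SpaceTimeL2 N μ) :
    timeShift (s + t) h = timeShift s (timeShift t h) := by
  refine Lp.ext ?_
  have h1 := (measurePreserving_sub_right (volume : Measure ℝ) s).quasiMeasurePreserving.ae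
    (timeShift_ae t h)
  filter_upwards [timeShift_ae (s + t) h, timeShift_ae s (timeShift t h), h1] with r h2 h3 h4
  rw [h2, h3, h4, sub_sub]

lemma norm_timeShift (t : ℝ) (h : SpaceTimeL2 N μ) : ‖timeShift t h‖ = ‖h‖ :=
  Lp.norm_compMeasurePreserving h (measurePreserving_sub_right volume t)

lemma timeShift_sub (t : ℝ) (h g : SpaceTimeL2 N μ) :
    timeShift t (h - g) = timeShift t h - timeShift t g :=
  map_sub (Lp.compMeasurePreserving (fun r : ℝ => r - t)
    (measurePreserving_sub_right volume t)) h g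

lemma continuous_timeShift (h : SpaceTimeL2 N μ) : Continuous fun t => timeShift t h := by
  have hc : Continuous fun t : ℝ => (⟨fun r => r - t, by fun_prop⟩ : C(ℝ, ℝ)) :=
    ContinuousMap.continuous_of_continuous_uncurry _ (by
      simp only [Function.uncurry_def, ContinuousMap.coe_mk]; fun_prop)
  exact (continuous_const (y := h)).compMeasurePreservingLp hc
    (fun t => measurePreserving_sub_right volume t) (by simp)

/-- The test function whose pairing with the source at time shift `t` is `⟨φ, u(t)⟩`. -/
def causalTest (h : IsDecayingSemigroup Ω M k) (φ : VecL2 N μ) : SpaceTimeL2 N μ :=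
  (h.memLp_causalKernel φ).toLp _

lemma causalTest_ae (h : IsDecayingSemigroup Ω M k) (φ : VecL2 N μ) :
    causalTest h φ =ᵐ[volume] causalKernel Ω φ :=
  MemLp.coeFn_toLp _

lemma timeShift_causalTest_ae (h : IsDecayingSemigroup Ω M k) (φ : VecL2 N μ) (t : ℝ) :
    timeShift t (causalTest h φ) =ᵐ[volume] fun r => causalKernel Ω φ (r - t) := by
  have h1 := (measurePreserving_sub_right (volume : Measure ℝ) t).quasiMeasurePreserving.ae
    (causalTest_ae h φ)
  filter_upwards [timeShift_ae t (causalTest h φ), h1] with r h2 h3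
  rw [h2, h3]

lemma causalKernel_sub (φ : VecL2 N μ) (r t : ℝ) :
    causalKernel Ω φ (r - t) =
      (Iio t).indicator (fun r => adjoint (Ω (t - r)) φ) r := by
  rw [causalKernel]
  by_cases hr : r < t
  · rw [indicator_of_mem (mem_Iio.2 (sub_neg.2 hr)), indicator_of_mem (mem_Iio.2 hr), neg_sub]
  · rw [indicator_of_notMem (fun h => hr (sub_neg.1 (mem_Iio.1 h))),
      indicator_of_notMem (fun h => hr (mem_Iio.1 h))]

lemma IsCausalField.ae_eq (h : IsDecayingSemigroup Ω M k) {f : SpaceTimeL2 N μ → Ω₀ → ℂ}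
    {φ : VecL2 N μ} {U : ℝ → Ω₀ → ℂ} (hU : IsCausalField ℙ Ω f φ U) (t : ℝ) :
    U t =ᵐ[ℙ] f (timeShift t (causalTest h φ)) := by
  obtain ⟨g, hg, hUg⟩ := hU.2 t
  have : g = timeShift t (causalTest h φ) := by
    refine Lp.ext ?_
    filter_upwards [hg, timeShift_causalTest_ae h φ t] with r h1 h2
    rw [h1, h2, causalKernel_sub]
  rwa [this] at hUg

/-- The random variables of a generalized field are bounded in mean square by their test
functions. -/
def IsMeanSquareBounded (ℙ : Measure Ω₀) (f : SpaceTimeL2 N μ → Ω₀ → ℂ) : Prop :=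
  ∃ B : ℝ, 0 ≤ B ∧ ∀ h, ‖∫ ω, f h ω * conj (f h ω) ∂ℙ‖ ≤ B * ‖h‖ ^ 2

lemma IsGeneralizedField.lintegral_enorm_sub_sq_le {f : SpaceTimeL2 N μ → Ω₀ → ℂ}
    (hf : IsGeneralizedField ℙ f) {B : ℝ}
    (hB : ∀ h, ‖∫ ω, f h ω * conj (f h ω) ∂ℙ‖ ≤ B * ‖h‖ ^ 2) (h g : SpaceTimeL2 N μ) :
    ∫⁻ ω, ‖f h ω - f g ω‖ₑ ^ 2 ∂ℙ ≤ ENNReal.ofReal (B * ‖h - g‖ ^ 2) := by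
  have hsub : ∀ᵐ ω ∂ℙ, f h ω - f g ω = f (h - g) ω := by
    have e := hf.add (h - g) g
    rw [sub_add_cancel] at e
    filter_upwards [e] with ω hω
    rw [hω, Pi.add_apply, add_sub_cancel_right]
  have hi : Integrable (fun ω => ‖f (h - g) ω‖ ^ 2) ℙ :=
    (memLp_two_iff_integrable_sq_norm (hf.memLp _).1).1 (hf.memLp _)
  have e1 : ∫⁻ ω, ‖f h ω - f g ω‖ₑ ^ 2 ∂ℙ = ∫⁻ ω, ENNReal.ofReal (‖f (h - g) ω‖ ^ 2) ∂ℙ := by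
    refine lintegral_congr_ae ?_
    filter_upwards [hsub] with ω hω
    rw [hω, ENNReal.ofReal_pow (norm_nonneg _), ofReal_norm]
  rw [e1, ← ofReal_integral_eq_lintegral_ofReal hi (ae_of_all _ fun ω => by positivity)]
  refine ENNReal.ofReal_le_ofReal ?_
  have e2 : ∫ ω, f (h - g) ω * conj (f (h - g) ω) ∂ℙ =
      ((∫ ω, ‖f (h - g) ω‖ ^ 2 ∂ℙ : ℝ) : ℂ) := by
    rw [← integral_complex_ofReal]
    congr 1; ext ω
    rw [Complex.mul_conj, Complex.normSq_eq_norm_sq]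
  have := hB (h - g)
  rw [e2, Complex.norm_real] at this
  exact (le_abs_self _).trans this

lemma IsMeanSquareBounded.exists_isCausalField (h : IsDecayingSemigroup Ω M k)
    {f : SpaceTimeL2 N μ → Ω₀ → ℂ} (hf : IsGeneralizedField ℙ f) (hfB : IsMeanSquareBounded ℙ f)
    (φ : VecL2 N μ) : ∃ U, IsCausalField ℙ Ω f φ U := by
  obtain ⟨B, hB0, hB⟩ := hfB
  obtain ⟨U, hU, hUf⟩ := exists_measurable_version (ℙ := ℙ)
    (u := fun t => f (timeShift t (causalTest h φ))) (fun t => hf.measurable _) (by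
      intro ε hε
      -- Translations are isometries, so continuity at `0` gives uniform continuity.
      have hnorm : ∀ s t : ℝ, ‖timeShift s (causalTest h φ) - timeShift t (causalTest h φ)‖ =
          ‖timeShift (s - t) (causalTest h φ) - causalTest h φ‖ := by
        intro s t
        rw [← norm_timeShift t (timeShift (s - t) _ - _), timeShift_sub, ← timeShift_add,
          add_sub_cancel]
      have hc : Tendsto (fun t => ENNReal.ofReal
          (B * ‖timeShift t (causalTest h φ) - causalTest h φ‖ ^ 2)) (𝓝 0) (𝓝 0) := by
        have h1 : Continuous fun t => ENNReal.ofReal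
            (B * ‖timeShift t (causalTest h φ) - causalTest h φ‖ ^ 2) :=
          ENNReal.continuous_ofReal.comp (continuous_const.mul
            (((continuous_timeShift _).sub continuous_const).norm.pow 2))
        have h2 := h1.tendsto 0
        rw [timeShift_zero, sub_self, norm_zero] at h2
        simpa using h2
      obtain ⟨δ, hδ, hball⟩ := Metric.eventually_nhds_iff.1
        (hc.eventually_le_const (pos_iff_ne_zero.2 hε))
      obtain ⟨n, hn⟩ := exists_nat_one_div_lt hδ
      refine ⟨n + 1, n.succ_pos, fun s t hst => ?_⟩
      refine (hf.lintegral_enorm_sub_sq_le hB _ _).trans ?_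
      rw [hnorm]
      refine hball ?_
      rw [Real.dist_eq, sub_zero]
      refine hst.trans_lt ?_
      push_cast
      exact hn)
  refine ⟨U, hU, fun t => ⟨timeShift t (causalTest h φ), ?_, hUf t⟩⟩
  filter_upwards [timeShift_causalTest_ae h φ t] with r hr
  rw [hr, causalKernel_sub]

/-- The correlation of the causal field, as an expectation. -/
def fieldCorrelation (ℙ : Measure Ω₀) (h : IsDecayingSemigroup Ω M k)
    (f : SpaceTimeL2 N μ → Ω₀ → ℂ) (φ ψ : VecL2 N μ) (τ : ℝ) : ℂ :=
  ∫ ω, f (causalTest h φ) ω * conj (f (timeShift (-τ) (causalTest h ψ)) ω) ∂ℙ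

lemma isErgodicPathFlow_timeShift {f : SpaceTimeL2 N μ → Ω₀ → ℂ} (hf : IsGeneralizedField ℙ f)
    (hstat : IsStationaryFamily ℙ timeShift f) (herg : IsErgodicFamily ℙ timeShift f) :
    IsErgodicPathFlow ℙ (fun ω i => f i ω)
      (fun t (F : SpaceTimeL2 N μ → ℂ) i => F (timeShift t i)) :=
  isErgodicPathFlow_of_family hf.measurable timeShift_zero timeShift_add hstat herg

lemma isFieldCorrelation_fieldCorrelation [IsProbabilityMeasure ℙ]
    (h : IsDecayingSemigroup Ω M k) {f : SpaceTimeL2 N μ → Ω₀ → ℂ} (hf : IsGeneralizedField ℙ f)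
    (hstat : IsStationaryFamily ℙ timeShift f) (herg : IsErgodicFamily ℙ timeShift f)
    (hfB : IsMeanSquareBounded ℙ f) :
    IsFieldCorrelation ℙ Ω f (fieldCorrelation ℙ h f) := by
  refine ⟨hfB.exists_isCausalField h hf, fun φ ψ U V hU hV τ => ?_⟩
  exact (isErgodicPathFlow_timeShift hf hstat herg).hasTimeCorrelation hU.1 hV.1
    (F := fun F => F (causalTest h φ)) (G := fun F => F (causalTest h ψ))
    (measurable_pi_apply _) (measurable_pi_apply _) (fun t => hU.ae_eq h t)
    (fun t => hV.ae_eq h t) (τ := τ)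
    ((hf.memLp (causalTest h φ)).integrable_mul (hf.memLp (timeShift (-τ) (causalTest h ψ))).star)

/-- The symmetry of the correlation follows from stationarity. -/
lemma fieldCorrelation_neg (h : IsDecayingSemigroup Ω M k) {f : SpaceTimeL2 N μ → Ω₀ → ℂ}
    (hf : IsGeneralizedField ℙ f) (hstat : IsStationaryFamily ℙ timeShift f)
    (herg : IsErgodicFamily ℙ timeShift f) (φ ψ : VecL2 N μ) (τ : ℝ) :
    fieldCorrelation ℙ h f φ ψ (-τ) = conj (fieldCorrelation ℙ h f ψ φ τ) := by
  have hF := isErgodicPathFlow_timeShift hf hstat herg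
  have hm : Measurable fun F : SpaceTimeL2 N μ → ℂ =>
      F (causalTest h φ) * conj (F (timeShift τ (causalTest h ψ))) :=
    (measurable_pi_apply _).mul (Complex.continuous_conj.measurable.comp (measurable_pi_apply _))
  have h1 := hF.integral_comp hm.stronglyMeasurable (-τ)
  rw [fieldCorrelation, fieldCorrelation, neg_neg, ← h1, ← integral_conj]
  congr 1
  ext ω
  beta_reduce
  rw [← timeShift_add, neg_add_cancel, timeShift_zero, map_mul, Complex.conj_conj, mul_comm]

lemma HasCorrelation.isMeanSquareBounded {f : SpaceTimeL2 N μ → Ω₀ → ℂ}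
    {K : ℝ → VecL2 N μ →L[ℂ] VecL2 N μ} (hK : IsCorrelationFamily K)
    (hfK : HasCorrelation ℙ f K) : IsMeanSquareBounded ℙ f := by
  obtain ⟨B, hB0, hB⟩ := hK.exists_bound
  exact ⟨B, hB0, fun h => by rw [hfK h h]; exact hB h⟩

lemma HasWhiteCorrelation.isMeanSquareBounded {f : SpaceTimeL2 N μ → Ω₀ → ℂ}
    {L : VecL2 N μ →L[ℂ] VecL2 N μ} (hfL : HasWhiteCorrelation ℙ f L) :
    IsMeanSquareBounded ℙ f := by
  obtain ⟨B, hB0, hB⟩ := exists_white_bound L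
  exact ⟨B, hB0, fun h => by rw [hfL h h]; exact hB h⟩

lemma HasCorrelation.fieldCorrelation_eq (h : IsDecayingSemigroup Ω M k)
    {f : SpaceTimeL2 N μ → Ω₀ → ℂ} {K : ℝ → VecL2 N μ →L[ℂ] VecL2 N μ}
    (hK : IsCorrelationFamily K) (hfK : HasCorrelation ℙ f K) (φ ψ : VecL2 N μ) (τ : ℝ) :
    fieldCorrelation ℙ h f φ ψ τ = ∫ s in Ioi (0 : ℝ), ∫ σ in Iio (s + τ),
      inner ℂ φ (Ω (s + τ - σ) (K σ (adjoint (Ω s) ψ))) := by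
  rw [fieldCorrelation, hfK, ← h.integral_correlation_causalKernel hK φ ψ τ]
  have h1 := Measure.quasiMeasurePreserving_fst (μ := (volume : Measure ℝ))
    (ν := (volume : Measure ℝ)).ae (causalTest_ae h φ)
  have h2 := Measure.quasiMeasurePreserving_snd (μ := (volume : Measure ℝ))
    (ν := (volume : Measure ℝ)).ae (timeShift_causalTest_ae h ψ (-τ))
  refine integral_congr_ae ?_
  filter_upwards [h1, h2] with p hp1 hp2
  rw [hp1, hp2, sub_neg_eq_add]

lemma HasWhiteCorrelation.fieldCorrelation_eq (h : IsDecayingSemigroup Ω M k)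
    {f : SpaceTimeL2 N μ → Ω₀ → ℂ} {L : VecL2 N μ →L[ℂ] VecL2 N μ}
    (hfL : HasWhiteCorrelation ℙ f L) (φ ψ : VecL2 N μ) {τ : ℝ} (hτ : 0 ≤ τ) :
    fieldCorrelation ℙ h f φ ψ τ = ∫ s in Ioi (0 : ℝ),
      inner ℂ φ (Ω (s + τ) (L (adjoint (Ω s) ψ))) := by
  rw [fieldCorrelation, hfL, ← IsDecayingSemigroup.integral_white_causalKernel L φ ψ hτ]
  refine integral_congr_ae ?_
  filter_upwards [causalTest_ae h φ, timeShift_causalTest_ae h ψ (-τ)] with p hp1 hp2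
  rw [hp1, hp2, sub_neg_eq_add]

end

/-! ### Sources that are functions -/

/-- The sum of the absolute values of the entries of a matrix. -/
def entrySum {N : ℕ} (A : Matrix (Fin N) (Fin N) ℂ) : ℝ := ∑ i, ∑ j, ‖A i j‖

lemma entrySum_nonneg {N : ℕ} (A : Matrix (Fin N) (Fin N) ℂ) : 0 ≤ entrySum A :=
  Finset.sum_nonneg fun _ _ => Finset.sum_nonneg fun _ _ => norm_nonneg _

lemma sum_norm_row_le_entrySum {N : ℕ} (A : Matrix (Fin N) (Fin N) ℂ) (i : Fin N) :
    ∑ j, ‖A i j‖ ≤ entrySum A :=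
  Finset.single_le_sum (f := fun i => ∑ j, ‖A i j‖)
    (fun _ _ => Finset.sum_nonneg fun _ _ => norm_nonneg _) (Finset.mem_univ i)

lemma mul_mul_conjTranspose_apply {N : ℕ} (P K Q : Matrix (Fin N) (Fin N) ℂ) (i j : Fin N) :
    (P * K * Q.conjTranspose) i j = ∑ a, ∑ b, P i a * K a b * conj (Q j b) := by
  simp only [Matrix.mul_apply, Matrix.conjTranspose_apply, Finset.sum_mul]
  exact Finset.sum_comm

lemma sum_sum_mul_le_entrySum {N : ℕ} (P Q : Matrix (Fin N) (Fin N) ℂ) {c : ℝ} (hc : 0 ≤ c)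
    (i j : Fin N) :
    ∑ a, ∑ b, ‖P i a‖ * ‖Q j b‖ * c ≤ entrySum P * entrySum Q * c := by
  simp_rw [← Finset.sum_mul, ← Finset.mul_sum, ← Finset.sum_mul]
  exact mul_le_mul_of_nonneg_right (mul_le_mul (sum_norm_row_le_entrySum P i)
    (sum_norm_row_le_entrySum Q j) (Finset.sum_nonneg fun _ _ => norm_nonneg _)
    (entrySum_nonneg P)) hc

lemma norm_mul_mul_conjTranspose_le {N : ℕ} (P K Q : Matrix (Fin N) (Fin N) ℂ) {c : ℝ}
    (hc : 0 ≤ c) (hK : ∀ a b, ‖K a b‖ ≤ c) (i j : Fin N) :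
    ‖(P * K * Q.conjTranspose) i j‖ ≤ entrySum P * entrySum Q * c := by
  rw [mul_mul_conjTranspose_apply]
  refine (norm_sum_le _ _).trans ((Finset.sum_le_sum fun a _ => norm_sum_le _ _).trans
    (le_trans (Finset.sum_le_sum fun a _ => Finset.sum_le_sum fun b _ => ?_)
      (sum_sum_mul_le_entrySum P Q hc i j)))
  rw [norm_mul, norm_mul, RCLike.norm_conj, mul_right_comm]
  gcongr
  exact hK a b

lemma integral_norm_mul_norm_le_sqrt {α E : Type*} [MeasurableSpace α] [NormedAddCommGroup E]
    {μ : Measure α} {f g : α → E} (hf : MemLp f 2 μ) (hg : MemLp g 2 μ) :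
    ∫ a, ‖f a‖ * ‖g a‖ ∂μ ≤ Real.sqrt (∫ a, ‖f a‖ ^ 2 ∂μ) * Real.sqrt (∫ a, ‖g a‖ ^ 2 ∂μ) := by
  have h := integral_mul_norm_le_Lp_mul_Lq (μ := μ) (f := f) (g := g)
    (Real.HolderConjugate.two_two) (by simpa using hf) (by simpa using hg)
  simpa [Real.sqrt_eq_rpow] using h

/-- The root mean square `𝔼(|f(y,0)|²)^{1/2}` of a source with correlation kernel `K`. -/
def rootMeanSquare {X : Type*} {N : ℕ} (K : X → X → ℝ → Matrix (Fin N) (Fin N) ℂ) (y : X) : ℝ :=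
  Real.sqrt (K y y 0).trace.re

lemma rootMeanSquare_nonneg {X : Type*} {N : ℕ} (K : X → X → ℝ → Matrix (Fin N) (Fin N) ℂ)
    (y : X) : 0 ≤ rootMeanSquare K y :=
  Real.sqrt_nonneg _

section

variable {X Ω₀ : Type*} {N : ℕ} {f : X × ℝ → Ω₀ → Fin N → ℂ}
  {K : X → X → ℝ → Matrix (Fin N) (Fin N) ℂ} {P : ℝ → X → X → Matrix (Fin N) (Fin N) ℂ}

/-- The integrand `P(s,A,y) f(y,t-s)` of the causal solution, with `p = (s,y)`. -/
def causalIntegrand (P : ℝ → X → X → Matrix (Fin N) (Fin N) ℂ) (f : X × ℝ → Ω₀ → Fin N → ℂ)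
    (A : X) (t : ℝ) (p : ℝ × X) (ω : Ω₀) : Fin N → ℂ :=
  (P p.1 A p.2).mulVec (f (p.2, t - p.1) ω)

lemma causalIntegrand_apply (A : X) (t : ℝ) (p : ℝ × X) (ω : Ω₀) (i : Fin N) :
    causalIntegrand P f A t p ω i = ∑ a, P p.1 A p.2 i a * f (p.2, t - p.1) ω a := rfl

lemma norm_causalIntegrand_le (A : X) (t : ℝ) (p : ℝ × X) (ω : Ω₀) (i : Fin N) :
    ‖causalIntegrand P f A t p ω i‖ ≤ ∑ a, ‖P p.1 A p.2 i a‖ * ‖f (p.2, t - p.1) ω a‖ := by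
  rw [causalIntegrand_apply]
  refine (norm_sum_le _ _).trans_eq ?_
  simp only [norm_mul]

/-- The weight `|P(s,A,y)| 𝔼(|f(y,0)|²)^{1/2}` at `p = (s,y)`. -/
def causalWeight (P : ℝ → X → X → Matrix (Fin N) (Fin N) ℂ)
    (K : X → X → ℝ → Matrix (Fin N) (Fin N) ℂ) (A : X) (p : ℝ × X) : ℝ :=
  entrySum (P p.1 A p.2) * rootMeanSquare K p.2

lemma causalWeight_nonneg (A : X) (p : ℝ × X) : 0 ≤ causalWeight P K A p :=
  mul_nonneg (entrySum_nonneg _) (rootMeanSquare_nonneg K _)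

end

section

variable {X Ω₀ : Type*} [MeasurableSpace X] [MeasurableSpace Ω₀] {N : ℕ} {μ : Measure X}
  {ℙ : Measure Ω₀} {f : X × ℝ → Ω₀ → Fin N → ℂ} {K : X → X → ℝ → Matrix (Fin N) (Fin N) ℂ}
  {P : ℝ → X → X → Matrix (Fin N) (Fin N) ℂ}

namespace IsFunctionField

lemma measurable_apply (hf : IsFunctionField ℙ f K) (j : Fin N) :
    Measurable fun p : (X × ℝ) × Ω₀ => f p.1 p.2 j :=
  (measurable_pi_apply j).comp hf.measurable

lemma integral_sq_le (hf : IsFunctionField ℙ f K) (p : X × ℝ) (j : Fin N) :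
    ∫ ω, ‖f p ω j‖ ^ 2 ∂ℙ ≤ (K p.1 p.1 0).trace.re := by
  have h : ∀ i, (K p.1 p.1 0 i i).re = ∫ ω, ‖f p ω i‖ ^ 2 ∂ℙ := by
    intro i
    have h1 := hf.correlation p.1 p.1 p.2 p.2 i i
    rw [sub_self] at h1
    have h2 : ∫ ω, f p ω i * conj (f p ω i) ∂ℙ = ((∫ ω, ‖f p ω i‖ ^ 2 ∂ℙ : ℝ) : ℂ) := by
      rw [← integral_complex_ofReal]
      congr 1; ext ω
      rw [Complex.mul_conj, Complex.normSq_eq_norm_sq]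
    rw [← h1, h2, Complex.ofReal_re]
  rw [Matrix.trace, Complex.re_sum]
  simp only [Matrix.diag_apply, h]
  exact Finset.single_le_sum (f := fun i => ∫ ω, ‖f p ω i‖ ^ 2 ∂ℙ)
    (fun i _ => integral_nonneg fun ω => by positivity) (Finset.mem_univ j)

lemma integral_norm_mul_le (hf : IsFunctionField ℙ f K) (p q : X × ℝ) (i j : Fin N) :
    ∫ ω, ‖f p ω i‖ * ‖f q ω j‖ ∂ℙ ≤ rootMeanSquare K p.1 * rootMeanSquare K q.1 :=
  (integral_norm_mul_norm_le_sqrt (hf.memLp p i) (hf.memLp q j)).trans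
    (mul_le_mul (Real.sqrt_le_sqrt (hf.integral_sq_le p i))
      (Real.sqrt_le_sqrt (hf.integral_sq_le q j)) (Real.sqrt_nonneg _) (Real.sqrt_nonneg _))

lemma integral_norm_le [IsProbabilityMeasure ℙ] (hf : IsFunctionField ℙ f K) (p : X × ℝ)
    (i : Fin N) : ∫ ω, ‖f p ω i‖ ∂ℙ ≤ rootMeanSquare K p.1 := by
  have h := integral_norm_mul_norm_le_sqrt (hf.memLp p i) (memLp_const (1 : ℂ))
  simp only [norm_one, mul_one, one_pow, integral_const, probReal_univ, smul_eq_mul,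
    Real.sqrt_one] at h
  exact h.trans (Real.sqrt_le_sqrt (hf.integral_sq_le p i))

/-- The Cauchy–Schwarz inequality for the correlation kernel. -/
lemma norm_kernel_le (hf : IsFunctionField ℙ f K) (x y : X) (σ : ℝ) (i j : Fin N) :
    ‖K x y σ i j‖ ≤ rootMeanSquare K x * rootMeanSquare K y := by
  have h := hf.correlation x y σ 0 i j
  rw [sub_zero] at h
  rw [← h]
  refine (norm_integral_le_integral_norm _).trans ?_
  simp only [norm_mul, RCLike.norm_conj]
  exact hf.integral_norm_mul_le (x, σ) (y, 0) i j

lemma measurable_kernel [SFinite ℙ] (hf : IsFunctionField ℙ f K) (i j : Fin N) :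
    Measurable fun q : (X × X) × ℝ => K q.1.1 q.1.2 q.2 i j := by
  have h : ∀ q : (X × X) × ℝ, K q.1.1 q.1.2 q.2 i j =
      ∫ ω, f (q.1.1, q.2) ω i * conj (f (q.1.2, 0) ω j) ∂ℙ := by
    intro q
    rw [hf.correlation, sub_zero]
  simp_rw [h]
  refine StronglyMeasurable.measurable ?_
  refine StronglyMeasurable.integral_prod_right (f := fun (q : (X × X) × ℝ) ω =>
    f (q.1.1, q.2) ω i * conj (f (q.1.2, 0) ω j)) ?_
  refine Measurable.stronglyMeasurable ?_
  refine Measurable.mul ((hf.measurable_apply i).comp (by fun_prop :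
    Measurable fun p : ((X × X) × ℝ) × Ω₀ => (((p.1.1.1, p.1.2) : X × ℝ), p.2)))
    (Complex.continuous_conj.measurable.comp ((hf.measurable_apply j).comp (by fun_prop :
    Measurable fun p : ((X × X) × ℝ) × Ω₀ => (((p.1.1.2, 0) : X × ℝ), p.2))))

lemma measurable_rootMeanSquare [SFinite ℙ] (hf : IsFunctionField ℙ f K) :
    Measurable (rootMeanSquare K) := by
  refine Real.continuous_sqrt.measurable.comp (Complex.measurable_re.comp ?_)
  simp only [Matrix.trace, Matrix.diag_apply]
  refine Finset.measurable_sum _ fun i _ => ?_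
  exact (hf.measurable_kernel i i).comp (by fun_prop : Measurable fun y : X => ((y, y), (0 : ℝ)))

lemma isErgodicPathFlow (hf : IsFunctionField ℙ f K)
    (hstat : IsStationaryFamily ℙ (fun t (p : X × ℝ) => (p.1, p.2 + t)) f)
    (herg : IsErgodicFamily ℙ (fun t (p : X × ℝ) => (p.1, p.2 + t)) f) :
    IsErgodicPathFlow ℙ (fun ω i => f i ω)
      (fun t (F : X × ℝ → Fin N → ℂ) p => F (p.1, p.2 + t)) :=
  isErgodicPathFlow_of_family (fun p => hf.measurable.comp measurable_prodMk_left)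
    (fun p => by simp) (fun s t p => by simp [add_assoc, add_comm s t]) hstat herg

end IsFunctionField

/-- The measure on delays and source points. -/
def delayMeasure (μ : Measure X) : Measure (ℝ × X) := (volume.restrict (Ioi (0 : ℝ))).prod μ

instance [SFinite μ] : SFinite (delayMeasure μ) := by unfold delayMeasure; infer_instance

lemma CausalIntegrable.integrable_causalWeight {A : X} (hA : CausalIntegrable μ P K A) :
    Integrable (causalWeight P K A) (delayMeasure μ) := hA

lemma measurable_causalIntegrand (hf : IsFunctionField ℙ f K)
    (hP : ∀ i j, Measurable fun p : ℝ × X × X => P p.1 p.2.1 p.2.2 i j) (A : X) (i : Fin N) :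
    Measurable fun q : (ℝ × (ℝ × X)) × Ω₀ => causalIntegrand P f A q.1.1 q.1.2 q.2 i := by
  simp only [causalIntegrand_apply]
  refine Finset.measurable_sum _ fun a _ => ?_
  refine Measurable.mul ((hP i a).comp (by fun_prop :
    Measurable fun q : (ℝ × (ℝ × X)) × Ω₀ => (q.1.2.1, A, q.1.2.2)))
    ((hf.measurable_apply a).comp (by fun_prop :
    Measurable fun q : (ℝ × (ℝ × X)) × Ω₀ => (((q.1.2.2, q.1.1 - q.1.2.1) : X × ℝ), q.2)))

lemma memLp_causalIntegrand (hf : IsFunctionField ℙ f K) (A : X) (t : ℝ) (p : ℝ × X) (i : Fin N) :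
    MemLp (fun ω => causalIntegrand P f A t p ω i) 2 ℙ := by
  simp only [causalIntegrand_apply]
  exact memLp_finsetSum _ fun a _ => (hf.memLp _ a).const_mul _

lemma integral_norm_causalIntegrand_mul_le (hf : IsFunctionField ℙ f K) (A B : X) (t t' : ℝ)
    (p q : ℝ × X) (i j : Fin N) :
    ∫ ω, ‖causalIntegrand P f A t p ω i‖ * ‖causalIntegrand P f B t' q ω j‖ ∂ℙ ≤
      causalWeight P K A p * causalWeight P K B q := by
  have hint : ∀ a b, Integrable (fun ω => ‖f (p.2, t - p.1) ω a‖ * ‖f (q.2, t' - q.1) ω b‖) ℙ :=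
    fun a b => (hf.memLp _ a).norm.integrable_mul (hf.memLp _ b).norm
  have hle : ∀ ω, ‖causalIntegrand P f A t p ω i‖ * ‖causalIntegrand P f B t' q ω j‖ ≤
      ∑ a, ∑ b, (‖P p.1 A p.2 i a‖ * ‖P q.1 B q.2 j b‖) *
        (‖f (p.2, t - p.1) ω a‖ * ‖f (q.2, t' - q.1) ω b‖) := by
    intro ω
    refine (mul_le_mul (norm_causalIntegrand_le A t p ω i) (norm_causalIntegrand_le B t' q ω j)
      (norm_nonneg _) (Finset.sum_nonneg fun _ _ => by positivity)).trans_eq ?_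
    rw [Finset.sum_mul_sum]
    refine Finset.sum_congr rfl fun a _ => Finset.sum_congr rfl fun b _ => ?_
    ring
  have hi1 : Integrable (fun ω => ∑ a, ∑ b, (‖P p.1 A p.2 i a‖ * ‖P q.1 B q.2 j b‖) *
        (‖f (p.2, t - p.1) ω a‖ * ‖f (q.2, t' - q.1) ω b‖)) ℙ :=
    integrable_finsetSum _ fun a _ => integrable_finsetSum _ fun b _ => (hint a b).const_mul _
  refine (integral_mono_of_nonneg (ae_of_all _ fun ω => by positivity) hi1
    (ae_of_all _ hle)).trans ?_
  rw [integral_finsetSum _ fun a _ => integrable_finsetSum _ fun b _ => (hint a b).const_mul _]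
  have hc := mul_nonneg (rootMeanSquare_nonneg K p.2) (rootMeanSquare_nonneg K q.2)
  calc _ = ∑ a, ∑ b, (‖P p.1 A p.2 i a‖ * ‖P q.1 B q.2 j b‖) *
        ∫ ω, ‖f (p.2, t - p.1) ω a‖ * ‖f (q.2, t' - q.1) ω b‖ ∂ℙ := by
        refine Finset.sum_congr rfl fun a _ => ?_
        rw [integral_finsetSum _ fun b _ => (hint a b).const_mul _]
        refine Finset.sum_congr rfl fun b _ => ?_
        rw [integral_const_mul]
    _ ≤ ∑ a, ∑ b, ‖P p.1 A p.2 i a‖ * ‖P q.1 B q.2 j b‖ *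
        (rootMeanSquare K p.2 * rootMeanSquare K q.2) := by
        gcongr with a _ b _
        exact hf.integral_norm_mul_le _ _ a b
    _ ≤ _ := (sum_sum_mul_le_entrySum _ _ hc i j).trans_eq
        (by rw [causalWeight, causalWeight]; ring)

lemma integrable_causalIntegrand [IsProbabilityMeasure ℙ] [SFinite μ] (hf : IsFunctionField ℙ f K)
    (hP : ∀ i j, Measurable fun p : ℝ × X × X => P p.1 p.2.1 p.2.2 i j) {A : X}
    (hA : CausalIntegrable μ P K A) (t : ℝ) (i : Fin N) :
    Integrable (Function.uncurry fun p ω => causalIntegrand P f A t p ω i)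
      ((delayMeasure μ).prod ℙ) := by
  have hm : Measurable (Function.uncurry fun p ω => causalIntegrand P f A t p ω i) :=
    (measurable_causalIntegrand hf hP A i).comp (by fun_prop :
      Measurable fun q : (ℝ × X) × Ω₀ => (((t, q.1) : ℝ × (ℝ × X)), q.2))
  refine (integrable_prod_iff hm.aestronglyMeasurable).2 ⟨ae_of_all _ fun p =>
    (memLp_causalIntegrand hf A t p i).integrable (by norm_num), ?_⟩
  refine hA.integrable_causalWeight.mono' hm.norm.aestronglyMeasurable.integral_prod_right'
    (ae_of_all _ fun p => ?_)
  rw [Real.norm_of_nonneg (integral_nonneg fun ω => norm_nonneg _)]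
  have hint : ∀ a, Integrable (fun ω => ‖f (p.2, t - p.1) ω a‖) ℙ := fun a =>
    ((hf.memLp _ a).integrable (by norm_num)).norm
  calc ∫ ω, ‖causalIntegrand P f A t p ω i‖ ∂ℙ
      ≤ ∫ ω, ∑ a, ‖P p.1 A p.2 i a‖ * ‖f (p.2, t - p.1) ω a‖ ∂ℙ :=
        integral_mono_of_nonneg (ae_of_all _ fun ω => norm_nonneg _)
          (integrable_finsetSum _ fun a _ => (hint a).const_mul _)
          (ae_of_all _ fun ω => norm_causalIntegrand_le A t p ω i)
    _ = ∑ a, ‖P p.1 A p.2 i a‖ * ∫ ω, ‖f (p.2, t - p.1) ω a‖ ∂ℙ := by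
        rw [integral_finsetSum _ fun a _ => (hint a).const_mul _]
        simp only [integral_const_mul]
    _ ≤ ∑ a, ‖P p.1 A p.2 i a‖ * rootMeanSquare K p.2 := by
        gcongr with a _
        exact hf.integral_norm_le _ a
    _ ≤ causalWeight P K A p := by
        rw [← Finset.sum_mul]
        exact mul_le_mul_of_nonneg_right (sum_norm_row_le_entrySum _ i)
          (rootMeanSquare_nonneg K _)

/-- The components of the causal solution are absolutely convergent integrals. -/
lemma causalSolution_ae_eq [IsProbabilityMeasure ℙ] [SFinite μ] (hf : IsFunctionField ℙ f K)
    (hP : ∀ i j, Measurable fun p : ℝ × X × X => P p.1 p.2.1 p.2.2 i j) {A : X}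
    (hA : CausalIntegrable μ P K A) (t : ℝ) :
    ∀ᵐ ω ∂ℙ, ∀ i, Integrable (fun p => causalIntegrand P f A t p ω i) (delayMeasure μ) ∧
      causalSolution μ P f A t ω i = ∫ p, causalIntegrand P f A t p ω i ∂(delayMeasure μ) := by
  have h : ∀ i, ∀ᵐ ω ∂ℙ, Integrable (fun p => causalIntegrand P f A t p ω i) (delayMeasure μ) :=
    fun i => (integrable_causalIntegrand hf hP hA t i).prod_left_ae
  filter_upwards [ae_all_iff.2 h] with ω hω i
  refine ⟨hω i, ?_⟩
  have hint : Integrable (fun p => causalIntegrand P f A t p ω) (delayMeasure μ) :=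
    Integrable.of_eval hω
  rw [← eval_integral hω, delayMeasure, integral_prod _ hint]
  rfl

lemma measurable_causalSolution [SFinite μ] (hf : IsFunctionField ℙ f K)
    (hP : ∀ i j, Measurable fun p : ℝ × X × X => P p.1 p.2.1 p.2.2 i j) (A : X) (i : Fin N) :
    Measurable (Function.uncurry fun t ω => causalSolution μ P f A t ω i) := by
  have h0 : Measurable fun q : (ℝ × (ℝ × X)) × Ω₀ => causalIntegrand P f A q.1.1 q.1.2 q.2 :=
    measurable_pi_lambda _ fun i => measurable_causalIntegrand hf hP A i
  have h1 : StronglyMeasurable fun q : ((ℝ × Ω₀) × ℝ) × X =>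
      causalIntegrand P f A q.1.1.1 (q.1.2, q.2) q.1.1.2 :=
    (h0.comp (by fun_prop : Measurable fun q : ((ℝ × Ω₀) × ℝ) × X =>
      (((q.1.1.1, (q.1.2, q.2)) : ℝ × (ℝ × X)), q.1.1.2))).stronglyMeasurable
  have h2 : StronglyMeasurable fun q : (ℝ × Ω₀) × ℝ =>
      ∫ y, causalIntegrand P f A q.1.1 (q.2, y) q.1.2 ∂μ := h1.integral_prod_right'
  have h3 : StronglyMeasurable fun q : ℝ × Ω₀ =>
      ∫ s in Ioi (0 : ℝ), ∫ y, causalIntegrand P f A q.1 (s, y) q.2 ∂μ := h2.integral_prod_right'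
  exact (measurable_pi_apply i).comp h3.measurable

/-- The causal solution at an admissible point is a stationary process generated by a function on
path space. -/
lemma exists_isGeneratedBy_causalSolution [IsProbabilityMeasure ℙ] [SFinite μ]
    (hf : IsFunctionField ℙ f K)
    (hstat : IsStationaryFamily ℙ (fun t (p : X × ℝ) => (p.1, p.2 + t)) f)
    (herg : IsErgodicFamily ℙ (fun t (p : X × ℝ) => (p.1, p.2 + t)) f)
    (hP : ∀ i j, Measurable fun p : ℝ × X × X => P p.1 p.2.1 p.2.2 i j) {A : X}
    (hA : CausalIntegrable μ P K A) (i : Fin N) :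
    ∃ Y : (X × ℝ → Fin N → ℂ) → ℂ, Measurable Y ∧
      IsGeneratedBy ℙ (fun ω i => f i ω) (fun t (F : X × ℝ → Fin N → ℂ) p => F (p.1, p.2 + t))
        (fun t ω => causalSolution μ P f A t ω i) Y := by
  obtain ⟨Y, hY, hgen⟩ := (hf.isErgodicPathFlow hstat herg).exists_isGeneratedBy_integral
    (u := fun t p ω => causalIntegrand P f A t p ω i)
    (fun t => integrable_causalIntegrand hf hP hA t i)
    (y := fun p F => ∑ a, P p.1 A p.2 i a * F (p.2, -p.1) a)
    (fun p => Measurable.stronglyMeasurable (Finset.measurable_sum _ fun a _ =>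
      ((measurable_pi_apply a).comp (measurable_pi_apply (p.2, -p.1))).const_mul _))
    (fun t => ae_of_all _ fun p => ae_of_all _ fun ω => by
      simp only [causalIntegrand_apply, sub_eq_neg_add])
  refine ⟨Y, hY.measurable, fun t => ?_⟩
  filter_upwards [hgen t, causalSolution_ae_eq hf hP hA t] with ω h1 h2
  rw [(h2 i).2]
  exact h1

end

/-! ### Pointwise time correlations -/

lemma measurePreserving_prodProdComm {α β γ δ : Type*} [MeasurableSpace α] [MeasurableSpace β]
    [MeasurableSpace γ] [MeasurableSpace δ] (a : Measure α) (b : Measure β) (c : Measure γ)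
    (d : Measure δ) [SFinite a] [SFinite b] [SFinite c] [SFinite d] :
    MeasurePreserving (fun q : (α × β) × (γ × δ) => ((q.1.1, q.2.1), (q.1.2, q.2.2)))
      ((a.prod b).prod (c.prod d)) ((a.prod c).prod (b.prod d)) := by
  have e1 := measurePreserving_prodAssoc a b (c.prod d)
  have e2 := (measurePreserving_prodAssoc b c d).symm
  have e3 := (Measure.measurePreserving_swap (μ := b) (ν := c)).prod (MeasurePreserving.id d)
  have e4 := measurePreserving_prodAssoc c b d
  have e5 := (measurePreserving_prodAssoc a c (b.prod d)).symm
  exact e5.comp (((MeasurePreserving.id a).prod (e4.comp (e3.comp e2))).comp e1)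

/-- The measure on `((s, σ), (x, y))` for which the time correlation is an absolutely convergent
integral. -/
def lagMeasure {X : Type*} [MeasurableSpace X] (μ : Measure X) (τ : ℝ) :
    Measure ((ℝ × ℝ) × (X × X)) :=
  (volume.restrict (causalRegion τ)).prod (μ.prod μ)

/-- The change of variables `s = s₂`, `σ = τ + s₂ - s₁` from pairs of delays `(s₁, s₂)`. -/
lemma measurePreserving_delay (τ : ℝ) :
    MeasurePreserving (fun p : ℝ × ℝ => (p.2, τ + p.2 - p.1))
      ((volume.restrict (Ioi 0)).prod (volume.restrict (Ioi 0)))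
      (volume.restrict (causalRegion τ)) := by
  have h1 : MeasurePreserving (fun y : ℝ => -y - τ) volume volume :=
    (measurePreserving_sub_right volume τ).comp (Measure.measurePreserving_neg volume)
  have h2 : MeasurePreserving (fun p : ℝ × ℝ => (p.2, τ + p.2 - p.1)) := by
    have h3 := (measurePreserving_lag τ).comp
      ((Measure.measurePreserving_neg (volume : Measure ℝ)).prod h1)
    have he : (fun p : ℝ × ℝ => (p.2, τ + p.2 - p.1)) =
        (fun p : ℝ × ℝ => (-p.2 - τ, p.1 - p.2)) ∘ Prod.map Neg.neg fun y => -y - τ := by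
      funext p
      refine Prod.ext ?_ ?_ <;> simp only [Function.comp_apply, Prod.map] <;> ring
    rw [he]
    exact h3
  have h4 := h2.restrict_preimage (measurableSet_causalRegion τ)
  have h5 : (fun p : ℝ × ℝ => (p.2, τ + p.2 - p.1)) ⁻¹' causalRegion τ = Ioi 0 ×ˢ Ioi 0 := by
    ext p
    rw [mem_preimage, mem_causalRegion, mem_prod, mem_Ioi, mem_Ioi]
    constructor
    · rintro ⟨h, h'⟩; simp only at h h'; exact ⟨by linarith, h⟩
    · rintro ⟨h, h'⟩; exact ⟨h', by simp only; linarith⟩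
  rwa [h5, Measure.volume_eq_prod, ← Measure.prod_restrict] at h4

/-- The change of variables `s = s₂`, `σ = τ + s₂ - s₁` from pairs of delays and source points. -/
lemma measurePreserving_delay_lag {X : Type*} [MeasurableSpace X] (μ : Measure X) [SFinite μ]
    (τ : ℝ) :
    MeasurePreserving
      (fun q : (ℝ × X) × (ℝ × X) => ((q.2.1, τ + q.2.1 - q.1.1), (q.1.2, q.2.2)))
      ((delayMeasure μ).prod (delayMeasure μ)) (lagMeasure μ τ) :=
  ((measurePreserving_delay τ).prod (MeasurePreserving.id (μ.prod μ))).comp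
    (measurePreserving_prodProdComm _ _ _ _)

section

variable {X : Type*} {N : ℕ}

/-- The integrand `P(s+τ-σ,A,x) K(x,y,σ) P(s,B,y)*` of the time correlation at
`q = ((s,σ),(x,y))`. -/
def lagIntegrand (P : ℝ → X → X → Matrix (Fin N) (Fin N) ℂ)
    (K : X → X → ℝ → Matrix (Fin N) (Fin N) ℂ) (A B : X) (τ : ℝ) (q : (ℝ × ℝ) × (X × X)) :
    Matrix (Fin N) (Fin N) ℂ :=
  P (q.1.1 + τ - q.1.2) A q.2.1 * K q.2.1 q.2.2 q.1.2 * (P q.1.1 B q.2.2).conjTranspose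

lemma lagIntegrand_delay {P : ℝ → X → X → Matrix (Fin N) (Fin N) ℂ}
    {K : X → X → ℝ → Matrix (Fin N) (Fin N) ℂ} (A B : X) (τ : ℝ) (q : (ℝ × X) × (ℝ × X)) :
    lagIntegrand P K A B τ ((q.2.1, τ + q.2.1 - q.1.1), (q.1.2, q.2.2)) =
      P q.1.1 A q.1.2 * K q.1.2 q.2.2 (τ + q.2.1 - q.1.1) * (P q.2.1 B q.2.2).conjTranspose := by
  rw [lagIntegrand]
  congr 3
  simp only
  ring

/-- The time correlation `C_{A,B}(τ)` of the causal solution. -/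
def pointCorrelation [MeasurableSpace X] (μ : Measure X)
    (P : ℝ → X → X → Matrix (Fin N) (Fin N) ℂ) (K : X → X → ℝ → Matrix (Fin N) (Fin N) ℂ)
    (A B : X) (τ : ℝ) : Matrix (Fin N) (Fin N) ℂ :=
  Matrix.of fun i j => ∫ q, lagIntegrand P K A B τ q i j ∂(lagMeasure μ τ)

end

section

variable {X Ω₀ : Type*} [MeasurableSpace X] [MeasurableSpace Ω₀] {N : ℕ} {μ : Measure X}
  {ℙ : Measure Ω₀} {f : X × ℝ → Ω₀ → Fin N → ℂ} {K : X → X → ℝ → Matrix (Fin N) (Fin N) ℂ}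
  {P : ℝ → X → X → Matrix (Fin N) (Fin N) ℂ}

instance [SFinite μ] (τ : ℝ) : SFinite (lagMeasure μ τ) := by unfold lagMeasure; infer_instance

lemma measurable_lagIntegrand [SFinite ℙ] (hf : IsFunctionField ℙ f K)
    (hP : ∀ i j, Measurable fun p : ℝ × X × X => P p.1 p.2.1 p.2.2 i j) (τ : ℝ) (i j : Fin N) :
    Measurable fun r : (X × X) × ((ℝ × ℝ) × (X × X)) =>
      lagIntegrand P K r.1.1 r.1.2 τ r.2 i j := by
  simp only [lagIntegrand, mul_mul_conjTranspose_apply]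
  refine Finset.measurable_sum _ fun a _ => Finset.measurable_sum _ fun b _ => ?_
  refine Measurable.mul (Measurable.mul ?_ ?_) (Complex.continuous_conj.measurable.comp ?_)
  · exact (hP i a).comp (by fun_prop : Measurable fun r : (X × X) × ((ℝ × ℝ) × (X × X)) =>
      (r.2.1.1 + τ - r.2.1.2, r.1.1, r.2.2.1))
  · exact (hf.measurable_kernel a b).comp (by fun_prop :
      Measurable fun r : (X × X) × ((ℝ × ℝ) × (X × X)) => ((r.2.2.1, r.2.2.2), r.2.1.2))
  · exact (hP j b).comp (by fun_prop : Measurable fun r : (X × X) × ((ℝ × ℝ) × (X × X)) =>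
      (r.2.1.1, r.1.2, r.2.2.2))

lemma measurable_lagIntegrand_right [SFinite ℙ] (hf : IsFunctionField ℙ f K)
    (hP : ∀ i j, Measurable fun p : ℝ × X × X => P p.1 p.2.1 p.2.2 i j) (A B : X) (τ : ℝ)
    (i j : Fin N) : Measurable fun q => lagIntegrand P K A B τ q i j := by
  have h := (measurable_lagIntegrand hf hP τ i j).comp (measurable_prodMk_left (x := (A, B)))
  exact h

lemma norm_lagIntegrand_delay_le (hf : IsFunctionField ℙ f K) (A B : X) (τ : ℝ)
    (q : (ℝ × X) × (ℝ × X)) (i j : Fin N) :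
    ‖lagIntegrand P K A B τ ((q.2.1, τ + q.2.1 - q.1.1), (q.1.2, q.2.2)) i j‖ ≤
      causalWeight P K A q.1 * causalWeight P K B q.2 := by
  rw [lagIntegrand_delay]
  refine (norm_mul_mul_conjTranspose_le _ _ _ (mul_nonneg (rootMeanSquare_nonneg K q.1.2)
    (rootMeanSquare_nonneg K q.2.2)) (fun a b => hf.norm_kernel_le _ _ _ a b) i j).trans_eq ?_
  rw [causalWeight, causalWeight]; ring

/-- The correlation integral converges absolutely: in terms of the two delays its integrand is
dominated by a product. -/
lemma integrable_lagIntegrand [SFinite ℙ] [SFinite μ] (hf : IsFunctionField ℙ f K)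
    (hP : ∀ i j, Measurable fun p : ℝ × X × X => P p.1 p.2.1 p.2.2 i j) {A B : X}
    (hA : CausalIntegrable μ P K A) (hB : CausalIntegrable μ P K B) (τ : ℝ) (i j : Fin N) :
    Integrable (fun q => lagIntegrand P K A B τ q i j) (lagMeasure μ τ) ∧
      ∫ q, ‖lagIntegrand P K A B τ q i j‖ ∂(lagMeasure μ τ) ≤
        (∫ p, causalWeight P K A p ∂(delayMeasure μ)) *
          ∫ p, causalWeight P K B p ∂(delayMeasure μ) := by
  have hm := measurable_lagIntegrand_right hf hP A B τ i j
  have hmp := measurePreserving_delay_lag μ τ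
  have hw := hA.integrable_causalWeight.mul_prod hB.integrable_causalWeight
  have hle : ∀ᵐ q ∂((delayMeasure μ).prod (delayMeasure μ)),
      ‖lagIntegrand P K A B τ ((q.2.1, τ + q.2.1 - q.1.1), (q.1.2, q.2.2)) i j‖ ≤
      causalWeight P K A q.1 * causalWeight P K B q.2 :=
    ae_of_all _ fun q => norm_lagIntegrand_delay_le hf A B τ q i j
  have hmc : Measurable fun q : (ℝ × X) × (ℝ × X) =>
      lagIntegrand P K A B τ ((q.2.1, τ + q.2.1 - q.1.1), (q.1.2, q.2.2)) i j :=
    hm.comp hmp.measurable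
  have hic := hw.mono' hmc.aestronglyMeasurable hle
  refine ⟨(hmp.integrable_comp (g := fun q => lagIntegrand P K A B τ q i j)
    hm.aestronglyMeasurable).1 hic, ?_⟩
  rw [← integral_comp_of_measurePreserving (G := fun q => ‖lagIntegrand P K A B τ q i j‖) hmp
    hm.norm.aestronglyMeasurable, ← integral_prod_mul]
  exact integral_mono_of_nonneg (ae_of_all _ fun q => norm_nonneg _) hw hle

lemma measurable_causalIntegrand_mul (hf : IsFunctionField ℙ f K)
    (hP : ∀ i j, Measurable fun p : ℝ × X × X => P p.1 p.2.1 p.2.2 i j) (A B : X) (t t' : ℝ)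
    (i j : Fin N) :
    Measurable fun r : ((ℝ × X) × (ℝ × X)) × Ω₀ =>
      causalIntegrand P f A t r.1.1 r.2 i * conj (causalIntegrand P f B t' r.1.2 r.2 j) := by
  have h1 := (measurable_causalIntegrand hf hP A i).comp (by fun_prop :
    Measurable fun r : ((ℝ × X) × (ℝ × X)) × Ω₀ => (((t, r.1.1) : ℝ × (ℝ × X)), r.2))
  have h2 := (measurable_causalIntegrand hf hP B j).comp (by fun_prop :
    Measurable fun r : ((ℝ × X) × (ℝ × X)) × Ω₀ => (((t', r.1.2) : ℝ × (ℝ × X)), r.2))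
  exact h1.mul (Complex.continuous_conj.measurable.comp h2)

lemma integrable_causalIntegrand_mul [IsProbabilityMeasure ℙ] [SFinite μ]
    (hf : IsFunctionField ℙ f K)
    (hP : ∀ i j, Measurable fun p : ℝ × X × X => P p.1 p.2.1 p.2.2 i j) {A B : X}
    (hA : CausalIntegrable μ P K A) (hB : CausalIntegrable μ P K B) (t t' : ℝ) (i j : Fin N) :
    Integrable (fun r : ((ℝ × X) × (ℝ × X)) × Ω₀ =>
      causalIntegrand P f A t r.1.1 r.2 i * conj (causalIntegrand P f B t' r.1.2 r.2 j))
      (((delayMeasure μ).prod (delayMeasure μ)).prod ℙ) := by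
  have hm := measurable_causalIntegrand_mul hf hP A B t t' i j
  have hw := hA.integrable_causalWeight.mul_prod hB.integrable_causalWeight
  refine (integrable_prod_iff hm.aestronglyMeasurable).2 ⟨ae_of_all _ fun q =>
    (memLp_causalIntegrand hf A t q.1 i).integrable_mul
      (memLp_causalIntegrand hf B t' q.2 j).star, ?_⟩
  refine hw.mono' hm.norm.aestronglyMeasurable.integral_prod_right' (ae_of_all _ fun q => ?_)
  rw [Real.norm_of_nonneg (integral_nonneg fun ω => norm_nonneg _)]
  simp only [norm_mul, RCLike.norm_conj]
  exact integral_norm_causalIntegrand_mul_le hf A B t t' q.1 q.2 i j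

lemma integral_causalIntegrand_mul (hf : IsFunctionField ℙ f K) (A B : X) (τ : ℝ)
    (q : (ℝ × X) × (ℝ × X)) (i j : Fin N) :
    ∫ ω, causalIntegrand P f A 0 q.1 ω i * conj (causalIntegrand P f B (-τ) q.2 ω j) ∂ℙ =
      lagIntegrand P K A B τ ((q.2.1, τ + q.2.1 - q.1.1), (q.1.2, q.2.2)) i j := by
  rw [lagIntegrand_delay, mul_mul_conjTranspose_apply]
  have hi : ∀ a b, Integrable (fun ω => P q.1.1 A q.1.2 i a * conj (P q.2.1 B q.2.2 j b) *
      (f (q.1.2, 0 - q.1.1) ω a * conj (f (q.2.2, -τ - q.2.1) ω b))) ℙ := fun a b =>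
    ((hf.memLp _ a).integrable_mul (hf.memLp _ b).star).const_mul _
  have hexp : ∀ ω, causalIntegrand P f A 0 q.1 ω i * conj (causalIntegrand P f B (-τ) q.2 ω j) =
      ∑ a, ∑ b, P q.1.1 A q.1.2 i a * conj (P q.2.1 B q.2.2 j b) *
      (f (q.1.2, 0 - q.1.1) ω a * conj (f (q.2.2, -τ - q.2.1) ω b)) := by
    intro ω
    rw [causalIntegrand_apply, causalIntegrand_apply, map_sum, Finset.sum_mul_sum]
    refine Finset.sum_congr rfl fun a _ => Finset.sum_congr rfl fun b _ => ?_
    rw [map_mul]; ring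
  simp_rw [hexp]
  rw [integral_finsetSum _ fun a _ => integrable_finsetSum _ fun b _ => hi a b]
  refine Finset.sum_congr rfl fun a _ => ?_
  rw [integral_finsetSum _ fun b _ => hi a b]
  refine Finset.sum_congr rfl fun b _ => ?_
  rw [integral_const_mul, hf.correlation]
  have : 0 - q.1.1 - (-τ - q.2.1) = τ + q.2.1 - q.1.1 := by ring
  rw [this]; ring

/-- The expectation of `u(A,0) ⊗ u(B,-τ)*`, by Fubini's theorem. -/
lemma integral_causalSolution_mul [IsProbabilityMeasure ℙ] [SFinite μ]
    (hf : IsFunctionField ℙ f K)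
    (hP : ∀ i j, Measurable fun p : ℝ × X × X => P p.1 p.2.1 p.2.2 i j) {A B : X}
    (hA : CausalIntegrable μ P K A) (hB : CausalIntegrable μ P K B) (τ : ℝ) (i j : Fin N) :
    Integrable (fun ω => causalSolution μ P f A 0 ω i * conj (causalSolution μ P f B (-τ) ω j)) ℙ ∧
      ∫ ω, causalSolution μ P f A 0 ω i * conj (causalSolution μ P f B (-τ) ω j) ∂ℙ =
        pointCorrelation μ P K A B τ i j := by
  have hint := integrable_causalIntegrand_mul hf hP hA hB 0 (-τ) i j
  have hprod : ∀ᵐ ω ∂ℙ, ∫ q, causalIntegrand P f A 0 q.1 ω i *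
      conj (causalIntegrand P f B (-τ) q.2 ω j) ∂((delayMeasure μ).prod (delayMeasure μ)) =
      causalSolution μ P f A 0 ω i * conj (causalSolution μ P f B (-τ) ω j) := by
    filter_upwards [causalSolution_ae_eq hf hP hA 0, causalSolution_ae_eq hf hP hB (-τ)]
      with ω h1 h2
    rw [(h1 i).2, (h2 j).2, ← integral_conj]
    exact integral_prod_mul (fun p => causalIntegrand P f A 0 p ω i)
      (fun p => conj (causalIntegrand P f B (-τ) p ω j))
  refine ⟨hint.integral_prod_right.congr hprod, ?_⟩
  have hlag := measurable_lagIntegrand_right hf hP A B τ i j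
  rw [← integral_congr_ae hprod, pointCorrelation, Matrix.of_apply,
    ← integral_comp_of_measurePreserving
    (G := fun q => lagIntegrand P K A B τ q i j) (measurePreserving_delay_lag μ τ)
    hlag.aestronglyMeasurable]
  simp_rw [← integral_causalIntegrand_mul hf A B τ]
  exact integral_integral_swap (f := fun ω (q : (ℝ × X) × (ℝ × X)) =>
    causalIntegrand P f A 0 q.1 ω i * conj (causalIntegrand P f B (-τ) q.2 ω j)) hint.swap

lemma hasTimeCorrelation_causalSolution [IsProbabilityMeasure ℙ] [SFinite μ]
    (hf : IsFunctionField ℙ f K)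
    (hstat : IsStationaryFamily ℙ (fun t (p : X × ℝ) => (p.1, p.2 + t)) f)
    (herg : IsErgodicFamily ℙ (fun t (p : X × ℝ) => (p.1, p.2 + t)) f)
    (hP : ∀ i j, Measurable fun p : ℝ × X × X => P p.1 p.2.1 p.2.2 i j) {A B : X}
    (hA : CausalIntegrable μ P K A) (hB : CausalIntegrable μ P K B) (τ : ℝ) (i j : Fin N) :
    HasTimeCorrelation ℙ (fun t ω => causalSolution μ P f A t ω i)
      (fun t ω => causalSolution μ P f B t ω j) τ (pointCorrelation μ P K A B τ i j) := by
  obtain ⟨Y, hY, hYg⟩ := exists_isGeneratedBy_causalSolution hf hstat herg hP hA i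
  obtain ⟨Z, hZ, hZg⟩ := exists_isGeneratedBy_causalSolution hf hstat herg hP hB j
  have hF := hf.isErgodicPathFlow hstat herg
  obtain ⟨hi, he⟩ := integral_causalSolution_mul hf hP hA hB τ i j
  have hae : (fun ω => causalSolution μ P f A 0 ω i *
      conj (causalSolution μ P f B (-τ) ω j)) =ᵐ[ℙ] fun ω =>
      Y (fun p => f p ω) * conj (Z (fun p => f (p.1, p.2 + -τ) ω)) := by
    filter_upwards [hYg 0, hZg (-τ)] with ω h1 h2
    rw [h1, h2]
    simp only [add_zero]
  have h := hF.hasTimeCorrelation (measurable_causalSolution hf hP A i)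
    (measurable_causalSolution hf hP B j) hY hZ hYg hZg (τ := τ) (hi.congr hae)
  rw [← he, integral_congr_ae hae]
  exact h

/-- The symmetry of the correlation follows from stationarity. -/
lemma pointCorrelation_neg [IsProbabilityMeasure ℙ] [SFinite μ]
    (hf : IsFunctionField ℙ f K)
    (hstat : IsStationaryFamily ℙ (fun t (p : X × ℝ) => (p.1, p.2 + t)) f)
    (herg : IsErgodicFamily ℙ (fun t (p : X × ℝ) => (p.1, p.2 + t)) f)
    (hP : ∀ i j, Measurable fun p : ℝ × X × X => P p.1 p.2.1 p.2.2 i j) {A B : X}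
    (hA : CausalIntegrable μ P K A) (hB : CausalIntegrable μ P K B) (τ : ℝ) :
    pointCorrelation μ P K A B (-τ) = (pointCorrelation μ P K B A τ).conjTranspose := by
  ext i j
  obtain ⟨Y, hY, hYg⟩ := exists_isGeneratedBy_causalSolution hf hstat herg hP hA i
  obtain ⟨Z, hZ, hZg⟩ := exists_isGeneratedBy_causalSolution hf hstat herg hP hB j
  have hF := hf.isErgodicPathFlow hstat herg
  rw [Matrix.conjTranspose_apply, ← (integral_causalSolution_mul hf hP hA hB (-τ) i j).2,
    ← (integral_causalSolution_mul hf hP hB hA τ j i).2]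
  change _ = conj _
  rw [← integral_conj, neg_neg]
  have hm : Measurable fun F : X × ℝ → Fin N → ℂ => Y F * conj (Z fun p => F (p.1, p.2 + τ)) :=
    hY.mul (Complex.continuous_conj.measurable.comp
      (hZ.comp (hF.preserving τ).measurable))
  have h1 := hF.integral_comp hm.stronglyMeasurable (-τ)
  have e1 : ∫ ω, causalSolution μ P f A 0 ω i * conj (causalSolution μ P f B τ ω j) ∂ℙ =
      ∫ ω, Y (fun p => f p ω) * conj (Z fun p => f (p.1, p.2 + τ) ω) ∂ℙ := by
    refine integral_congr_ae ?_
    filter_upwards [hYg 0, hZg τ] with ω h1 h2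
    rw [h1, h2]
    simp only [add_zero]
  rw [e1, ← h1]
  refine integral_congr_ae ?_
  filter_upwards [hYg (-τ), hZg 0] with ω h1 h2
  rw [map_mul, Complex.conj_conj, mul_comm, h1, h2]
  simp only [add_assoc, add_neg_cancel, add_zero]

lemma pointCorrelation_eq_iterated [SFinite ℙ] [SFinite μ] (hf : IsFunctionField ℙ f K)
    (hP : ∀ i j, Measurable fun p : ℝ × X × X => P p.1 p.2.1 p.2.2 i j) {A B : X}
    (hA : CausalIntegrable μ P K A) (hB : CausalIntegrable μ P K B) (τ : ℝ) (i j : Fin N) :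
    pointCorrelation μ P K A B τ i j =
      ∫ s in Ioi (0 : ℝ), ∫ σ in Iio (s + τ), ∫ z : X × X,
        (P (s + τ - σ) A z.1 * K z.1 z.2 σ * (P s B z.2).conjTranspose) i j ∂(μ.prod μ) := by
  have hi := (integrable_lagIntegrand hf hP hA hB τ i j).1
  rw [pointCorrelation, Matrix.of_apply]
  rw [lagMeasure] at hi ⊢
  rw [integral_prod _ hi]
  exact setIntegral_causalRegion hi.integral_prod_left

end

/-! ### Operators with Schwartz kernels -/

lemma measurable_entrySum {α : Type*} [MeasurableSpace α] {N : ℕ}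
    {k : α → Matrix (Fin N) (Fin N) ℂ} (hk : ∀ i j, Measurable fun a => k a i j) :
    Measurable fun a => entrySum (k a) :=
  Finset.measurable_sum _ fun i _ => Finset.measurable_sum _ fun j _ => (hk i j).norm

section

variable {X : Type*} {N : ℕ}

/-- The integrand of the sesquilinear form with kernel `k`. -/
def kernelForm (k : X → X → Matrix (Fin N) (Fin N) ℂ) (φ ψ : X → EuclideanSpace ℂ (Fin N))
    (p : X × X) : ℂ :=
  ∑ i, ∑ j, conj (φ p.1 i) * k p.1 p.2 i j * ψ p.2 j

lemma norm_kernelForm_le (k : X → X → Matrix (Fin N) (Fin N) ℂ)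
    (φ ψ : X → EuclideanSpace ℂ (Fin N)) (p : X × X) :
    ‖kernelForm k φ ψ p‖ ≤ ‖φ p.1‖ * entrySum (k p.1 p.2) * ‖ψ p.2‖ := by
  rw [kernelForm, entrySum, Finset.mul_sum, Finset.sum_mul]
  refine (norm_sum_le _ _).trans (Finset.sum_le_sum fun i _ => ?_)
  rw [Finset.mul_sum, Finset.sum_mul]
  refine (norm_sum_le _ _).trans (Finset.sum_le_sum fun j _ => ?_)
  rw [norm_mul, norm_mul, RCLike.norm_conj]
  gcongr
  · exact PiLp.norm_apply_le _ _
  · exact PiLp.norm_apply_le _ _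

end

section

variable {X : Type*} [MeasurableSpace X] {N : ℕ} {μ : Measure X}

lemma aestronglyMeasurable_coord {φ : X → EuclideanSpace ℂ (Fin N)}
    (hφ : AEStronglyMeasurable φ μ) (i : Fin N) : AEStronglyMeasurable (fun x => φ x i) μ :=
  (by fun_prop : Continuous fun v : EuclideanSpace ℂ (Fin N) => v i).comp_aestronglyMeasurable hφ

lemma aestronglyMeasurable_kernelForm [SFinite μ] {k : X → X → Matrix (Fin N) (Fin N) ℂ}
    (hk : ∀ i j, Measurable fun p : X × X => k p.1 p.2 i j)
    {φ ψ : X → EuclideanSpace ℂ (Fin N)} (hφ : AEStronglyMeasurable φ μ)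
    (hψ : AEStronglyMeasurable ψ μ) : AEStronglyMeasurable (kernelForm k φ ψ) (μ.prod μ) := by
  refine Finset.aestronglyMeasurable_fun_sum _ fun i _ =>
    Finset.aestronglyMeasurable_fun_sum _ fun j _ => ?_
  exact ((Complex.continuous_conj.comp_aestronglyMeasurable
    (aestronglyMeasurable_coord hφ i).comp_fst).mul
    (hk i j).aestronglyMeasurable).mul (aestronglyMeasurable_coord hψ j).comp_snd

/-- The restriction of `φ` to the points of `D` at which it is at most `n`. -/
def truncate (D : Set X) (hD : MeasurableSet D) (n : ℕ) (φ : VecL2 N μ) : VecL2 N μ :=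
  ((Lp.memLp φ).indicator (hD.inter (measurableSet_le
    (Lp.stronglyMeasurable φ).norm.measurable (measurable_const (a := (n : ℝ)))))).toLp _

lemma truncate_ae (D : Set X) (hD : MeasurableSet D) (n : ℕ) (φ : VecL2 N μ) :
    truncate D hD n φ =ᵐ[μ] (D ∩ {x | ‖φ x‖ ≤ n}).indicator φ :=
  MemLp.coeFn_toLp _

lemma norm_truncate_le (D : Set X) (hD : MeasurableSet D) (n : ℕ) (φ : VecL2 N μ) :
    ∀ᵐ x ∂μ, ‖truncate D hD n φ x‖ ≤ ‖φ x‖ := by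
  filter_upwards [truncate_ae D hD n φ] with x hx
  rw [hx]
  exact norm_indicator_le_norm_self _ _

lemma truncate_eq_zero (D : Set X) (hD : MeasurableSet D) (n : ℕ) (φ : VecL2 N μ) :
    ∀ᵐ x ∂μ, x ∉ D → truncate D hD n φ x = 0 := by
  filter_upwards [truncate_ae D hD n φ] with x hx hxD
  rw [hx, indicator_of_notMem fun h => hxD h.1]

lemma truncate_bounded (D : Set X) (hD : MeasurableSet D) (n : ℕ) (φ : VecL2 N μ) :
    ∃ M : ℝ, ∀ᵐ x ∂μ, ‖truncate D hD n φ x‖ ≤ M := by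
  refine ⟨n, ?_⟩
  filter_upwards [truncate_ae D hD n φ] with x hx
  rw [hx]
  by_cases h : x ∈ D ∩ {x | ‖φ x‖ ≤ n}
  · rw [indicator_of_mem h]; exact h.2
  · rw [indicator_of_notMem h, norm_zero]; positivity

lemma tendsto_truncate {D : ℕ → Set X} (hmono : Monotone D) (hD : ∀ n, MeasurableSet (D n))
    (hcov : ∀ᵐ x ∂μ, ∃ n, x ∈ D n) (φ : VecL2 N μ) :
    ∀ᵐ x ∂μ, Tendsto (fun n => truncate (D n) (hD n) n φ x) atTop (𝓝 (φ x)) := by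
  filter_upwards [hcov, ae_all_iff.2 fun n => truncate_ae (D n) (hD n) n φ] with x ⟨m, hm⟩ hx
  refine tendsto_const_nhds.congr' ?_
  obtain ⟨l, hl⟩ := exists_nat_ge ‖φ x‖
  filter_upwards [eventually_ge_atTop m, eventually_ge_atTop l] with n h1 h2
  rw [hx n, indicator_of_mem]
  exact ⟨hmono h1 hm, hl.trans (by exact_mod_cast h2)⟩

/-- Dominated convergence in the first argument of the inner product. -/
lemma tendsto_inner_of_dominated {φ : VecL2 N μ} {φs : ℕ → VecL2 N μ}
    (hle : ∀ n, ∀ᵐ x ∂μ, ‖φs n x‖ ≤ ‖φ x‖)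
    (hlim : ∀ᵐ x ∂μ, Tendsto (fun n => φs n x) atTop (𝓝 (φ x))) (v : VecL2 N μ) :
    Tendsto (fun n => inner ℂ (φs n) v) atTop (𝓝 (inner ℂ φ v)) := by
  simp only [L2.inner_def]
  have hb : Integrable (fun x => ‖φ x‖ * ‖v x‖) μ :=
    (Lp.memLp φ).norm.integrable_mul (Lp.memLp v).norm
  refine tendsto_integral_of_dominated_convergence _ (fun n => ?_) hb (fun n => ?_) ?_
  · exact (Lp.aestronglyMeasurable (φs n)).inner (Lp.aestronglyMeasurable v)
  · filter_upwards [hle n] with x hx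
    exact (norm_inner_le_norm _ _).trans (by gcongr)
  · filter_upwards [hlim] with x hx
    exact hx.inner tendsto_const_nhds

lemma tendsto_integral_kernelForm [SFinite μ] {k : X → X → Matrix (Fin N) (Fin N) ℂ}
    (hk : ∀ i j, Measurable fun p : X × X => k p.1 p.2 i j) {φ ψ : VecL2 N μ}
    {φs ψs : ℕ → VecL2 N μ} (hφ : ∀ n, ∀ᵐ x ∂μ, ‖φs n x‖ ≤ ‖φ x‖)
    (hφlim : ∀ᵐ x ∂μ, Tendsto (fun n => φs n x) atTop (𝓝 (φ x)))
    (hψ : ∀ n, ∀ᵐ x ∂μ, ‖ψs n x‖ ≤ ‖ψ x‖)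
    (hψlim : ∀ᵐ x ∂μ, Tendsto (fun n => ψs n x) atTop (𝓝 (ψ x)))
    (hint : Integrable (fun p : X × X => ‖φ p.1‖ * entrySum (k p.1 p.2) * ‖ψ p.2‖) (μ.prod μ)) :
    Tendsto (fun n => ∫ p, kernelForm k (φs n) (ψs n) p ∂(μ.prod μ)) atTop
      (𝓝 (∫ p, kernelForm k φ ψ p ∂(μ.prod μ))) := by
  refine tendsto_integral_of_dominated_convergence _ (fun n => ?_) hint (fun n => ?_) ?_
  · exact aestronglyMeasurable_kernelForm hk (Lp.aestronglyMeasurable _) (Lp.aestronglyMeasurable _)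
  · filter_upwards [Measure.quasiMeasurePreserving_fst.ae (hφ n),
      Measure.quasiMeasurePreserving_snd.ae (hψ n)] with p h1 h2
    refine (norm_kernelForm_le _ _ _ _).trans ?_
    have := entrySum_nonneg (k p.1 p.2)
    gcongr
  · filter_upwards [Measure.quasiMeasurePreserving_fst.ae hφlim,
      Measure.quasiMeasurePreserving_snd.ae hψlim] with p h1 h2
    refine tendsto_finsetSum _ fun i _ => tendsto_finsetSum _ fun j _ => ?_
    have e1 : Tendsto (fun n => conj (φs n p.1 i)) atTop (𝓝 (conj (φ p.1 i))) :=
      ((by fun_prop : Continuous fun v : EuclideanSpace ℂ (Fin N) => conj (v i)).tendsto _).comp h1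
    have e2 : Tendsto (fun n => ψs n p.2 j) atTop (𝓝 (ψ p.2 j)) :=
      ((by fun_prop : Continuous fun v : EuclideanSpace ℂ (Fin N) => v j).tendsto _).comp h2
    exact (e1.mul_const _).mul e2

/-- The kernel formula holds for all square integrable functions for which the double integral
converges absolutely. -/
lemma HasKernel.inner_eq [SFinite μ] {R : VecL2 N μ →L[ℂ] VecL2 N μ}
    {k : X → X → Matrix (Fin N) (Fin N) ℂ} (hR : HasKernel μ R k)
    (hk : ∀ i j, Measurable fun p : X × X => k p.1 p.2 i j) {φ ψ : VecL2 N μ}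
    (hint : Integrable (fun p : X × X => ‖φ p.1‖ * entrySum (k p.1 p.2) * ‖ψ p.2‖) (μ.prod μ)) :
    inner ℂ φ (R ψ) = ∫ p, kernelForm k φ ψ p ∂(μ.prod μ) := by
  obtain ⟨D, hmono, hD, -, hcov, -, hform⟩ := hR
  set φs : ℕ → VecL2 N μ := fun n => truncate (D n) (hD n) n φ
  set ψs : ℕ → VecL2 N μ := fun n => truncate (D n) (hD n) n ψ
  have hφle : ∀ n, ∀ᵐ x ∂μ, ‖φs n x‖ ≤ ‖φ x‖ := fun n => norm_truncate_le _ _ _ φ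
  have hψle : ∀ n, ∀ᵐ x ∂μ, ‖ψs n x‖ ≤ ‖ψ x‖ := fun n => norm_truncate_le _ _ _ ψ
  have hφlim := tendsto_truncate hmono hD hcov φ
  have hψlim := tendsto_truncate hmono hD hcov ψ
  -- For fixed `m` the kernel formula holds for `φs n` and `ψs m` as soon as `m ≤ n`.
  have step : ∀ m, inner ℂ φ (R (ψs m)) = ∫ p, kernelForm k φ (ψs m) p ∂(μ.prod μ) := by
    intro m
    have hint' : Integrable (fun p : X × X =>
        ‖φ p.1‖ * entrySum (k p.1 p.2) * ‖ψs m p.2‖) (μ.prod μ) := by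
      refine hint.mono' ?_ ?_
      · exact ((Lp.aestronglyMeasurable φ).comp_fst.norm.mul
          (measurable_entrySum hk).aestronglyMeasurable).mul
          (Lp.aestronglyMeasurable (ψs m)).comp_snd.norm
      · filter_upwards [Measure.quasiMeasurePreserving_snd.ae (hψle m)] with p hp
        have := entrySum_nonneg (k p.1 p.2)
        rw [Real.norm_of_nonneg (by positivity)]
        gcongr
    have h1 := tendsto_inner_of_dominated hφle hφlim (R (ψs m))
    have h2 := tendsto_integral_kernelForm hk hφle hφlim (ψs := fun _ => ψs m)
      (fun _ => ae_of_all _ fun _ => le_rfl) (ae_of_all _ fun _ => tendsto_const_nhds) hint'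
    refine tendsto_nhds_unique h1 (h2.congr' ?_)
    filter_upwards [eventually_ge_atTop m] with n hn
    refine (hform n (φs n) (ψs m) (truncate_eq_zero _ _ _ _) ?_ (truncate_bounded _ _ _ _)
      (truncate_bounded _ _ _ _)).symm
    filter_upwards [truncate_eq_zero (D m) (hD m) m ψ] with x hx hxn
    exact hx fun h => hxn (hmono hn h)
  have h1 : Tendsto (fun m => inner ℂ φ (R (ψs m))) atTop (𝓝 (inner ℂ φ (R ψ))) := by
    have h := (Complex.continuous_conj.tendsto _).comp
      (tendsto_inner_of_dominated hψle hψlim (adjoint R φ))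
    rw [inner_conj_symm, ContinuousLinearMap.adjoint_inner_left] at h
    refine h.congr fun m => ?_
    rw [Function.comp_apply, inner_conj_symm, ContinuousLinearMap.adjoint_inner_left]
  have h2 := tendsto_integral_kernelForm hk (φs := fun _ => φ)
    (fun _ => ae_of_all _ fun _ => le_rfl) (ae_of_all _ fun _ => tendsto_const_nhds)
    hψle hψlim hint
  exact tendsto_nhds_unique h1 (h2.congr fun m => (step m).symm)

lemma HasKernel.eq_zero [SFinite μ] {R : VecL2 N μ →L[ℂ] VecL2 N μ}
    {k : X → X → Matrix (Fin N) (Fin N) ℂ} (hR : HasKernel μ R k) (hk : ∀ x y, k x y = 0) :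
    R = 0 := by
  ext1 ψ
  refine ext_inner_left ℂ fun φ => ?_
  rw [hR.inner_eq (fun i j => by simp [hk]) (by simp [hk, entrySum])]
  simp [kernelForm, hk]

end

/-! ### The adjoint semigroup as an integral operator -/

lemma measurePreserving_prodLeftComm {α β γ : Type*} [MeasurableSpace α] [MeasurableSpace β]
    [MeasurableSpace γ] (a : Measure α) (b : Measure β) (c : Measure γ) [SFinite a] [SFinite b]
    [SFinite c] :
    MeasurePreserving (fun q : β × (α × γ) => (q.2.1, (q.1, q.2.2)))
      (b.prod (a.prod c)) (a.prod (b.prod c)) := by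
  have e1 := (measurePreserving_prodAssoc b a c).symm
  have e2 := (Measure.measurePreserving_swap (μ := b) (ν := a)).prod (MeasurePreserving.id c)
  have e3 := measurePreserving_prodAssoc a b c
  exact e3.comp (e2.comp e1)

section

variable {X : Type*} {N : ℕ}

/-- The component `a` of `φ(A)^* P(s,A,y)`, with `p = (s,y)`. -/
def transposeIntegrand (P : ℝ → X → X → Matrix (Fin N) (Fin N) ℂ)
    (φ : X → EuclideanSpace ℂ (Fin N)) (a : Fin N) (p : ℝ × X) (A : X) : ℂ :=
  ∑ i, conj (φ A i) * P p.1 A p.2 i a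

lemma norm_transposeIntegrand_le (P : ℝ → X → X → Matrix (Fin N) (Fin N) ℂ)
    (φ : X → EuclideanSpace ℂ (Fin N)) (a : Fin N) (p : ℝ × X) (A : X) :
    ‖transposeIntegrand P φ a p A‖ ≤ ‖φ A‖ * entrySum (P p.1 A p.2) := by
  rw [transposeIntegrand, entrySum, Finset.mul_sum]
  refine (norm_sum_le _ _).trans (Finset.sum_le_sum fun i _ => ?_)
  rw [norm_mul, RCLike.norm_conj]
  gcongr
  · exact PiLp.norm_apply_le _ _
  · exact Finset.single_le_sum (f := fun j => ‖P p.1 A p.2 i j‖) (fun _ _ => norm_nonneg _)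
      (Finset.mem_univ a)

lemma norm_transposeIntegrand_mul_le (P : ℝ → X → X → Matrix (Fin N) (Fin N) ℂ)
    (K : X → X → ℝ → Matrix (Fin N) (Fin N) ℂ)
    (φ : X → EuclideanSpace ℂ (Fin N)) (a : Fin N) (p : ℝ × X) (A : X) :
    ‖transposeIntegrand P φ a p A‖ * rootMeanSquare K p.2 ≤ ‖φ A‖ * causalWeight P K A p := by
  rw [causalWeight, ← mul_assoc]
  exact mul_le_mul_of_nonneg_right (norm_transposeIntegrand_le P φ a p A)
    (rootMeanSquare_nonneg K _)

/-- The component `a` of `∫ φ(A)^* P(s,A,y) dA`, with `p = (s,y)`. For causal test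
functions `φ` it is the complex conjugate of `Ω(s)^* φ` at almost every `y` at which the source does
not vanish. -/
def adjointTransform [MeasurableSpace X] (μ : Measure X)
    (P : ℝ → X → X → Matrix (Fin N) (Fin N) ℂ) (φ : X → EuclideanSpace ℂ (Fin N)) (a : Fin N)
    (p : ℝ × X) : ℂ :=
  ∫ A, transposeIntegrand P φ a p A ∂μ

end

section

variable {X : Type*} [MeasurableSpace X] {N : ℕ} {μ : Measure X}
  {K : X → X → ℝ → Matrix (Fin N) (Fin N) ℂ} {P : ℝ → X → X → Matrix (Fin N) (Fin N) ℂ}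

/-- The total weight of the test function `φ` at `p = (s,y)`. -/
def testWeight (μ : Measure X) (P : ℝ → X → X → Matrix (Fin N) (Fin N) ℂ)
    (K : X → X → ℝ → Matrix (Fin N) (Fin N) ℂ) (φ : X → EuclideanSpace ℂ (Fin N)) (p : ℝ × X) : ℝ :=
  ∫ A, ‖φ A‖ * causalWeight P K A p ∂μ

/-- The weights are integrable against `φ`. By duality the source is then integrable against the
solution of the adjoint problem with data `φ`. -/
def IsCausalTest (μ : Measure X) (P : ℝ → X → X → Matrix (Fin N) (Fin N) ℂ)
    (K : X → X → ℝ → Matrix (Fin N) (Fin N) ℂ) (φ : X → EuclideanSpace ℂ (Fin N)) : Prop :=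
  Integrable (fun r : X × (ℝ × X) => ‖φ r.1‖ * causalWeight P K r.1 r.2) (μ.prod (delayMeasure μ))

lemma testWeight_nonneg (φ : X → EuclideanSpace ℂ (Fin N)) (p : ℝ × X) :
    0 ≤ testWeight μ P K φ p :=
  integral_nonneg fun A => mul_nonneg (norm_nonneg _) (causalWeight_nonneg A p)

lemma IsCausalTest.ae_norm_adjointTransform_mul_le [SFinite μ] {φ : X → EuclideanSpace ℂ (Fin N)}
    (hφ : IsCausalTest μ P K φ) :
    ∀ᵐ p ∂(delayMeasure μ), ∀ a, ‖adjointTransform μ P φ a p‖ * rootMeanSquare K p.2 ≤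
      testWeight μ P K φ p := by
  filter_upwards [hφ.prod_left_ae] with p hp a
  refine (mul_le_mul_of_nonneg_right (norm_integral_le_integral_norm _)
    (rootMeanSquare_nonneg K _)).trans ?_
  rw [← integral_mul_const]
  exact integral_mono_of_nonneg
    (ae_of_all _ fun A => mul_nonneg (norm_nonneg _) (rootMeanSquare_nonneg K _)) hp
    (ae_of_all _ fun A => norm_transposeIntegrand_mul_le P K φ a p A)

lemma aestronglyMeasurable_transposeIntegrand [SFinite μ]
    (hP : ∀ i j, Measurable fun p : ℝ × X × X => P p.1 p.2.1 p.2.2 i j)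
    {φ : X → EuclideanSpace ℂ (Fin N)} (hφ : AEStronglyMeasurable φ μ) (a : Fin N)
    {ν : Measure (ℝ × X)} [SFinite ν] :
    AEStronglyMeasurable (fun r : (ℝ × X) × X => transposeIntegrand P φ a r.1 r.2)
      (ν.prod μ) := by
  refine Finset.aestronglyMeasurable_fun_sum _ fun i _ => ?_
  exact (Complex.continuous_conj.comp_aestronglyMeasurable
    (aestronglyMeasurable_coord hφ i).comp_snd).mul ((hP i a).comp (by fun_prop :
      Measurable fun r : (ℝ × X) × X => (r.1.1, r.2, r.1.2))).aestronglyMeasurable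

/-- The formula for `Ω(t)^* φ` at the points at which the source does not vanish. Elsewhere the
integral over `A` need not converge. The formula is obtained by testing `Ω(t)` on the vector
functions `1_S e_a`. -/
lemma HasKernel.ae_adjoint_eq [SigmaFinite μ] {R : VecL2 N μ →L[ℂ] VecL2 N μ} {t : ℝ}
    (hR : HasKernel μ R (P t)) (hP : ∀ i j, Measurable fun p : ℝ × X × X => P p.1 p.2.1 p.2.2 i j)
    (hK : Measurable (rootMeanSquare K)) {φ : VecL2 N μ}
    (hint : Integrable (fun z : X × X => ‖φ z.1‖ * causalWeight P K z.1 (t, z.2)) (μ.prod μ))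
    (a : Fin N) :
    ∀ᵐ x ∂μ, rootMeanSquare K x ≠ 0 →
      conj (adjoint R φ x a) = adjointTransform μ P φ a (t, x) := by
  -- On `E n` the weight dominates the kernel up to the factor `n + 1`.
  set E : ℕ → Set X := fun n => {x | 1 / ((n : ℝ) + 1) ≤ rootMeanSquare K x} ∩ spanningSets μ n
  have hE : ∀ n, MeasurableSet (E n) := fun n =>
    (measurableSet_le measurable_const hK).inter (measurableSet_spanningSets μ n)
  have hEμ : ∀ n, μ (E n) < ⊤ := fun n =>
    (measure_mono inter_subset_right).trans_lt (measure_spanningSets_lt_top μ n)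
  have hPt : ∀ i j, Measurable fun p : X × X => P t p.1 p.2 i j := fun i j =>
    (hP i j).comp (by fun_prop : Measurable fun p : X × X => (t, p.1, p.2))
  have hsum : Integrable (fun x => testWeight μ P K φ (t, x)) μ := hint.integral_prod_right
  have hmT : AEStronglyMeasurable (fun z : X × X => transposeIntegrand P φ a (t, z.2) z.1)
      (μ.prod μ) := by
    refine Finset.aestronglyMeasurable_fun_sum _ fun i _ => ?_
    exact (Complex.continuous_conj.comp_aestronglyMeasurable
      (aestronglyMeasurable_coord (Lp.aestronglyMeasurable φ) i).comp_fst).mul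
      (hPt i a).aestronglyMeasurable
  have hmA : AEStronglyMeasurable (fun x => adjointTransform μ P φ a (t, x)) μ :=
    hmT.prod_swap.integral_prod_right'
  have hdom : ∀ n, ∀ x ∈ E n, (1 : ℝ) ≤ (n + 1) * rootMeanSquare K x := fun n x hx => by
    have h := hx.1
    rw [mem_ofPred_eq, div_le_iff₀ (by positivity)] at h
    linarith
  have hintE : ∀ n, ∀ S ⊆ E n, MeasurableSet S →
      Integrable (S.indicator fun x => adjointTransform μ P φ a (t, x)) μ ∧
      ∫ x in S, conj (adjoint R φ x a) ∂μ =
        ∫ x in S, adjointTransform μ P φ a (t, x) ∂μ := by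
    intro n S hSE hS
    have hSμ : μ S ≠ ⊤ := ((measure_mono hSE).trans_lt (hEμ n)).ne
    set χ : VecL2 N μ := indicatorConstLp 2 hS hSμ (EuclideanSpace.single a (1 : ℂ))
    have hχ : χ =ᵐ[μ] S.indicator fun _ => EuclideanSpace.single a (1 : ℂ) :=
      indicatorConstLp_coeFn
    have hG : Integrable (fun z : X × X => S.indicator
        (fun x => transposeIntegrand P φ a (t, x) z.1) z.2) (μ.prod μ) := by
      refine (hint.const_mul ((n : ℝ) + 1)).mono' ?_ (ae_of_all _ fun z => ?_)
      · have h := hmT.indicator (measurable_snd hS)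
        exact h
      · have h0 : 0 ≤ ((n : ℝ) + 1) * (‖φ z.1‖ * causalWeight P K z.1 (t, z.2)) :=
          mul_nonneg (by positivity) (mul_nonneg (norm_nonneg _) (causalWeight_nonneg _ _))
        by_cases hz : z.2 ∈ S
        · rw [indicator_of_mem hz]
          refine le_trans ?_ (mul_le_mul_of_nonneg_left
            (norm_transposeIntegrand_mul_le P K φ a (t, z.2) z.1) (by positivity))
          have h1 := mul_le_mul_of_nonneg_left (hdom n z.2 (hSE hz))
            (norm_nonneg (transposeIntegrand P φ a (t, z.2) z.1))
          simp only
          linarith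
        · rw [indicator_of_notMem hz, norm_zero]; exact h0
    have hG1 : Integrable (S.indicator fun x => adjointTransform μ P φ a (t, x)) μ := by
      refine hG.integral_prod_right.congr (ae_of_all _ fun x => ?_)
      by_cases hx : x ∈ S
      · simp only [indicator_of_mem hx]; rfl
      · simp only [indicator_of_notMem hx, integral_zero]
    refine ⟨hG1, ?_⟩
    have hform : kernelForm (P t) φ χ =ᵐ[μ.prod μ] fun z : X × X => S.indicator
        (fun x => transposeIntegrand P φ a (t, x) z.1) z.2 := by
      filter_upwards [Measure.quasiMeasurePreserving_snd.ae hχ] with z hz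
      rw [kernelForm, hz]
      by_cases hx : z.2 ∈ S
      · simp only [indicator_of_mem hx, transposeIntegrand, PiLp.single_apply]
        simp
      · simp only [indicator_of_notMem hx]
        simp
    have hnorm : Integrable (fun z : X × X => ‖φ z.1‖ * entrySum (P t z.1 z.2) * ‖χ z.2‖)
        (μ.prod μ) := by
      refine (hint.const_mul ((n : ℝ) + 1)).mono' ?_ ?_
      · exact ((Lp.aestronglyMeasurable φ).comp_fst.norm.mul
          (measurable_entrySum hPt).aestronglyMeasurable).mul
          (Lp.aestronglyMeasurable χ).comp_snd.norm
      · filter_upwards [Measure.quasiMeasurePreserving_snd.ae hχ] with z hz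
        have h0 : 0 ≤ ‖φ z.1‖ * entrySum (P t z.1 z.2) :=
          mul_nonneg (norm_nonneg _) (entrySum_nonneg _)
        rw [Real.norm_of_nonneg (mul_nonneg h0 (norm_nonneg _)), hz]
        by_cases hx : z.2 ∈ S
        · have h1 := mul_le_mul_of_nonneg_left (hdom n z.2 (hSE hx)) h0
          rw [indicator_of_mem hx, PiLp.norm_single, norm_one, causalWeight]
          linarith
        · rw [indicator_of_notMem hx, norm_zero, mul_zero]
          exact mul_nonneg (by positivity) (mul_nonneg (norm_nonneg _) (causalWeight_nonneg _ _))
    have h1 := hR.inner_eq hPt hnorm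
    rw [integral_congr_ae hform, integral_prod_symm _ hG,
      ← ContinuousLinearMap.adjoint_inner_left, L2.inner_def] at h1
    rw [← integral_indicator hS, ← integral_indicator hS]
    refine Eq.trans (Eq.trans (integral_congr_ae ?_) h1)
      (integral_congr_ae (ae_of_all _ fun x => ?_))
    · filter_upwards [hχ] with x hx
      rw [hx]
      by_cases hxS : x ∈ S
      · simp [indicator_of_mem hxS, EuclideanSpace.inner_single_right]
      · simp [indicator_of_notMem hxS]
    · by_cases hx : x ∈ S
      · simp only [indicator_of_mem hx]; rfl
      · simp only [indicator_of_notMem hx, integral_zero]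
  have hstep : ∀ n, ∀ᵐ x ∂μ, x ∈ E n →
      conj (adjoint R φ x a) = adjointTransform μ P φ a (t, x) := by
    intro n
    rw [← ae_restrict_iff' (hE n)]
    have : IsFiniteMeasure (μ.restrict (E n)) := ⟨by rw [Measure.restrict_apply_univ]; exact hEμ n⟩
    refine Integrable.ae_eq_of_forall_setIntegral_eq _ _ ?_ ?_ fun S hS _ => ?_
    · have h := ((Lp.memLp (adjoint R φ)).restrict (E n)).integrable
        (by norm_num)
      refine h.mono (Complex.continuous_conj.comp_aestronglyMeasurable
        (aestronglyMeasurable_coord h.1 a)) (ae_of_all _ fun x => ?_)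
      rw [RCLike.norm_conj]
      exact PiLp.norm_apply_le _ _
    · exact (integrable_indicator_iff (hE n)).1 (hintE n (E n) subset_rfl (hE n)).1
    · rw [Measure.restrict_restrict hS]
      exact (hintE n _ inter_subset_right (hS.inter (hE n))).2
  filter_upwards [ae_all_iff.2 hstep] with x hx h0
  have hpos : 0 < rootMeanSquare K x := lt_of_le_of_ne (rootMeanSquare_nonneg K x) (Ne.symm h0)
  obtain ⟨m, hm⟩ := exists_nat_one_div_lt hpos
  have hl := mem_spanningSetsIndex μ x
  refine hx (max m (spanningSetsIndex μ x)) ⟨?_, monotone_spanningSets μ (le_max_right _ _) hl⟩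
  refine le_trans ?_ hm.le
  gcongr
  exact le_max_left _ _

end

/-! ### The Schwartz kernel of the time correlation -/

section

variable {X : Type*} {N : ℕ}

/-- The integrand of the correlation at `q = ((s₁,x),(s₂,y))`, tested on `φ` and `ψ` at `(A,B)`. -/
def testedIntegrand (P : ℝ → X → X → Matrix (Fin N) (Fin N) ℂ)
    (K : X → X → ℝ → Matrix (Fin N) (Fin N) ℂ) (φ ψ : X → EuclideanSpace ℂ (Fin N)) (τ : ℝ)
    (a b : Fin N) (z : X × X) (q : (ℝ × X) × (ℝ × X)) : ℂ :=
  transposeIntegrand P φ a q.1 z.1 * K q.1.2 q.2.2 (τ + q.2.1 - q.1.1) a b *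
    conj (transposeIntegrand P ψ b q.2 z.2)

lemma sum_testedIntegrand (P : ℝ → X → X → Matrix (Fin N) (Fin N) ℂ)
    (K : X → X → ℝ → Matrix (Fin N) (Fin N) ℂ) (φ ψ : X → EuclideanSpace ℂ (Fin N)) (τ : ℝ)
    (z : X × X) (q : (ℝ × X) × (ℝ × X)) :
    ∑ a, ∑ b, testedIntegrand P K φ ψ τ a b z q = ∑ i, ∑ j, conj (φ z.1 i) *
      lagIntegrand P K z.1 z.2 τ ((q.2.1, τ + q.2.1 - q.1.1), (q.1.2, q.2.2)) i j * ψ z.2 j := by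
  set F : Fin N → Fin N → Fin N → Fin N → ℂ := fun i j a b => conj (φ z.1 i) *
    (P q.1.1 z.1 q.1.2 i a * K q.1.2 q.2.2 (τ + q.2.1 - q.1.1) a b *
      conj (P q.2.1 z.2 q.2.2 j b)) * ψ z.2 j
  calc ∑ a, ∑ b, testedIntegrand P K φ ψ τ a b z q = ∑ a, ∑ b, ∑ i, ∑ j, F i j a b := by
        refine Finset.sum_congr rfl fun a _ => Finset.sum_congr rfl fun b _ => ?_
        simp only [testedIntegrand, transposeIntegrand, map_sum, map_mul, Complex.conj_conj,
          Finset.sum_mul, Finset.mul_sum]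
        rw [Finset.sum_comm]
        refine Finset.sum_congr rfl fun i _ => Finset.sum_congr rfl fun j _ => ?_
        simp only [F]
        ring
    _ = ∑ i, ∑ a, ∑ b, ∑ j, F i j a b :=
        (Finset.sum_congr rfl fun _ _ => Finset.sum_comm).trans Finset.sum_comm
    _ = ∑ i, ∑ j, ∑ a, ∑ b, F i j a b := Finset.sum_congr rfl fun _ _ =>
        (Finset.sum_congr rfl fun _ _ => Finset.sum_comm).trans Finset.sum_comm
    _ = _ := by
        simp only [F, lagIntegrand_delay, mul_mul_conjTranspose_apply, Finset.sum_mul,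
          Finset.mul_sum]

end

section

variable {X Ω₀ : Type*} [MeasurableSpace X] [MeasurableSpace Ω₀] {N : ℕ} {μ : Measure X}
  {ℙ : Measure Ω₀} {f : X × ℝ → Ω₀ → Fin N → ℂ} {K : X → X → ℝ → Matrix (Fin N) (Fin N) ℂ}
  {P : ℝ → X → X → Matrix (Fin N) (Fin N) ℂ}

/-- The integrand of the tested correlation, expressed by the solutions of the adjoint problem. -/
def transformedIntegrand (μ : Measure X) (P : ℝ → X → X → Matrix (Fin N) (Fin N) ℂ)
    (K : X → X → ℝ → Matrix (Fin N) (Fin N) ℂ) (φ ψ : X → EuclideanSpace ℂ (Fin N)) (τ : ℝ)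
    (a b : Fin N) (q : (ℝ × X) × (ℝ × X)) : ℂ :=
  adjointTransform μ P φ a q.1 * K q.1.2 q.2.2 (τ + q.2.1 - q.1.1) a b *
    conj (adjointTransform μ P ψ b q.2)

lemma norm_testedIntegrand_le (hf : IsFunctionField ℙ f K) (φ ψ : X → EuclideanSpace ℂ (Fin N))
    (τ : ℝ) (a b : Fin N) (z : X × X) (q : (ℝ × X) × (ℝ × X)) :
    ‖testedIntegrand P K φ ψ τ a b z q‖ ≤
      (‖φ z.1‖ * causalWeight P K z.1 q.1) * (‖ψ z.2‖ * causalWeight P K z.2 q.2) := by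
  rw [testedIntegrand, norm_mul, norm_mul, RCLike.norm_conj]
  calc _ ≤ ‖transposeIntegrand P φ a q.1 z.1‖ *
        (rootMeanSquare K q.1.2 * rootMeanSquare K q.2.2) *
        ‖transposeIntegrand P ψ b q.2 z.2‖ := by
        gcongr
        exact hf.norm_kernel_le _ _ _ _ _
    _ = (‖transposeIntegrand P φ a q.1 z.1‖ * rootMeanSquare K q.1.2) *
        (‖transposeIntegrand P ψ b q.2 z.2‖ * rootMeanSquare K q.2.2) := by ring
    _ ≤ _ := by
        exact mul_le_mul (norm_transposeIntegrand_mul_le P K φ a q.1 z.1)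
          (norm_transposeIntegrand_mul_le P K ψ b q.2 z.2)
          (mul_nonneg (norm_nonneg _) (rootMeanSquare_nonneg K _))
          (mul_nonneg (norm_nonneg _) (causalWeight_nonneg _ _))

lemma integrable_testedIntegrand [SFinite ℙ] [SFinite μ] (hf : IsFunctionField ℙ f K)
    (hP : ∀ i j, Measurable fun p : ℝ × X × X => P p.1 p.2.1 p.2.2 i j) {φ ψ : VecL2 N μ}
    (hφ : IsCausalTest μ P K φ) (hψ : IsCausalTest μ P K ψ) (τ : ℝ) (a b : Fin N) :
    Integrable (Function.uncurry (testedIntegrand P K φ ψ τ a b))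
      ((μ.prod μ).prod ((delayMeasure μ).prod (delayMeasure μ))) := by
  have hmp := measurePreserving_prodProdComm μ μ (delayMeasure μ) (delayMeasure μ)
  have hw := hmp.integrable_comp_of_integrable (hφ.mul_prod hψ)
  refine hw.mono' ?_ (ae_of_all _ fun r => norm_testedIntegrand_le hf _ _ τ a b r.1 r.2)
  have h1 := (aestronglyMeasurable_transposeIntegrand (ν := delayMeasure μ) hP
    (Lp.aestronglyMeasurable φ) a).prod_swap
  have h2 := (aestronglyMeasurable_transposeIntegrand (ν := delayMeasure μ) hP
    (Lp.aestronglyMeasurable ψ) b).prod_swap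
  have h3 := h1.comp_quasiMeasurePreserving
    (Measure.quasiMeasurePreserving_fst.comp hmp.quasiMeasurePreserving)
  have h4 := h2.comp_quasiMeasurePreserving
    (Measure.quasiMeasurePreserving_snd.comp hmp.quasiMeasurePreserving)
  have h5 : Measurable fun r : (X × X) × ((ℝ × X) × (ℝ × X)) =>
      K r.2.1.2 r.2.2.2 (τ + r.2.2.1 - r.2.1.1) a b :=
    (hf.measurable_kernel a b).comp (by fun_prop : Measurable
      fun r : (X × X) × ((ℝ × X) × (ℝ × X)) =>
        (((r.2.1.2, r.2.2.2) : X × X), τ + r.2.2.1 - r.2.1.1))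
  exact (h3.mul h5.aestronglyMeasurable).mul (Complex.continuous_conj.comp_aestronglyMeasurable h4)

lemma integral_testedIntegrand_left (φ ψ : X → EuclideanSpace ℂ (Fin N)) (τ : ℝ) (a b : Fin N)
    [SFinite μ] (q : (ℝ × X) × (ℝ × X)) :
    ∫ z, testedIntegrand P K φ ψ τ a b z q ∂(μ.prod μ) =
      transformedIntegrand μ P K φ ψ τ a b q := by
  have h : ∀ z : X × X, testedIntegrand P K φ ψ τ a b z q =
      (transposeIntegrand P φ a q.1 z.1 * conj (transposeIntegrand P ψ b q.2 z.2)) *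
        K q.1.2 q.2.2 (τ + q.2.1 - q.1.1) a b := fun z => by
    rw [testedIntegrand]; ring
  simp_rw [h]
  rw [integral_mul_const]
  rw [integral_prod_mul (fun A => transposeIntegrand P φ a q.1 A)
    (fun B => conj (transposeIntegrand P ψ b q.2 B)), integral_conj, transformedIntegrand,
    adjointTransform, adjointTransform]
  ring

lemma integrable_transformedIntegrand [SFinite ℙ] [SFinite μ] (hf : IsFunctionField ℙ f K)
    (hP : ∀ i j, Measurable fun p : ℝ × X × X => P p.1 p.2.1 p.2.2 i j) {φ ψ : VecL2 N μ}
    (hφ : IsCausalTest μ P K φ) (hψ : IsCausalTest μ P K ψ) (τ : ℝ) (a b : Fin N) :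
    Integrable (transformedIntegrand μ P K φ ψ τ a b)
      ((delayMeasure μ).prod (delayMeasure μ)) := by
  have h := (integrable_testedIntegrand hf hP hφ hψ τ a b).integral_prod_right
  exact h.congr (ae_of_all _ fun q => integral_testedIntegrand_left φ ψ τ a b q)

lemma IsCausalTest.ae_integrable {φ : X → EuclideanSpace ℂ (Fin N)} [SFinite μ]
    (hφ : IsCausalTest μ P K φ) :
    ∀ᵐ A ∂μ, Integrable (fun p => ‖φ A‖ * causalWeight P K A p) (delayMeasure μ) :=
  hφ.prod_right_ae

/-- The correlation `C_{A,B}(τ)`, tested on `φ` and `ψ`. -/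
lemma integral_kernelForm_pointCorrelation [SFinite ℙ] [SFinite μ] (hf : IsFunctionField ℙ f K)
    (hP : ∀ i j, Measurable fun p : ℝ × X × X => P p.1 p.2.1 p.2.2 i j) {φ ψ : VecL2 N μ}
    (hφ : IsCausalTest μ P K φ) (hψ : IsCausalTest μ P K ψ) (τ : ℝ) :
    ∫ z, kernelForm (pointCorrelation μ P K · · τ) φ ψ z ∂(μ.prod μ) =
      ∫ q, ∑ a, ∑ b, transformedIntegrand μ P K φ ψ τ a b q
        ∂((delayMeasure μ).prod (delayMeasure μ)) := by
  have hG : ∀ a b, Integrable (fun r : (X × X) × ((ℝ × X) × (ℝ × X)) =>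
      testedIntegrand P K φ ψ τ a b r.1 r.2)
      ((μ.prod μ).prod ((delayMeasure μ).prod (delayMeasure μ))) :=
    fun a b => integrable_testedIntegrand hf hP hφ hψ τ a b
  have hD := fun a b => integrable_transformedIntegrand hf hP hφ hψ τ a b
  have hGs : Integrable (Function.uncurry fun z q => ∑ a, ∑ b, testedIntegrand P K φ ψ τ a b z q)
      ((μ.prod μ).prod ((delayMeasure μ).prod (delayMeasure μ))) :=
    integrable_finsetSum _ fun a _ => integrable_finsetSum _ fun b _ => hG a b
  have h1 : ∀ᵐ z ∂(μ.prod μ), kernelForm (pointCorrelation μ P K · · τ) φ ψ z =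
      ∫ q, ∑ a, ∑ b, testedIntegrand P K φ ψ τ a b z q
        ∂((delayMeasure μ).prod (delayMeasure μ)) := by
    filter_upwards [Measure.quasiMeasurePreserving_fst.ae hφ.ae_integrable,
      Measure.quasiMeasurePreserving_snd.ae hψ.ae_integrable] with z hz1 hz2
    have hmp := measurePreserving_delay_lag μ τ
    have hm := fun i j => measurable_lagIntegrand_right hf hP z.1 z.2 τ i j
    have hi : ∀ i j, Integrable (fun q : (ℝ × X) × (ℝ × X) => conj (φ z.1 i) *
        lagIntegrand P K z.1 z.2 τ ((q.2.1, τ + q.2.1 - q.1.1), (q.1.2, q.2.2)) i j * ψ z.2 j)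
        ((delayMeasure μ).prod (delayMeasure μ)) := by
      intro i j
      have hm' := (hm i j).comp hmp.measurable
      refine (hz1.mul_prod hz2).mono'
        ((hm'.const_mul _).mul_const _).aestronglyMeasurable (ae_of_all _ fun q => ?_)
      rw [norm_mul, norm_mul, RCLike.norm_conj]
      calc _ ≤ ‖φ z.1‖ * (causalWeight P K z.1 q.1 * causalWeight P K z.2 q.2) * ‖ψ z.2‖ := by
            have := mul_nonneg (causalWeight_nonneg (P := P) (K := K) z.1 q.1)
              (causalWeight_nonneg (P := P) (K := K) z.2 q.2)
            gcongr
            · exact PiLp.norm_apply_le _ _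
            · exact norm_lagIntegrand_delay_le hf z.1 z.2 τ q i j
            · exact PiLp.norm_apply_le _ _
        _ = _ := by ring
    simp_rw [sum_testedIntegrand]
    rw [integral_finsetSum _ fun i _ => integrable_finsetSum _ fun j _ => hi i j, kernelForm]
    refine Finset.sum_congr rfl fun i _ => ?_
    rw [integral_finsetSum _ fun j _ => hi i j]
    refine Finset.sum_congr rfl fun j _ => ?_
    rw [integral_mul_const, integral_const_mul, pointCorrelation, Matrix.of_apply,
      integral_comp_of_measurePreserving (G := fun q => lagIntegrand P K z.1 z.2 τ q i j) hmp
        (hm i j).aestronglyMeasurable]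
  rw [integral_congr_ae h1, integral_integral hGs]
  calc _ = ∑ a, ∑ b, ∫ r, testedIntegrand P K φ ψ τ a b r.1 r.2
        ∂((μ.prod μ).prod ((delayMeasure μ).prod (delayMeasure μ))) := by
        rw [integral_finsetSum _ fun a _ => integrable_finsetSum _ fun b _ => hG a b]
        refine Finset.sum_congr rfl fun a _ => ?_
        rw [integral_finsetSum _ fun b _ => hG a b]
    _ = ∑ a, ∑ b, ∫ q, transformedIntegrand μ P K φ ψ τ a b q
        ∂((delayMeasure μ).prod (delayMeasure μ)) := by
        refine Finset.sum_congr rfl fun a _ => Finset.sum_congr rfl fun b _ => ?_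
        rw [integral_prod_symm _ (hG a b)]
        exact integral_congr_ae (ae_of_all _ fun q => integral_testedIntegrand_left φ ψ τ a b q)
    _ = _ := by
        rw [integral_finsetSum _ fun a _ => integrable_finsetSum _ fun b _ => hD a b]
        refine Finset.sum_congr rfl fun a _ => ?_
        rw [integral_finsetSum _ fun b _ => hD a b]

end

section

variable {X Ω₀ : Type*} [MeasurableSpace X] [MeasurableSpace Ω₀] {N : ℕ} {μ : Measure X}
  {ℙ : Measure Ω₀} {f : X × ℝ → Ω₀ → Fin N → ℂ} {K : X → X → ℝ → Matrix (Fin N) (Fin N) ℂ}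
  {P : ℝ → X → X → Matrix (Fin N) (Fin N) ℂ} {Ω : ℝ → VecL2 N μ →L[ℂ] VecL2 N μ}

lemma IsCausalTest.ae_adjoint_eq [SigmaFinite μ] (hΩ : ∀ t, 0 < t → HasKernel μ (Ω t) (P t))
    (hP : ∀ i j, Measurable fun p : ℝ × X × X => P p.1 p.2.1 p.2.2 i j)
    (hK : Measurable (rootMeanSquare K)) {φ : VecL2 N μ} (hφ : IsCausalTest μ P K φ) :
    ∀ᵐ t ∂(volume.restrict (Ioi (0 : ℝ))), Integrable (fun x => testWeight μ P K φ (t, x)) μ ∧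
      ∀ᵐ x ∂μ, ∀ a, (rootMeanSquare K x ≠ 0 →
          conj (adjoint (Ω t) φ x a) = adjointTransform μ P φ a (t, x)) ∧
        ‖adjointTransform μ P φ a (t, x)‖ * rootMeanSquare K x ≤ testWeight μ P K φ (t, x) := by
  have h1 := ((measurePreserving_prodLeftComm μ (volume.restrict (Ioi (0 : ℝ)))
    μ).integrable_comp_of_integrable hφ).prod_right_ae
  have h2 := Measure.ae_ae_of_ae_prod hφ.ae_norm_adjointTransform_mul_le
  filter_upwards [h1, h2, ae_restrict_mem measurableSet_Ioi] with t ht1 ht2 ht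
  refine ⟨ht1.integral_prod_right, ?_⟩
  filter_upwards [ht2, ae_all_iff.2 fun a => (hΩ t (mem_Ioi.1 ht)).ae_adjoint_eq hP hK ht1 a]
    with x hx1 hx2 a
  exact ⟨hx2 a, hx1 a⟩

/-- A bound for a vector `v` given by the adjoint transform, in terms of the total weight. -/
lemma norm_mul_le_of_adjointTransform {φ : X → EuclideanSpace ℂ (Fin N)}
    {v : EuclideanSpace ℂ (Fin N)} {p : ℝ × X}
    (h : ∀ a, (rootMeanSquare K p.2 ≠ 0 → conj (v a) = adjointTransform μ P φ a p) ∧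
      ‖adjointTransform μ P φ a p‖ * rootMeanSquare K p.2 ≤ testWeight μ P K φ p) :
    ‖v‖ * rootMeanSquare K p.2 ≤ N * testWeight μ P K φ p := by
  have hv : ‖v‖ ≤ ∑ a, ‖v a‖ := by
    rw [EuclideanSpace.norm_eq]
    refine Real.sqrt_le_iff.2 ⟨Finset.sum_nonneg fun _ _ => norm_nonneg _, ?_⟩
    exact Finset.sum_sq_le_sq_sum_of_nonneg fun _ _ => norm_nonneg _
  calc ‖v‖ * rootMeanSquare K p.2 ≤ ∑ a, ‖v a‖ * rootMeanSquare K p.2 := by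
        rw [← Finset.sum_mul]
        exact mul_le_mul_of_nonneg_right hv (rootMeanSquare_nonneg K _)
    _ ≤ ∑ _a : Fin N, testWeight μ P K φ p := by
        refine Finset.sum_le_sum fun a _ => ?_
        by_cases h0 : rootMeanSquare K p.2 = 0
        · rw [h0, mul_zero]; exact testWeight_nonneg φ p
        · have h1 := (h a).2
          rwa [← (h a).1 h0, RCLike.norm_conj] at h1
    _ = _ := by simp

/-- The kernel formula for `R`, tested on `T^* φ` and `S^* ψ`, where `T = Ω(t)` and `S = Ω(s)` are
known only through the formulas for their adjoints. -/
lemma inner_adjoint_eq_integral [SigmaFinite μ] [SFinite ℙ] (hf : IsFunctionField ℙ f K)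
    {R S T : VecL2 N μ →L[ℂ] VecL2 N μ} {τ t s : ℝ}
    (hR : HasKernel μ R fun x y => K x y (τ + s - t)) {φ ψ : VecL2 N μ}
    (hφi : Integrable (fun x => testWeight μ P K φ (t, x)) μ)
    (hφ : ∀ᵐ x ∂μ, ∀ a, (rootMeanSquare K x ≠ 0 →
        conj (adjoint T φ x a) = adjointTransform μ P φ a (t, x)) ∧
      ‖adjointTransform μ P φ a (t, x)‖ * rootMeanSquare K x ≤ testWeight μ P K φ (t, x))
    (hψi : Integrable (fun x => testWeight μ P K ψ (s, x)) μ)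
    (hψ : ∀ᵐ x ∂μ, ∀ a, (rootMeanSquare K x ≠ 0 →
        conj (adjoint S ψ x a) = adjointTransform μ P ψ a (s, x)) ∧
      ‖adjointTransform μ P ψ a (s, x)‖ * rootMeanSquare K x ≤ testWeight μ P K ψ (s, x)) :
    inner ℂ φ (T (R (adjoint S ψ))) =
      ∫ z, ∑ a, ∑ b, transformedIntegrand μ P K φ ψ τ a b ((t, z.1), (s, z.2)) ∂(μ.prod μ) := by
  have hKm : ∀ i j, Measurable fun p : X × X => K p.1 p.2 (τ + s - t) i j := fun i j =>
    (hf.measurable_kernel i j).comp (by fun_prop : Measurable fun p : X × X => (p, τ + s - t))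
  have hKe : ∀ x y, entrySum (K x y (τ + s - t)) ≤
      N * N * (rootMeanSquare K x * rootMeanSquare K y) := fun x y =>
    (Finset.sum_le_sum fun i _ => Finset.sum_le_sum fun j _ =>
      hf.norm_kernel_le x y (τ + s - t) i j).trans_eq (by simp; ring)
  have hint : Integrable (fun p : X × X => ‖adjoint T φ p.1‖ *
      entrySum (K p.1 p.2 (τ + s - t)) * ‖adjoint S ψ p.2‖) (μ.prod μ) := by
    refine ((hφi.mul_prod hψi).const_mul ((N : ℝ) ^ 4)).mono' ?_ ?_
    · exact ((Lp.aestronglyMeasurable _).comp_fst.norm.mul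
        (measurable_entrySum hKm).aestronglyMeasurable).mul
        (Lp.aestronglyMeasurable _).comp_snd.norm
    · filter_upwards [Measure.quasiMeasurePreserving_fst.ae hφ,
        Measure.quasiMeasurePreserving_snd.ae hψ] with z h1 h2
      have h3 := norm_mul_le_of_adjointTransform (p := (t, z.1)) h1
      have h4 := norm_mul_le_of_adjointTransform (p := (s, z.2)) h2
      rw [Real.norm_of_nonneg (mul_nonneg (mul_nonneg (norm_nonneg _) (entrySum_nonneg _))
        (norm_nonneg _))]
      calc _ ≤ ‖adjoint T φ z.1‖ *
            (N * N * (rootMeanSquare K z.1 * rootMeanSquare K z.2)) *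
            ‖adjoint S ψ z.2‖ := by
            gcongr
            exact hKe _ _
        _ = N * N * ((‖adjoint T φ z.1‖ * rootMeanSquare K z.1) *
            (‖adjoint S ψ z.2‖ * rootMeanSquare K z.2)) := by ring
        _ ≤ N * N * ((N * testWeight μ P K φ (t, z.1)) * (N * testWeight μ P K ψ (s, z.2))) :=
            mul_le_mul_of_nonneg_left (mul_le_mul h3 h4
              (mul_nonneg (norm_nonneg _) (rootMeanSquare_nonneg K _))
              (mul_nonneg (Nat.cast_nonneg _) (testWeight_nonneg _ _))) (by positivity)
        _ = _ := by ring
  rw [← ContinuousLinearMap.adjoint_inner_left, hR.inner_eq hKm hint]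
  refine integral_congr_ae ?_
  filter_upwards [Measure.quasiMeasurePreserving_fst.ae hφ,
    Measure.quasiMeasurePreserving_snd.ae hψ] with z h1 h2
  refine Finset.sum_congr rfl fun a _ => Finset.sum_congr rfl fun b _ => ?_
  rw [transformedIntegrand]
  -- Where the source vanishes, the kernel `K` vanishes, and the transforms do not matter.
  have hK0 := hf.norm_kernel_le z.1 z.2 (τ + s - t) a b
  by_cases hx : rootMeanSquare K z.1 = 0
  · rw [hx, zero_mul, norm_le_zero_iff] at hK0
    simp only [hK0, mul_zero, zero_mul]
  by_cases hy : rootMeanSquare K z.2 = 0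
  · rw [hy, mul_zero, norm_le_zero_iff] at hK0
    simp only [hK0, mul_zero, zero_mul]
  simp only
  rw [← (h1 a).1 hx, ← (h2 b).1 hy, Complex.conj_conj]

/-- The correlation of the generalized field, tested on `φ` and `ψ`. -/
lemma integral_causalRegion_eq [SigmaFinite μ] [SFinite ℙ] (hf : IsFunctionField ℙ f K) {M k : ℝ}
    (h : IsDecayingSemigroup Ω M k) (hΩ : ∀ t, 0 < t → HasKernel μ (Ω t) (P t))
    (hP : ∀ i j, Measurable fun p : ℝ × X × X => P p.1 p.2.1 p.2.2 i j)
    {Kop : ℝ → VecL2 N μ →L[ℂ] VecL2 N μ} (hKop : IsCorrelationFamily Kop)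
    (hKer : ∀ σ, HasKernel μ (Kop σ) fun x y => K x y σ) {φ ψ : VecL2 N μ}
    (hφ : IsCausalTest μ P K φ) (hψ : IsCausalTest μ P K ψ) (τ : ℝ) :
    ∫ p in causalRegion τ, inner ℂ φ (Ω (p.1 + τ - p.2)
        (Kop p.2 (adjoint (Ω p.1) ψ))) =
      ∫ q, ∑ a, ∑ b, transformedIntegrand μ P K φ ψ τ a b q
        ∂((delayMeasure μ).prod (delayMeasure μ)) := by
  have hi := h.integrableOn_correlation hKop φ ψ τ
  rw [← integral_comp_of_measurePreserving (measurePreserving_delay τ) hi.aestronglyMeasurable]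
  have hD : Integrable (fun q => ∑ a, ∑ b, transformedIntegrand μ P K φ ψ τ a b q)
      ((delayMeasure μ).prod (delayMeasure μ)) :=
    integrable_finsetSum _ fun a _ => integrable_finsetSum _ fun b _ =>
      integrable_transformedIntegrand hf hP hφ hψ τ a b
  have hmp := measurePreserving_prodProdComm (volume.restrict (Ioi (0 : ℝ)))
    (volume.restrict (Ioi (0 : ℝ))) μ μ
  have hDc := hmp.integrable_comp_of_integrable hD
  have e := integral_comp_of_measurePreserving hmp hD.aestronglyMeasurable
  refine Eq.trans ?_ ((integral_prod _ hDc).symm.trans e)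
  have h1 := hφ.ae_adjoint_eq hΩ hP hf.measurable_rootMeanSquare
  have h2 := hψ.ae_adjoint_eq hΩ hP hf.measurable_rootMeanSquare
  refine integral_congr_ae ?_
  filter_upwards [Measure.quasiMeasurePreserving_fst.ae h1,
    Measure.quasiMeasurePreserving_snd.ae h2] with p hp1 hp2
  have e2 : p.2 + τ - (τ + p.2 - p.1) = p.1 := by ring
  simp only [e2]
  exact inner_adjoint_eq_integral hf (hKer _) hp1.1 hp1.2 hp2.1 hp2.2

lemma measurable_causalWeight [SFinite ℙ] (hf : IsFunctionField ℙ f K)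
    (hP : ∀ i j, Measurable fun p : ℝ × X × X => P p.1 p.2.1 p.2.2 i j) :
    Measurable fun r : X × (ℝ × X) => causalWeight P K r.1 r.2 := by
  refine Measurable.mul ?_ (hf.measurable_rootMeanSquare.comp (by fun_prop :
    Measurable fun r : X × (ℝ × X) => r.2.2))
  exact measurable_entrySum fun i j => (hP i j).comp (by fun_prop :
    Measurable fun r : X × (ℝ × X) => (r.2.1, r.1, r.2.2))

/-- The points of the `n`-th spanning set of `X` at which the integral of the weight is at most `n`.
The weight is integrated as a function with values in `[0, ∞]`, so these points are admissible. -/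
def admissibleSet (μ : Measure X) [SigmaFinite μ] (P : ℝ → X → X → Matrix (Fin N) (Fin N) ℂ)
    (K : X → X → ℝ → Matrix (Fin N) (Fin N) ℂ) (n : ℕ) : Set X :=
  {A | ∫⁻ p, ENNReal.ofReal (causalWeight P K A p) ∂(delayMeasure μ) ≤ n} ∩ spanningSets μ n

lemma measurableSet_admissibleSet [SigmaFinite μ] [SFinite ℙ] (hf : IsFunctionField ℙ f K)
    (hP : ∀ i j, Measurable fun p : ℝ × X × X => P p.1 p.2.1 p.2.2 i j) (n : ℕ) :
    MeasurableSet (admissibleSet μ P K n) :=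
  (measurableSet_le (measurable_causalWeight hf hP).ennreal_ofReal.lintegral_prod_right'
    measurable_const).inter (measurableSet_spanningSets μ n)

lemma causalIntegrable_of_mem_admissibleSet [SigmaFinite μ] [SFinite ℙ]
    (hf : IsFunctionField ℙ f K)
    (hP : ∀ i j, Measurable fun p : ℝ × X × X => P p.1 p.2.1 p.2.2 i j) {n : ℕ} {A : X}
    (hA : A ∈ admissibleSet μ P K n) :
    CausalIntegrable μ P K A ∧ ∫ p, causalWeight P K A p ∂(delayMeasure μ) ≤ n := by
  have hm : Measurable (causalWeight P K A) := by
    have h := (measurable_causalWeight hf hP).comp (measurable_prodMk_left (x := A))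
    exact h
  have hle : ∫⁻ p, ENNReal.ofReal (causalWeight P K A p) ∂(delayMeasure μ) ≤ n := hA.1
  have h0 : 0 ≤ᵐ[delayMeasure μ] causalWeight P K A := ae_of_all _ fun p => causalWeight_nonneg A p
  refine ⟨?_, ?_⟩
  · have : Integrable (causalWeight P K A) (delayMeasure μ) := by
      refine ⟨hm.aestronglyMeasurable, ?_⟩
      rw [hasFiniteIntegral_iff_ofReal h0]
      exact hle.trans_lt (ENNReal.natCast_lt_top n)
    exact this
  · rw [integral_eq_lintegral_of_nonneg_ae h0 hm.aestronglyMeasurable]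
    exact ENNReal.toReal_le_of_le_ofReal (Nat.cast_nonneg n) (by rwa [ENNReal.ofReal_natCast])

lemma ae_exists_mem_admissibleSet [SigmaFinite μ] (hadm : ∀ᵐ x ∂μ, CausalIntegrable μ P K x) :
    ∀ᵐ x ∂μ, ∃ n, x ∈ admissibleSet μ P K n := by
  filter_upwards [hadm] with x hx
  have h0 : 0 ≤ᵐ[delayMeasure μ] causalWeight P K x := ae_of_all _ fun p => causalWeight_nonneg x p
  have h1 := (hasFiniteIntegral_iff_ofReal h0).1 hx.integrable_causalWeight.2
  obtain ⟨m, hm⟩ := ENNReal.exists_nat_gt h1.ne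
  refine ⟨max m (spanningSetsIndex μ x), ?_,
    monotone_spanningSets μ (le_max_right _ _) (mem_spanningSetsIndex μ x)⟩
  exact hm.le.trans (by exact_mod_cast le_max_left _ _)

/-- Bounded functions on an exhausting set are causal test functions. -/
lemma isCausalTest_of_bounded [SigmaFinite μ] [SFinite ℙ] (hf : IsFunctionField ℙ f K)
    (hP : ∀ i j, Measurable fun p : ℝ × X × X => P p.1 p.2.1 p.2.2 i j) {n : ℕ} {φ : VecL2 N μ}
    (hφ : ∀ᵐ x ∂μ, x ∉ admissibleSet μ P K n → φ x = 0) {C : ℝ} (hC : ∀ᵐ x ∂μ, ‖φ x‖ ≤ C) :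
    IsCausalTest μ P K φ := by
  have hm : AEStronglyMeasurable (fun r : X × (ℝ × X) => ‖φ r.1‖ * causalWeight P K r.1 r.2)
      (μ.prod (delayMeasure μ)) :=
    (Lp.aestronglyMeasurable φ).comp_fst.norm.mul
      (measurable_causalWeight hf hP).aestronglyMeasurable
  have hS := measurableSet_admissibleSet (μ := μ) hf hP n
  have hSμ : μ (admissibleSet μ P K n) < ⊤ :=
    (measure_mono inter_subset_right).trans_lt (measure_spanningSets_lt_top μ n)
  refine (integrable_prod_iff hm).2 ⟨?_, ?_⟩
  · filter_upwards [hφ] with x hx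
    by_cases hxS : x ∈ admissibleSet μ P K n
    · exact (causalIntegrable_of_mem_admissibleSet hf hP hxS).1.integrable_causalWeight.const_mul _
    · simp [hx hxS]
  · have hi : Integrable ((admissibleSet μ P K n).indicator fun _ => C * n) μ :=
      (integrable_indicator_iff hS).2 (integrableOn_const hSμ.ne)
    refine hi.mono' hm.norm.integral_prod_right' ?_
    filter_upwards [hφ, hC] with x hx hxC
    rw [Real.norm_of_nonneg (integral_nonneg fun p => norm_nonneg _)]
    by_cases hxS : x ∈ admissibleSet μ P K n
    · have h2 := (causalIntegrable_of_mem_admissibleSet hf hP hxS).2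
      have e : ∀ p, ‖‖φ x‖ * causalWeight P K x p‖ = ‖φ x‖ * causalWeight P K x p := fun p =>
        Real.norm_of_nonneg (mul_nonneg (norm_nonneg _) (causalWeight_nonneg x p))
      simp only [indicator_of_mem hxS, e]
      rw [integral_const_mul]
      exact mul_le_mul hxC h2 (integral_nonneg fun p => causalWeight_nonneg x p)
        ((norm_nonneg _).trans hxC)
    · simp [hx hxS, indicator_of_notMem hxS]

lemma measurable_pointCorrelation [SFinite ℙ] [SFinite μ] (hf : IsFunctionField ℙ f K)
    (hP : ∀ i j, Measurable fun p : ℝ × X × X => P p.1 p.2.1 p.2.2 i j) (τ : ℝ) (i j : Fin N) :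
    Measurable fun z : X × X => pointCorrelation μ P K z.1 z.2 τ i j :=
  ((measurable_lagIntegrand hf hP τ i j).stronglyMeasurable.integral_prod_right'
    (ν := lagMeasure μ τ)).measurable

/-- If the matrix elements of `R` are given by the correlation formula for generalized sources, then
`R` has the Schwartz kernel `C_{A,B}(τ)`. -/
lemma hasKernel_pointCorrelation [SigmaFinite μ] [SFinite ℙ] (hf : IsFunctionField ℙ f K) {M k : ℝ}
    (h : IsDecayingSemigroup Ω M k) (hΩ : ∀ t, 0 < t → HasKernel μ (Ω t) (P t))
    (hP : ∀ i j, Measurable fun p : ℝ × X × X => P p.1 p.2.1 p.2.2 i j)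
    {Kop : ℝ → VecL2 N μ →L[ℂ] VecL2 N μ} (hKop : IsCorrelationFamily Kop)
    (hKer : ∀ σ, HasKernel μ (Kop σ) fun x y => K x y σ)
    (hadm : ∀ᵐ x ∂μ, CausalIntegrable μ P K x) {τ : ℝ} {R : VecL2 N μ →L[ℂ] VecL2 N μ}
    (hR : ∀ φ ψ, ∫ s in Ioi (0 : ℝ), ∫ σ in Iio (s + τ), inner ℂ φ (Ω (s + τ - σ)
      (Kop σ (adjoint (Ω s) ψ))) = inner ℂ φ (R ψ)) :
    HasKernel μ R (pointCorrelation μ P K · · τ) := by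
  refine ⟨admissibleSet μ P K, fun m n hmn => ?_, measurableSet_admissibleSet hf hP,
    fun n => (measure_mono inter_subset_right).trans_lt (measure_spanningSets_lt_top μ n),
    ae_exists_mem_admissibleSet hadm, fun n i j => ?_, ?_⟩
  · refine inter_subset_inter (fun A hA => ?_) (monotone_spanningSets μ hmn)
    have h : ∫⁻ p, ENNReal.ofReal (causalWeight P K A p) ∂(delayMeasure μ) ≤ m := hA
    exact h.trans (Nat.cast_le.2 hmn)
  · have hS := measurableSet_admissibleSet (μ := μ) hf hP n
    have hSμ : μ (admissibleSet μ P K n) < ⊤ :=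
      (measure_mono inter_subset_right).trans_lt (measure_spanningSets_lt_top μ n)
    refine Measure.integrableOn_of_bounded (M := (n : ℝ) * n) ?_
      (measurable_pointCorrelation hf hP τ i j).aestronglyMeasurable
      ((ae_restrict_iff' (hS.prod hS)).2 (ae_of_all _ fun z hz => ?_))
    · rw [Measure.prod_prod]
      exact (ENNReal.mul_lt_top hSμ hSμ).ne
    · obtain ⟨h1, h2⟩ := causalIntegrable_of_mem_admissibleSet hf hP (mem_prod.1 hz).1
      obtain ⟨h3, h4⟩ := causalIntegrable_of_mem_admissibleSet hf hP (mem_prod.1 hz).2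
      change ‖∫ q, lagIntegrand P K z.1 z.2 τ q i j ∂(lagMeasure μ τ)‖ ≤ _
      refine (norm_integral_le_integral_norm _).trans
        ((integrable_lagIntegrand hf hP h1 h3 τ i j).2.trans ?_)
      exact mul_le_mul h2 h4 (integral_nonneg fun p => causalWeight_nonneg _ p) (Nat.cast_nonneg n)
  · rintro n φ ψ hφ hψ ⟨C, hC⟩ ⟨C', hC'⟩
    have hφt := isCausalTest_of_bounded hf hP hφ hC
    have hψt := isCausalTest_of_bounded hf hP hψ hC'
    rw [← hR φ ψ, ← setIntegral_causalRegion (h.integrableOn_correlation hKop φ ψ τ),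
      integral_causalRegion_eq hf h hΩ hP hKop hKer hφt hψt τ,
      ← integral_kernelForm_pointCorrelation hf hP hφt hψt τ]
    rfl

end

end

end PassiveImaging

open PassiveImaging in
theorem mainTheorem1 {X : Type*} [MeasurableSpace X] (μ : Measure X) [SigmaFinite μ] (N : ℕ)
    {Ω₀ : Type*} [MeasurableSpace Ω₀] (ℙ : Measure Ω₀) [IsProbabilityMeasure ℙ]
    (Hop : VecL2 N μ →ₗ.[ℂ] VecL2 N μ) (Ω : ℝ → VecL2 N μ →L[ℂ] VecL2 N μ)
    (hΩ : IsExpSemigroup Hop Ω) (hdecay : DecaysExponentially Ω) :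
    -- Generalized source; all kernels are tested on square integrable functions `φ`, `ψ`.
    (∀ f : SpaceTimeL2 N μ → Ω₀ → ℂ, IsGeneralizedField ℙ f →
      IsStationaryFamily ℙ timeShift f → IsErgodicFamily ℙ timeShift f →
      -- Source with correlation kernel `K(x,y,σ)`.
      (∀ K : ℝ → VecL2 N μ →L[ℂ] VecL2 N μ, IsCorrelationFamily K → HasCorrelation ℙ f K →
        ∃ C : VecL2 N μ → VecL2 N μ → ℝ → ℂ, IsFieldCorrelation ℙ Ω f C ∧
          (∀ φ ψ τ, 0 < τ →
            IntegrableOn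
              (fun p : ℝ × ℝ => inner ℂ φ (Ω (p.1 + τ - p.2)
                (K p.2 (ContinuousLinearMap.adjoint (Ω p.1) ψ))))
              {p | 0 < p.1 ∧ p.2 < p.1 + τ} ∧
            C φ ψ τ = ∫ s in Ioi (0 : ℝ), ∫ σ in Iio (s + τ),
              inner ℂ φ (Ω (s + τ - σ) (K σ (ContinuousLinearMap.adjoint (Ω s) ψ)))) ∧
          (∀ φ ψ τ, C φ ψ (-τ) = conj (C ψ φ τ)) ∧
          (∀ t₀ : ℝ, 0 < t₀ → (∀ t, t₀ ≤ |t| → K t = 0) →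
            ∀ S : ℝ → VecL2 N μ →L[ℂ] VecL2 N μ, IsBackward Ω K t₀ S →
            (∀ v, IntegrableOn (fun t => S t v) (Icc (-t₀) t₀)) →
            ∃ 𝓛 Pi : VecL2 N μ →L[ℂ] VecL2 N μ,
              IsStrongIntegral (Icc (-t₀) t₀) S 𝓛 ∧
              IsStrongIntegral (Ioi 0)
                (fun s => Ω s ∘L 𝓛 ∘L ContinuousLinearMap.adjoint (Ω s)) Pi ∧
              ∀ φ ψ τ, t₀ < τ → C φ ψ τ = inner ℂ φ (Ω τ (Pi ψ)))) ∧
      -- Source that is white in time, with correlation kernel `L(x,y) δ(σ)`.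
      (∀ L : VecL2 N μ →L[ℂ] VecL2 N μ, HasWhiteCorrelation ℙ f L →
        ∃ C : VecL2 N μ → VecL2 N μ → ℝ → ℂ, IsFieldCorrelation ℙ Ω f C ∧
          (∀ φ ψ τ, 0 < τ →
            IntegrableOn
              (fun s => inner ℂ φ (Ω (s + τ) (L (ContinuousLinearMap.adjoint (Ω s) ψ))))
              (Ioi 0) ∧
            C φ ψ τ = ∫ s in Ioi (0 : ℝ),
              inner ℂ φ (Ω (s + τ) (L (ContinuousLinearMap.adjoint (Ω s) ψ)))) ∧
          (∀ φ ψ τ, C φ ψ (-τ) = conj (C ψ φ τ)) ∧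
          ∃ Pi : VecL2 N μ →L[ℂ] VecL2 N μ,
            IsStrongIntegral (Ioi 0)
              (fun s => Ω s ∘L L ∘L ContinuousLinearMap.adjoint (Ω s)) Pi ∧
            ∀ φ ψ τ, 0 < τ → C φ ψ τ = inner ℂ φ (Ω τ (Pi ψ)))) ∧
    -- Source and kernels that are functions; pointwise formulas.
    (∀ (f : X × ℝ → Ω₀ → Fin N → ℂ) (K : X → X → ℝ → Matrix (Fin N) (Fin N) ℂ)
      (P : ℝ → X → X → Matrix (Fin N) (Fin N) ℂ), IsFunctionField ℙ f K →
      IsStationaryFamily ℙ (fun t p => (p.1, p.2 + t)) f →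
      IsErgodicFamily ℙ (fun t p => (p.1, p.2 + t)) f →
      (∀ i j, Measurable fun p : ℝ × X × X => P p.1 p.2.1 p.2.2 i j) →
      (∀ t, 0 < t → HasKernel μ (Ω t) (P t)) →
      ∃ C : X → X → ℝ → Matrix (Fin N) (Fin N) ℂ,
        (∀ A B, CausalIntegrable μ P K A → CausalIntegrable μ P K B →
          (∀ τ i j, HasTimeCorrelation ℙ (fun t ω => causalSolution μ P f A t ω i)
            (fun t ω => causalSolution μ P f B t ω j) τ (C A B τ i j)) ∧
          (∀ τ, 0 < τ → ∀ i j,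
            Integrable
              (fun q : (ℝ × ℝ) × (X × X) =>
                (P (q.1.1 + τ - q.1.2) A q.2.1 * K q.2.1 q.2.2 q.1.2 *
                  (P q.1.1 B q.2.2).conjTranspose) i j)
              ((volume.restrict {p : ℝ × ℝ | 0 < p.1 ∧ p.2 < p.1 + τ}).prod (μ.prod μ)) ∧
            C A B τ i j = ∫ s in Ioi (0 : ℝ), ∫ σ in Iio (s + τ), ∫ z : X × X,
              (P (s + τ - σ) A z.1 * K z.1 z.2 σ * (P s B z.2).conjTranspose) i j
                ∂(μ.prod μ)) ∧
          (∀ τ, C A B (-τ) = (C B A τ).conjTranspose)) ∧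
        (∀ Kop : ℝ → VecL2 N μ →L[ℂ] VecL2 N μ, IsCorrelationFamily Kop →
          (∀ σ, HasKernel μ (Kop σ) fun x y => K x y σ) →
          (∀ᵐ x ∂μ, CausalIntegrable μ P K x) →
          ∀ t₀ : ℝ, 0 < t₀ → (∀ x y t, t₀ ≤ |t| → K x y t = 0) →
          ∀ S : ℝ → VecL2 N μ →L[ℂ] VecL2 N μ, IsBackward Ω Kop t₀ S →
          (∀ v, IntegrableOn (fun t => S t v) (Icc (-t₀) t₀)) →
          ∃ 𝓛 Pi : VecL2 N μ →L[ℂ] VecL2 N μ,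
            IsStrongIntegral (Icc (-t₀) t₀) S 𝓛 ∧
            IsStrongIntegral (Ioi 0)
              (fun s => Ω s ∘L 𝓛 ∘L ContinuousLinearMap.adjoint (Ω s)) Pi ∧
            ∀ τ, t₀ < τ → HasKernel μ (Ω τ ∘L Pi) (C · · τ))) := by
  obtain ⟨M, k, h⟩ := hΩ.exists_isDecayingSemigroup hdecay
  refine ⟨fun f hf hstat herg => ⟨fun K hK hfK => ?_, fun L hfL => ?_⟩,
    fun f K P hf hstat herg hP hker => ?_⟩
  · refine ⟨fieldCorrelation ℙ h f, isFieldCorrelation_fieldCorrelation h hf hstat herg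
      (HasCorrelation.isMeanSquareBounded hK hfK),
      fun φ ψ τ _ => ⟨h.integrableOn_correlation hK φ ψ τ, hfK.fieldCorrelation_eq h hK φ ψ τ⟩,
      fun φ ψ τ => fieldCorrelation_neg h hf hstat herg φ ψ τ, fun t₀ ht₀ hK0 S hS hSi => ?_⟩
    obtain ⟨𝓛, Pi, h𝓛, hPi, hform⟩ := h.exists_backward_sandwich hK0 hS hSi
    refine ⟨𝓛, Pi, h𝓛, hPi, fun φ ψ τ hτ => ?_⟩
    rw [hfK.fieldCorrelation_eq h hK, hform φ ψ τ hτ (ht₀.trans hτ)]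
  · obtain ⟨Pi, hPi, hform⟩ := h.exists_sandwich L
    refine ⟨fieldCorrelation ℙ h f, isFieldCorrelation_fieldCorrelation h hf hstat herg
      hfL.isMeanSquareBounded,
      fun φ ψ τ hτ => ⟨(hform φ ψ τ hτ.le).1, hfL.fieldCorrelation_eq h φ ψ hτ.le⟩,
      fun φ ψ τ => fieldCorrelation_neg h hf hstat herg φ ψ τ, Pi, hPi, fun φ ψ τ hτ => ?_⟩
    rw [hfL.fieldCorrelation_eq h φ ψ hτ.le, (hform φ ψ τ hτ.le).2]
  · refine ⟨pointCorrelation μ P K, fun A B hA hB => ⟨fun τ i j => ?_, fun τ _ i j => ⟨?_, ?_⟩,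
      fun τ => ?_⟩, fun Kop hKop hKer hadm t₀ ht₀ hK0 S hS hSi => ?_⟩
    · exact hasTimeCorrelation_causalSolution hf hstat herg hP hA hB τ i j
    · exact (integrable_lagIntegrand hf hP hA hB τ i j).1
    · exact pointCorrelation_eq_iterated hf hP hA hB τ i j
    · exact pointCorrelation_neg hf hstat herg hP hA hB τ
    · obtain ⟨𝓛, Pi, h𝓛, hPi, hform⟩ := h.exists_backward_sandwich
        (fun t ht => (hKer t).eq_zero fun x y => hK0 x y t ht) hS hSi
      exact ⟨𝓛, Pi, h𝓛, hPi, fun τ hτ => hasKernel_pointCorrelation hf h hker hP hKop hKer hadm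
        fun φ ψ => hform φ ψ τ hτ (ht₀.trans hτ)⟩
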